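/- **Setting.** Let $q_0=(\tfrac1{\sqrt3},1)$, $q_1=(0,0)$, $q_2=(\tfrac2{\sqrt3},0)$, $F_i(x)=\tfrac12(x+q_i)$, let $\mathcal{SG}$ be the Sierpinski gasket, i.e. the unique nonempty compact set with $\mathcal{SG}=\bigcup_{i=0}^2F_i\mathcal{SG}$, and let $V_0=\{q_0,q_1,q_2\}$, $V_{m+1}=\bigcup_iF_iV_m$, $F_w=F_{w_1}\circ\cdots\circ F_{w_m}$ for a word $w$. Put $\mathcal E_m(u,v)=(\tfrac53)^m\sum_{x\sim_m y}(u(x)-u(y))(v(x)-v(y))$, where $x\sim_m y$ runs over the sides of the $m$-cells $F_w\mathcal{SG}$, $|w|=m$, and $\mathcal E(u,v)=\lim_m\mathcal E_m(u,v)$. For a relatively open $\Omega\subseteq\mathcal{SG}$, "$\Delta u=0$ in $\Omega$" means that $u$ has finite energy on every cell contained in $\Omega$ and $\mathcal E(u,v)=0$ for every continuous $v$ of finite energy whose support is a compact subset of $\Omega$. The normal derivative at $q_i\in V_0$ is $\partial_nu(q_i)=\lim_m(\tfrac53)^m\big(2u(q_i)-u(F_i^mq_{i+1})-u(F_i^mq_{i-1})\big)$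 (indices mod $3$). Let $0\le\lambda<1$ have binary expansion $\lambda=\sum_{k\ge1}e_k(\lambda)2^{-k}$ without infinitely many consecutive $1$'s, and $S\lambda=\sum_{k\ge1}e_{k+1}(\lambda)2^{-k}$. Let $\Omega_\lambda^-=\{(x,y)\in\mathcal{SG}\setminus V_0: y<1-\lambda\}$ and $X_\lambda=\{(x,y)\in\mathcal{SG}:y=1-\lambda\}$. Let $X_\lambda^-=X_\lambda$ if $\lambda$ is not a dyadic rational, and $X_\lambda^-=V_{d}\cap X_\lambda$ if it is, where $d\ge0$ is the smallest integer such that $\lambda$ is a multiple of $2^{-d}$. Let $\partial\Omega_\lambda^-=X_\lambda^-\cup\{q_1,q_2\}$ and $\bar\Omega_\lambda^-=\Omega_\lambda^-\cup\partial\Omega_\lambda^-$. For $f\in C(\partial\Omega_\lambda^-)$, a solution of the Dirichlet problem is a $u\in C(\bar\Omega_\lambda^-)$ with $\Delta u=0$ in $\Omega_\lambda^-$ and $u=f$ on $\partial\Omega_\lambda^-$. Let $h_1^\lambda$ be the solution with boundary values $1$ at $q_1$ and $0$ on the rest of $\partial\Omega_\lambda^-$, and put $\eta_1(\lambda)=\partial_nh_1^\lambda(q_1)$,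 $\eta_2(\lambda)=-\partial_nh_1^\lambda(q_2)$. With $a=\eta_1(S\lambda)$, $b=\eta_2(S\lambda)$ let $$M_0^\lambda=\frac1{6+4a+4b}\begin{pmatrix}3+3a+3b&3+a+b\\3+a+b&3+3a+3b\end{pmatrix},\quad M_1^\lambda=\begin{pmatrix}1&0\\-\frac b{2a}&\frac b{2a}\end{pmatrix},\quad M_2^\lambda=\begin{pmatrix}\frac b{2a}&-\frac b{2a}\\0&1\end{pmatrix},$$ and $M_w^\lambda=M_{w_m}^{S^{m-1}\lambda}\cdots M_{w_2}^{S\lambda}M_{w_1}^\lambda$. Let $\mu_1^\lambda,\mu_2^\lambda$ be the unique Borel probability measures on $X_\lambda^-$ with $$\mu_i^\lambda(F_w\mathcal{SG}\cap X_\lambda^-)=\frac1{\eta_1(\lambda)-\eta_2(\lambda)}(1,1)M_w^\lambda c_i,\qquad c_1=\begin{pmatrix}\eta_1(\lambda)\\-\eta_2(\lambda)\end{pmatrix},\ c_2=\begin{pmatrix}-\eta_2(\lambda)\\\eta_1(\lambda)\end{pmatrix},$$ for every finite word $w$ with $w_k=0$ if $e_k(\lambda)=0$ and $w_k\in\{1,2\}$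 if $e_k(\lambda)=1$. **Theorem 4.6 (Extension Algorithm).** Let $0\le\lambda<1$ and $f\in C(\partial\Omega_\lambda^-)$. The Dirichlet problem on $\Omega_\lambda^-$ with boundary data $f$ has a unique solution $u$. The functions $h_1^{S\lambda}$, the normal derivatives defining $\eta_1(S\lambda),\eta_2(S\lambda)$, and the measures $\mu_1^{S\lambda},\mu_2^{S\lambda}$ are well defined. With $a=\eta_1(S\lambda)$, $b=\eta_2(S\lambda)$, $D=4a^2+14a-2b-4b^2+12$ one has $a>0$, $D>0$, and the following formulas. (i) If $e_1(\lambda)=0$, then $V_1\cap\Omega_\lambda^-=\{F_0q_1,F_0q_2,F_1q_2\}$ and $$u(F_0q_1)=\tfrac{9+5a+b}{D}f(q_1)+\tfrac{3+a+5b}{D}f(q_2)+\tfrac{(7+4a)(a-b)}{D}\int_{X_{S\lambda}^-}f\circ F_0\,d\mu_1^{S\lambda}+\tfrac{(1+4b)(a-b)}{D}\int_{X_{S\lambda}^-}f\circ F_0\,d\mu_2^{S\lambda},$$ $$u(F_0q_2)=\tfrac{9+5a+b}{D}f(q_2)+\tfrac{3+a+5b}{D}f(q_1)+\tfrac{(7+4a)(a-b)}{D}\int_{X_{S\lambda}^-}f\circ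 F_0\,d\mu_2^{S\lambda}+\tfrac{(1+4b)(a-b)}{D}\int_{X_{S\lambda}^-}f\circ F_0\,d\mu_1^{S\lambda},$$ $$u(F_1q_2)=\tfrac14\big(u(F_0q_1)+u(F_0q_2)+f(q_1)+f(q_2)\big).$$ (ii) If $e_1(\lambda)=1$, then $V_1\cap\Omega_\lambda^-=\{F_1q_2\}$ and $$u(F_1q_2)=\tfrac{b}{2a}\big(f(q_1)+f(q_2)\big)+\tfrac{a-b}{2a}\Big(\int_{X_{S\lambda}^-}f\circ F_1\,d\mu_2^{S\lambda}+\int_{X_{S\lambda}^-}f\circ F_2\,d\mu_1^{S\lambda}\Big).$$ -/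

import Mathlib

open Set Filter Topology MeasureTheory

namespace SGLower

/-- The Euclidean plane; `x 0` is the horizontal and `x 1` the vertical coordinate. -/
abbrev Plane : Type := EuclideanSpace ℝ (Fin 2)

/-- The boundary vertices `q₀ = (1/√3, 1)`, `q₁ = (0, 0)`, `q₂ = (2/√3, 0)`. -/
noncomputable def q : Fin 3 → Plane :=
  ![!₂[1 / Real.sqrt 3, 1], !₂[0, 0], !₂[2 / Real.sqrt 3, 0]]

/-- The contraction of ratio `1/2` with fixed point `qᵢ`. -/
noncomputable def F (i : Fin 3) (x : Plane) : Plane := (1 / 2 : ℝ) • (x + q i)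

/-- `F_w = F_{w₁} ∘ ⋯ ∘ F_{w_m}` for a finite word `w = w₁ ⋯ w_m`. -/
noncomputable def cellMap : List (Fin 3) → Plane → Plane
  | [] => id
  | i :: w => F i ∘ cellMap w

/-- The vertex sets `V_m`: `V_0 = {q₀, q₁, q₂}` and `V_{m+1} = ⋃ᵢ Fᵢ V_m`. -/
noncomputable def V : ℕ → Set Plane
  | 0 => range q
  | m + 1 => ⋃ i, F i '' V m

/-- The Sierpinski gasket, as the closure of `V_* = ⋃ V_m`.
The lemma `eq_SG_iff` shows that it is the unique nonempty compact set with `K = ⋃ᵢ Fᵢ K`. -/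
noncomputable def SG : Set Plane := closure (⋃ m, V m)

theorem F_fixed (i : Fin 3) : F i (q i) = q i := by
  unfold F
  rw [← two_smul ℝ (q i), smul_smul]
  norm_num

theorem dist_F (i : Fin 3) (x y : Plane) : dist (F i x) (F i y) = (1 / 2) * dist x y := by
  simp only [F, dist_smul₀, dist_add_right]
  norm_num

theorem continuous_F (i : Fin 3) : Continuous (F i) := by
  unfold F
  fun_prop

theorem dist_cellMap (w : List (Fin 3)) (x y : Plane) :
    dist (cellMap w x) (cellMap w y) = (1 / 2) ^ w.length * dist x y := by
  induction w with
  | nil => simp [cellMap]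
  | cons i w ih =>
    simp only [cellMap, Function.comp_apply, dist_F, ih, List.length_cons, pow_succ]
    ring

theorem exists_cellMap {K : Set Plane} (hK : K = ⋃ i, F i '' K) (n : ℕ) :
    ∀ x ∈ K, ∃ w : List (Fin 3), w.length = n ∧ ∃ y ∈ K, cellMap w y = x := by
  induction n with
  | zero => exact fun x hx => ⟨[], rfl, x, hx, rfl⟩
  | succ n ih =>
    intro x hx
    rw [hK] at hx
    obtain ⟨i, y, hy, rfl⟩ := mem_iUnion.1 hx
    obtain ⟨w, hw, z, hz, rfl⟩ := ih y hy
    exact ⟨i :: w, by simp [hw], z, hz, rfl⟩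

theorem cellMap_mem {K : Set Plane} (hK : K = ⋃ i, F i '' K) (w : List (Fin 3)) :
    ∀ x ∈ K, cellMap w x ∈ K := by
  induction w with
  | nil => exact fun x hx => hx
  | cons i w ih =>
    intro x hx
    rw [hK]
    exact mem_iUnion.2 ⟨i, _, ih x hx, rfl⟩

theorem subset_of_selfSimilar {K L : Set Plane} (hK : IsCompact K) (hKF : K = ⋃ i, F i '' K)
    (hL : IsCompact L) (hLn : L.Nonempty) (hLF : L = ⋃ i, F i '' L) : K ⊆ L := by
  intro x hx
  obtain ⟨z, hz⟩ := hLn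
  obtain ⟨C, hC⟩ := (hK.isBounded).exists_norm_le
  rw [← hL.isClosed.closure_eq, Metric.mem_closure_iff]
  intro ε hε
  have ht : Tendsto (fun n : ℕ => (1 / 2 : ℝ) ^ n * (C + ‖z‖)) atTop (𝓝 0) := by
    have := (tendsto_pow_atTop_nhds_zero_of_lt_one (r := (1 / 2 : ℝ))
      (by norm_num) (by norm_num)).mul_const (C + ‖z‖)
    simpa using this
  obtain ⟨n, hn⟩ := (ht.eventually (gt_mem_nhds hε)).exists
  obtain ⟨w, hw, y, hy, rfl⟩ := exists_cellMap hKF n x hx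
  refine ⟨cellMap w z, cellMap_mem hLF w z hz, ?_⟩
  rw [dist_cellMap, hw]
  refine lt_of_le_of_lt ?_ hn
  refine mul_le_mul_of_nonneg_left ?_ (by positivity)
  exact (dist_le_norm_add_norm y z).trans (by linarith [hC y hy])

theorem V_norm_le (m : ℕ) : ∀ x ∈ V m, ‖x‖ ≤ ∑ i, ‖q i‖ := by
  induction m with
  | zero =>
    rintro _ ⟨i, rfl⟩
    exact Finset.single_le_sum (f := fun i => ‖q i‖) (fun _ _ => norm_nonneg _)
      (Finset.mem_univ i)
  | succ m ih =>
    intro x hx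
    obtain ⟨i, y, hy, rfl⟩ := mem_iUnion.1 hx
    have h1 := ih y hy
    have h2 : ‖q i‖ ≤ ∑ i, ‖q i‖ :=
      Finset.single_le_sum (f := fun i => ‖q i‖) (fun _ _ => norm_nonneg _) (Finset.mem_univ i)
    have h3 := norm_add_le y (q i)
    have h4 : ‖F i y‖ = (1 / 2) * ‖y + q i‖ := by
      simp only [F, norm_smul]
      norm_num
    linarith

theorem isCompact_SG : IsCompact SG := by
  refine Bornology.IsBounded.isCompact_closure ?_
  refine isBounded_iff_forall_norm_le.2 ⟨∑ i, ‖q i‖, fun x hx => ?_⟩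
  obtain ⟨m, hm⟩ := mem_iUnion.1 hx
  exact V_norm_le m x hm

theorem SG_nonempty : SG.Nonempty :=
  ⟨q 0, subset_closure (mem_iUnion.2 ⟨0, 0, rfl⟩)⟩

theorem SG_selfSimilar : SG = ⋃ i, F i '' SG := by
  apply Subset.antisymm
  · refine closure_minimal ?_
      (isClosed_iUnion_of_finite fun i => (isCompact_SG.image (continuous_F i)).isClosed)
    intro x hx
    obtain ⟨m, hm⟩ := mem_iUnion.1 hx
    cases m with
    | zero =>
      obtain ⟨i, rfl⟩ := hm
      exact mem_iUnion.2 ⟨i, q i, subset_closure (mem_iUnion.2 ⟨0, i, rfl⟩), F_fixed i⟩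
    | succ m =>
      obtain ⟨i, y, hy, rfl⟩ := mem_iUnion.1 hm
      exact mem_iUnion.2 ⟨i, y, subset_closure (mem_iUnion.2 ⟨m, hy⟩), rfl⟩
  · refine iUnion_subset fun i => (image_closure_subset_closure_image (continuous_F i)).trans ?_
    refine closure_mono ?_
    rintro _ ⟨y, hy, rfl⟩
    obtain ⟨m, hm⟩ := mem_iUnion.1 hy
    exact mem_iUnion.2 ⟨m + 1, mem_iUnion.2 ⟨i, y, hm, rfl⟩⟩

/-- `SG` is the unique nonempty compact set with `K = ⋃ᵢ Fᵢ K`. -/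
theorem eq_SG_iff (K : Set Plane) :
    K = SG ↔ K.Nonempty ∧ IsCompact K ∧ K = ⋃ i, F i '' K := by
  constructor
  · rintro rfl
    exact ⟨SG_nonempty, isCompact_SG, SG_selfSimilar⟩
  · rintro ⟨h1, h2, h3⟩
    exact Subset.antisymm
      (subset_of_selfSimilar h2 h3 isCompact_SG SG_nonempty SG_selfSimilar)
      (subset_of_selfSimilar isCompact_SG SG_selfSimilar h2 h1 h3)

/-! ### Energy -/

/-- The graph energy `E_m(u, v) = (5/3)^m ∑_{x ∼ₘ y} (u x - u y) (v x - v y)`.  The edges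
`x ∼ₘ y` are the sides of the `m`-cells, and each edge is a side of exactly one `m`-cell,
so the sum over edges is the sum over the words of length `m` and the three sides of a cell. -/
noncomputable def graphEnergy (m : ℕ) (u v : Plane → ℝ) : ℝ :=
  (5 / 3 : ℝ) ^ m * ∑ w : Fin m → Fin 3, ∑ i : Fin 3,
    (u (cellMap (List.ofFn w) (q i)) - u (cellMap (List.ofFn w) (q (i + 1)))) *
    (v (cellMap (List.ofFn w) (q i)) - v (cellMap (List.ofFn w) (q (i + 1))))

/-- The energy `E(u) = lim E_m(u, u)` is finite.  Only the values of `u` on `V_*` matter. -/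
def FiniteEnergy (u : Plane → ℝ) : Prop :=
  ∃ e : ℝ, Tendsto (fun m => graphEnergy m u u) atTop (𝓝 e)

/-- Test functions of a relatively open set `Ω ⊆ SG`: elements of the domain of the energy
whose support is contained in a compact subset of `Ω`. -/
def IsTestFunction (Ω : Set Plane) (v : Plane → ℝ) : Prop :=
  ContinuousOn v SG ∧ FiniteEnergy v ∧ ∃ K ⊆ Ω, IsCompact K ∧ ∀ x ∈ SG \ K, v x = 0

/-- `Δ u = 0` in a relatively open set `Ω ⊆ SG`, in the weak formulation: `u` has locally
finite energy in `Ω` (finite energy on every cell contained in `Ω`), and `E(u, v) = 0` for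
every test function `v` of `Ω`.  (For large `m` the sum `E_m(u, v)` only involves values of `u`
in `Ω`, because `v` is supported in a compact subset of `Ω`.) -/
def IsHarmonicIn (Ω : Set Plane) (u : Plane → ℝ) : Prop :=
  (∀ w : List (Fin 3), cellMap w '' SG ⊆ Ω → FiniteEnergy (u ∘ cellMap w)) ∧
  ∀ v, IsTestFunction Ω v → Tendsto (fun m => graphEnergy m u v) atTop (𝓝 0)

/-- The normal derivative of `u` at `qᵢ` exists and equals `d`. -/
def HasNormalDeriv (u : Plane → ℝ) (i : Fin 3) (d : ℝ) : Prop :=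
  Tendsto (fun m : ℕ => (5 / 3 : ℝ) ^ m *
    (2 * u (q i) - u ((F i)^[m] (q (i + 1))) - u ((F i)^[m] (q (i - 1))))) atTop (𝓝 d)

/-- The normal derivative of `u` at `qᵢ`: the limit in `HasNormalDeriv`. -/
noncomputable def normalDeriv (u : Plane → ℝ) (i : Fin 3) : ℝ :=
  limUnder atTop (fun m : ℕ => (5 / 3 : ℝ) ^ m *
    (2 * u (q i) - u ((F i)^[m] (q (i + 1))) - u ((F i)^[m] (q (i - 1)))))

/-! ### Lower domains -/

/-- The binary digit `e_{k+1}(lam)` of `lam ∈ [0, 1)` (so `digit lam 0` is the first digit),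
for the expansion without infinitely many consecutive `1`s. -/
noncomputable def digit (lam : ℝ) (k : ℕ) : Fin 2 := Real.digits lam 2 k

/-- `S lam = ∑ₖ e_{k+1}(lam) 2⁻ᵏ`, the shift of the binary expansion. -/
noncomputable def shift (lam : ℝ) : ℝ := Real.ofDigits (fun k => digit lam (k + 1))

/-- The lower domain `Ω_lam⁻`. -/
def lowerDomain (lam : ℝ) : Set Plane := {x | x ∈ SG \ V 0 ∧ x 1 < 1 - lam}

/-- The horizontal slice `X_lam` of the gasket. -/
def slice (lam : ℝ) : Set Plane := {x | x ∈ SG ∧ x 1 = 1 - lam}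

/-- `lam` is a multiple of `2⁻ᵈ`. -/
def IsDyadicOfLevel (lam : ℝ) (d : ℕ) : Prop := ∃ k : ℤ, lam = k / 2 ^ d

open Classical in
/-- The upper part `X_lam⁻` of the boundary: `V_{d(lam)} ∩ X_lam` if `lam` is a dyadic rational
and `d(lam)` is the smallest `d` with `lam` a multiple of `2⁻ᵈ`; otherwise `X_lam`. -/
noncomputable def upperBoundary (lam : ℝ) : Set Plane :=
  if h : ∃ d, IsDyadicOfLevel lam d then V (Nat.find h) ∩ slice lam else slice lam

/-- The boundary `∂Ω_lam⁻ = X_lam⁻ ∪ {q₁, q₂}`. -/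
noncomputable def lowerBoundary (lam : ℝ) : Set Plane := upperBoundary lam ∪ {q 1, q 2}

/-- The closed domain `Ω_lam⁻ ∪ ∂Ω_lam⁻`. -/
noncomputable def closedLowerDomain (lam : ℝ) : Set Plane := lowerDomain lam ∪ lowerBoundary lam

/-- `u` solves the Dirichlet problem on `Ω_lam⁻`: it is continuous on the closed domain,
`Δ u = 0` in `Ω_lam⁻`, and `u = f` on `∂Ω_lam⁻`. -/
def IsDirichletSolution (lam : ℝ) (f u : Plane → ℝ) : Prop :=
  ContinuousOn u (closedLowerDomain lam) ∧ IsHarmonicIn (lowerDomain lam) u ∧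
    ∀ x ∈ lowerBoundary lam, u x = f x

/-! ### The coefficients and the boundary measures -/

/-- The boundary data `1` at `q₁`, `0` at `q₂` and on `X_lam⁻`. -/
noncomputable def data₁ : Plane → ℝ := indicator {q 1} (fun _ => 1)

/-- `h₁^lam`: a solution of the Dirichlet problem with value `1` at `q₁` and `0` on the rest of
the boundary.  Its values outside the closed domain play no role. -/
noncomputable def h₁ (lam : ℝ) : Plane → ℝ :=
  Classical.epsilon (IsDirichletSolution lam data₁)

/-- `η₁(lam) = ∂ₙ h₁(q₁)`. -/
noncomputable def η₁ (lam : ℝ) : ℝ := normalDeriv (h₁ lam) 1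

/-- `η₂(lam) = - ∂ₙ h₁(q₂)`. -/
noncomputable def η₂ (lam : ℝ) : ℝ := -normalDeriv (h₁ lam) 2

/-- The matrices `M_0`, `M_1`, `M_2`, where `a = η₁(S lam)` and `b = η₂(S lam)`. -/
noncomputable def stepMatrix (a b : ℝ) : Fin 3 → Matrix (Fin 2) (Fin 2) ℝ :=
  ![!![(3 + 3 * a + 3 * b) / (6 + 4 * a + 4 * b), (3 + a + b) / (6 + 4 * a + 4 * b);
       (3 + a + b) / (6 + 4 * a + 4 * b), (3 + 3 * a + 3 * b) / (6 + 4 * a + 4 * b)],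
    !![1, 0;
       -(b / (2 * a)), b / (2 * a)],
    !![b / (2 * a), -(b / (2 * a));
       0, 1]]

/-- `M_w^lam = M_{w_m}^{S^{m-1} lam} ⋯ M_{w₂}^{S lam} M_{w₁}^lam`. -/
noncomputable def wordMatrix : ℝ → List (Fin 3) → Matrix (Fin 2) (Fin 2) ℝ
  | _, [] => 1
  | lam, i :: w =>
      wordMatrix (shift lam) w * stepMatrix (η₁ (shift lam)) (η₂ (shift lam)) i

/-- The words `w` with `w_k = 0` if `e_k(lam) = 0` and `w_k ∈ {1, 2}` if `e_k(lam) = 1`. -/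
def IsBoundaryWord (lam : ℝ) (w : List (Fin 3)) : Prop :=
  ∀ (k : ℕ) (hk : k < w.length), w[k] = 0 ↔ digit lam k = 0

/-- `μ` is a Borel probability measure on `X_lam⁻` with
`μ(X_w) = (1, 1) M_w c / (η₁(lam) - η₂(lam))`, `X_w = F_w SG ∩ X_lam⁻`, for all boundary
words `w`. -/
def IsBoundaryMeasure (lam : ℝ) (c : Fin 2 → ℝ) (μ : Measure Plane) : Prop :=
  IsProbabilityMeasure μ ∧ μ (upperBoundary lam)ᶜ = 0 ∧
  ∀ w : List (Fin 3), IsBoundaryWord lam w →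
    μ.real (cellMap w '' SG ∩ upperBoundary lam) =
      1 / (η₁ lam - η₂ lam) *
        dotProduct ![(1 : ℝ), 1] (Matrix.mulVec (wordMatrix lam w) c)

/-- The coefficient vector `(η₁, -η₂)` of the first boundary measure. -/
noncomputable def coeff₁ (lam : ℝ) : Fin 2 → ℝ := ![η₁ lam, -η₂ lam]

/-- The coefficient vector `(-η₂, η₁)` of the second boundary measure. -/
noncomputable def coeff₂ (lam : ℝ) : Fin 2 → ℝ := ![-η₂ lam, η₁ lam]

/-- The measure `μ₁^lam`. -/
noncomputable def μ₁ (lam : ℝ) : Measure Plane :=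
  Classical.epsilon (IsBoundaryMeasure lam (coeff₁ lam))

/-- The measure `μ₂^lam`. -/
noncomputable def μ₂ (lam : ℝ) : Measure Plane :=
  Classical.epsilon (IsBoundaryMeasure lam (coeff₂ lam))

/-- The denominator in the formula for `u(F₀ q₁)`, where `a = η₁(S lam)`, `b = η₂(S lam)`. -/
noncomputable def denom (a b : ℝ) : ℝ := 4 * a ^ 2 + 14 * a - 2 * b - 4 * b ^ 2 + 12

end SGLower

/-!
The proof replaces the unknown solution by an explicit one and checks that it is the solution.

*Responses.*  By self-similarity, the response of the lower domain of `lam` (how boundary values at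
`q 1`, `q 2` determine the normal derivatives there, for zero data on the upper boundary) is a
rational function of the response of the lower domain of `shift lam`.  In the coordinates
`symResponse = η₁ - η₂` and `antiResponse = η₁ + η₂` (symmetric and antisymmetric data)
each digit acts by an explicit monotone map, so iterating the recursion from the values at `lam = 0`
converges to a solution of the recursion with `1 ≤ η₁ - η₂` and `3 ≤ η₁ + η₂`.

*Harmonic means.*  In the same way the data on the upper boundary enter only through two numbers
`mean₁`, `mean₂`.  Each is a convex combination of the corresponding means of the pieces of the
data, and so they are limits of finite averages, by uniform continuity of the data.

*Existence.*  With responses and means at hand, the formulas of the theorem say which values to put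
at the vertices of level one; a cell of the domain that meets the upper boundary is treated in the
same way, as a lower domain of `shift lam` with the restricted data, and every other cell carries a
harmonic function, extended by the `1/5`-`2/5` rule.  A `CellSystem` records such a recursive
prescription and `CellSystem.toFun` is the function it describes; it is continuous as soon as the
prescribed values on small cells have small oscillation (`CellSystem.continuousOn_toFun`).  The
recursions for responses and means are exactly the balance of the fluxes at the new vertices
(`State.isBalanced_lower`).

*Weak and strong harmonicity.*  Summation by parts writes the graph energy as a sum of fluxes, so
that `IsHarmonicIn` on the lower domain is the same as balance of the fluxes at all vertices in the
domain (`isBalanced_of_isHarmonicIn` and `isHarmonicIn_of_isBalanced`).  Balance gives a maximum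
principle, `IsBalanced.le_of_boundary`, and hence uniqueness, `IsDirichletSolution.eqOn`.
Consequently `η₁`, `η₂` are the numbers found from the recursion (`η₁_eq`, `η₂_eq`).

*Boundary measures.*  The means are positive linear functionals of continuous data, so they are
integrals for probability measures by the Riesz representation theorem.  The matrices `M_i`
transport the fluxes through the bottom corners from a domain to a cell (`stepMatrix_mulVec`), which
shows that these measures have the prescribed values on the pieces of the upper boundary.  The
values on the pieces determine the integrals of continuous functions, so the measures are unique,
and the integrals in the theorem are `mean₁` and `mean₂`.
-/

namespace SGLower

/-! ### Binary digits -/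

theorem digit_eq_zero_or_one (lam : ℝ) (k : ℕ) : digit lam k = 0 ∨ digit lam k = 1 := by
  generalize digit lam k = e
  fin_cases e <;> simp

theorem shift_eq {lam : ℝ} (h : lam ∈ Ico (0 : ℝ) 1) :
    shift lam = 2 * lam - (digit lam 0 : ℕ) := by
  have h1 := Real.ofDigits_digits (b := 2) (by norm_num) h
  rw [Real.ofDigits_eq_sum_add_ofDigits _ 1] at h1
  simp only [Finset.range_one, Finset.sum_singleton, Real.ofDigitsTerm] at h1
  simp only [shift, digit]
  norm_num at h1 ⊢
  linarith

theorem digit_zero_eq_zero_iff {lam : ℝ} (h : lam ∈ Ico (0 : ℝ) 1) :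
    digit lam 0 = 0 ↔ lam < 1 / 2 := by
  simp only [digit, Real.digits]
  norm_num
  constructor
  · intro h1
    by_contra h2
    have : ⌊lam * 2⌋₊ = 1 := by
      rw [Nat.floor_eq_iff (by linarith [h.1])]
      norm_num
      constructor <;> linarith [h.2]
    rw [this] at h1
    simp at h1
  · intro h1
    have : ⌊lam * 2⌋₊ = 0 := by
      rw [Nat.floor_eq_zero]
      linarith
    rw [this]
    exact dvd_zero 2

theorem lt_half_of_digit {lam : ℝ} (h : lam ∈ Ico (0 : ℝ) 1) (h0 : digit lam 0 = 0) :
    lam < 1 / 2 := (digit_zero_eq_zero_iff h).1 h0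

theorem half_le_of_digit {lam : ℝ} (h : lam ∈ Ico (0 : ℝ) 1) (h0 : digit lam 0 = 1) :
    1 / 2 ≤ lam := by
  by_contra h1
  rw [(digit_zero_eq_zero_iff h).2 (not_le.1 h1)] at h0
  simp at h0

theorem shift_of_digit_zero {lam : ℝ} (h : lam ∈ Ico (0 : ℝ) 1) (h0 : digit lam 0 = 0) :
    shift lam = 2 * lam := by
  rw [shift_eq h, h0]; simp

theorem shift_of_digit_one {lam : ℝ} (h : lam ∈ Ico (0 : ℝ) 1) (h0 : digit lam 0 = 1) :
    shift lam = 2 * lam - 1 := by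
  rw [shift_eq h, h0]; simp

theorem shift_mem {lam : ℝ} (h : lam ∈ Ico (0 : ℝ) 1) : shift lam ∈ Ico (0 : ℝ) 1 := by
  rcases digit_eq_zero_or_one lam 0 with h0 | h0
  · have := lt_half_of_digit h h0
    rw [shift_of_digit_zero h h0]
    exact ⟨by linarith [h.1], by linarith⟩
  · have := half_le_of_digit h h0
    rw [shift_of_digit_one h h0]
    exact ⟨by linarith, by linarith [h.2]⟩

theorem digit_shift {lam : ℝ} (h : lam ∈ Ico (0 : ℝ) 1) (k : ℕ) :
    digit (shift lam) k = digit lam (k + 1) := by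
  rw [shift_eq h]
  simp only [digit, Real.digits]
  generalize hm : ((Fin.ofNat 2 ⌊lam * ((2 : ℕ) : ℝ) ^ (0 + 1)⌋₊ : Fin 2) : ℕ) = e
  have h1 : lam * ((2 : ℕ) : ℝ) ^ (k + 1 + 1) =
      (2 * lam - e) * ((2 : ℕ) : ℝ) ^ (k + 1) + ((e * 2 ^ (k + 1) : ℕ) : ℝ) := by
    push_cast; ring
  have h2 : 0 ≤ 2 * lam - e := by
    have := (shift_mem h).1
    rw [shift_eq h] at this
    simp only [digit, Real.digits] at this
    rwa [hm] at this
  rw [h1, Nat.floor_add_natCast (by positivity)]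
  apply Fin.ext
  simp only [Fin.val_ofNat]
  rw [show e * 2 ^ (k + 1) = e * 2 ^ k * 2 by ring, Nat.add_mul_mod_self_right]

/-- Induction along the initial block of digits `1`: it is finite because `lam < 1`. -/
theorem digit_induction {P : ℝ → Prop}
    (zero : ∀ lam ∈ Ico (0 : ℝ) 1, digit lam 0 = 0 → P lam)
    (one : ∀ lam ∈ Ico (0 : ℝ) 1, digit lam 0 = 1 → P (shift lam) → P lam) :
    ∀ lam ∈ Ico (0 : ℝ) 1, P lam := by
  have key : ∀ (m : ℕ) (lam : ℝ), lam ∈ Ico (0 : ℝ) 1 → 1 < 2 ^ m * (1 - lam) → P lam := by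
    intro m
    induction m with
    | zero => intro lam h h1; linarith [h.1]
    | succ m ih =>
      intro lam h h1
      rcases digit_eq_zero_or_one lam 0 with h0 | h0
      · exact zero lam h h0
      · refine one lam h h0 (ih _ (shift_mem h) ?_)
        rw [shift_of_digit_one h h0]
        rw [pow_succ] at h1
        linarith
  intro lam h
  obtain ⟨m, hm⟩ := pow_unbounded_of_one_lt (1 / (1 - lam)) (one_lt_two (α := ℝ))
  refine key m lam h ?_
  rwa [div_lt_iff₀ (by linarith [h.2])] at hm

/-! ### Barycentric coordinates -/

/-- The barycentric coordinates with respect to `q₀, q₁, q₂`; the one of `q₀` is the height. -/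
noncomputable def bary (i : Fin 3) (x : Plane) : ℝ :=
  ![x 1, 1 - x 1 - (Real.sqrt 3 / 2 * x 0 - x 1 / 2), Real.sqrt 3 / 2 * x 0 - x 1 / 2] i

theorem bary_q (k i : Fin 3) : bary k (q i) = if k = i then 1 else 0 := by
  have h : Real.sqrt 3 ≠ 0 := by positivity
  fin_cases k <;> fin_cases i <;> simp [bary, q] <;> field_simp <;> norm_num

theorem bary_F (k i : Fin 3) (x : Plane) : bary k (F i x) = (bary k x + bary k (q i)) / 2 := by
  fin_cases k <;> simp [bary, F] <;> ring

theorem sum_bary (x : Plane) : bary 0 x + bary 1 x + bary 2 x = 1 := by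
  simp [bary]
  ring

theorem bary_ext {x y : Plane} (h : ∀ k, bary k x = bary k y) : x = y := by
  have h0 := h 0
  have h2 := h 2
  have h3 : 0 < Real.sqrt 3 := by positivity
  simp only [bary] at h0 h2
  simp at h0 h2
  ext k
  fin_cases k
  · simp
    rw [h0] at h2
    have : Real.sqrt 3 / 2 * x 0 = Real.sqrt 3 / 2 * y 0 := by linarith
    exact mul_left_cancel₀ (by positivity) this
  · exact h0

theorem continuous_bary (k : Fin 3) : Continuous (bary k) := by
  unfold bary
  fin_cases k <;> simp <;> fun_prop

theorem V_subset_SG (m : ℕ) : V m ⊆ SG := fun _ hx => subset_closure (mem_iUnion.2 ⟨m, hx⟩)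

theorem q_mem_SG (i : Fin 3) : q i ∈ SG := V_subset_SG 0 ⟨i, rfl⟩

theorem F_mem_SG (i : Fin 3) {x : Plane} (hx : x ∈ SG) : F i x ∈ SG := by
  rw [SG_selfSimilar]
  exact mem_iUnion.2 ⟨i, x, hx, rfl⟩

theorem cellMap_mem_SG (w : List (Fin 3)) {x : Plane} (hx : x ∈ SG) : cellMap w x ∈ SG :=
  cellMap_mem SG_selfSimilar w x hx

theorem exists_F_of_mem_SG {x : Plane} (hx : x ∈ SG) : ∃ i, ∃ y ∈ SG, F i y = x := by
  rw [SG_selfSimilar] at hx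
  obtain ⟨i, y, hy, rfl⟩ := mem_iUnion.1 hx
  exact ⟨i, y, hy, rfl⟩

theorem bary_nonneg (k : Fin 3) {x : Plane} (hx : x ∈ SG) : 0 ≤ bary k x := by
  have hV : ∀ m, ∀ x ∈ V m, 0 ≤ bary k x := by
    intro m
    induction m with
    | zero =>
      rintro _ ⟨i, rfl⟩
      rw [bary_q]
      split_ifs <;> norm_num
    | succ m ih =>
      intro x hx
      obtain ⟨i, y, hy, rfl⟩ := mem_iUnion.1 hx
      have := ih y hy
      rw [bary_F, bary_q]
      split_ifs <;> linarith
  have : SG ⊆ {x | 0 ≤ bary k x} :=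
    closure_minimal (iUnion_subset fun m x hx => hV m x hx)
      (isClosed_le continuous_const (continuous_bary k))
  exact this hx

theorem bary_le_one (k : Fin 3) {x : Plane} (hx : x ∈ SG) : bary k x ≤ 1 := by
  have h := sum_bary x
  have h0 := bary_nonneg 0 hx
  have h1 := bary_nonneg 1 hx
  have h2 := bary_nonneg 2 hx
  fin_cases k <;> simp <;> linarith

theorem eq_q_of_bary {k : Fin 3} {x : Plane} (hx : x ∈ SG) (h : 1 ≤ bary k x) : x = q k := by
  have hs := sum_bary x
  have h0 := bary_nonneg 0 hx
  have h1 := bary_nonneg 1 hx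
  have h2 := bary_nonneg 2 hx
  apply bary_ext
  intro j
  rw [bary_q]
  fin_cases k <;> fin_cases j <;> simp at h ⊢ <;> linarith

theorem F_injective (i : Fin 3) : Function.Injective (F i) := by
  intro x y h
  have := dist_F i x y
  rw [h, dist_self] at this
  exact dist_eq_zero.1 (by linarith)

theorem q_injective : Function.Injective q := by
  intro i j h
  have := bary_q i j
  rw [← h, bary_q] at this
  by_contra hij
  simp [hij] at this

/-- Two different cells of level one meet only in their common vertex. -/
theorem eq_q_of_F_eq {i j : Fin 3} (hij : i ≠ j) {x y : Plane} (hx : x ∈ SG) (hy : y ∈ SG)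
    (h : F i x = F j y) : x = q j ∧ y = q i := by
  have h1 := congrArg (bary i) h
  have h2 := congrArg (bary j) h
  simp only [bary_F, bary_q, if_pos, if_neg hij, if_neg hij.symm] at h1 h2
  exact ⟨eq_q_of_bary hx (by linarith [bary_nonneg j hy]),
    eq_q_of_bary hy (by linarith [bary_nonneg i hx])⟩

theorem F_q_comm (i j : Fin 3) : F i (q j) = F j (q i) := by
  simp only [F, add_comm]

theorem eq_of_F_eq_q {i j : Fin 3} {x : Plane} (hx : x ∈ SG) (h : F i x = q j) :
    i = j ∧ x = q j := by
  have h1 := congrArg (bary j) h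
  rw [bary_F, bary_q, bary_q] at h1
  have h2 := bary_le_one j hx
  by_cases hij : i = j
  · subst hij
    simp at h1
    exact ⟨rfl, eq_q_of_bary hx (by linarith)⟩
  · simp [Ne.symm hij] at h1
    linarith

/-! ### Words -/

theorem cellMap_append (v w : List (Fin 3)) : cellMap (v ++ w) = cellMap v ∘ cellMap w := by
  induction v with
  | nil => rfl
  | cons i v ih => simp [cellMap, ih, Function.comp_assoc]

theorem continuous_cellMap (w : List (Fin 3)) : Continuous (cellMap w) := by
  induction w with
  | nil => exact continuous_id
  | cons i w ih => exact (continuous_F i).comp ih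

theorem cellMap_replicate_q (i : Fin 3) (n : ℕ) : cellMap (List.replicate n i) (q i) = q i := by
  induction n with
  | zero => rfl
  | succ n ih => rw [List.replicate_succ]; simp [cellMap, ih, F_fixed]

theorem eq_replicate_of_cellMap_eq_q {w : List (Fin 3)} {a : Fin 3} {x : Plane} (hx : x ∈ SG)
    (h : cellMap w x = q a) : w = List.replicate w.length a ∧ x = q a := by
  induction w with
  | nil => exact ⟨rfl, h⟩
  | cons i w ih =>
    obtain ⟨rfl, h2⟩ := eq_of_F_eq_q (cellMap_mem_SG w hx) h
    obtain ⟨h3, h4⟩ := ih h2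
    exact ⟨by rw [List.length_cons, List.replicate_succ, ← h3], h4⟩

/-- Two different cells of the same level meet only in a common vertex, and the words of the
two cells differ as described. -/
theorem cellMap_eq_cellMap {w w' : List (Fin 3)} (hl : w.length = w'.length) {x y : Plane}
    (hx : x ∈ SG) (hy : y ∈ SG) (h : cellMap w x = cellMap w' y) :
    (w = w' ∧ x = y) ∨ ∃ (v : List (Fin 3)) (i j : Fin 3) (k : ℕ), i ≠ j ∧
      w = v ++ i :: List.replicate k j ∧ w' = v ++ j :: List.replicate k i ∧
      x = q j ∧ y = q i := by
  induction w generalizing w' with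
  | nil =>
    obtain rfl := List.length_eq_zero_iff.1 hl.symm
    exact Or.inl ⟨rfl, h⟩
  | cons i w ih =>
    cases w' with
    | nil => simp at hl
    | cons j w' =>
      have hl' : w.length = w'.length := by simpa using hl
      by_cases hij : i = j
      · subst hij
        rcases ih hl' (F_injective i h) with ⟨rfl, h2⟩ | ⟨v, a, b, k, h1, h2, h3, h4⟩
        · exact Or.inl ⟨rfl, h2⟩
        · exact Or.inr ⟨i :: v, a, b, k, h1, by simp [h2], by simp [h3], h4⟩
      · obtain ⟨h1, h2⟩ := eq_q_of_F_eq hij (cellMap_mem_SG w hx) (cellMap_mem_SG w' hy) h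
        obtain ⟨h3, h4⟩ := eq_replicate_of_cellMap_eq_q hx h1
        obtain ⟨h5, h6⟩ := eq_replicate_of_cellMap_eq_q hy h2
        exact Or.inr ⟨[], i, j, w.length, hij, by simp [← h3], by
          rw [hl']; simp [← h5], h4, h6⟩

/-- The height is an affine function on each cell, with slope `2^{-|w|}`. -/
theorem cellMap_height (w : List (Fin 3)) (x : Plane) :
    cellMap w x 1 = cellMap w (q 0) 1 - (1 / 2) ^ w.length * (1 - x 1) := by
  induction w with
  | nil =>
    have : q 0 1 = 1 := by simp [q]
    simp [cellMap, this]
  | cons i w ih =>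
    have h1 : ∀ z, F i z 1 = (z 1 + q i 1) / 2 := fun z => by
      simp [F]; ring
    simp only [cellMap, Function.comp_apply, h1, List.length_cons, pow_succ]
    rw [ih]
    ring

theorem F_height_zero (x : Plane) : F 0 x 1 = (x 1 + 1) / 2 := by
  simp [F, q]; ring

theorem F_height_of_ne {i : Fin 3} (hi : i ≠ 0) (x : Plane) : F i x 1 = x 1 / 2 := by
  fin_cases i
  · exact absurd rfl hi
  all_goals simp [F, q]; ring

theorem height_le_one {x : Plane} (hx : x ∈ SG) : x 1 ≤ 1 := bary_le_one 0 hx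

theorem height_nonneg {x : Plane} (hx : x ∈ SG) : 0 ≤ x 1 := bary_nonneg 0 hx

theorem q_zero_height : q 0 1 = 1 := by simp [q]

theorem q_height_of_ne {i : Fin 3} (hi : i ≠ 0) : q i 1 = 0 := by
  fin_cases i
  · exact absurd rfl hi
  all_goals simp [q]

/-! ### The upper boundary -/

theorem isDyadicOfLevel_succ {lam : ℝ} (h : lam ∈ Ico (0 : ℝ) 1) (d : ℕ) :
    IsDyadicOfLevel lam (d + 1) ↔ IsDyadicOfLevel (shift lam) d := by
  rw [shift_eq h]
  generalize (digit lam 0 : ℕ) = e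
  constructor
  · rintro ⟨k, hk⟩
    refine ⟨k - e * 2 ^ d, ?_⟩
    rw [hk, pow_succ]
    push_cast
    field_simp
  · rintro ⟨k, hk⟩
    refine ⟨k + e * 2 ^ d, ?_⟩
    have : lam = (k / 2 ^ d + e) / 2 := by linarith
    rw [this, pow_succ]
    push_cast
    field_simp

theorem isDyadicOfLevel_zero {lam : ℝ} (h : lam ∈ Ico (0 : ℝ) 1) :
    IsDyadicOfLevel lam 0 ↔ lam = 0 := by
  constructor
  · rintro ⟨k, hk⟩
    simp only [pow_zero, div_one] at hk
    have h1 : (-1 : ℝ) < k := by linarith [h.1]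
    have h2 : (k : ℝ) < 1 := by linarith [h.2]
    have h3 : k = 0 := by
      have : -1 < k := by exact_mod_cast h1
      have : k < 1 := by exact_mod_cast h2
      omega
    rw [hk, h3]; simp
  · rintro rfl
    exact ⟨0, by simp⟩

theorem shift_zero : shift 0 = 0 := by
  have h : (0 : ℝ) ∈ Ico (0 : ℝ) 1 := by simp
  rw [shift_of_digit_zero h ((digit_zero_eq_zero_iff h).2 (by norm_num))]
  simp

theorem upperBoundary_of_not_dyadic {lam : ℝ} (h : ¬ ∃ d, IsDyadicOfLevel lam d) :
    upperBoundary lam = slice lam := by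
  rw [upperBoundary, dif_neg h]

theorem upperBoundary_of_isLeast {lam : ℝ} {d : ℕ} (h : IsDyadicOfLevel lam d)
    (h' : ∀ m < d, ¬ IsDyadicOfLevel lam m) : upperBoundary lam = V d ∩ slice lam := by
  classical
  rw [upperBoundary, dif_pos ⟨d, h⟩, (Nat.find_eq_iff ⟨d, h⟩).2 ⟨h, h'⟩]

theorem mem_slice_zero {lam : ℝ} (h : lam ∈ Ico (0 : ℝ) 1) (h0 : digit lam 0 = 0) {x : Plane}
    (hx : x ∈ SG) : F 0 x ∈ slice lam ↔ x ∈ slice (shift lam) := by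
  rw [slice, slice, shift_of_digit_zero h h0]
  simp only [mem_ofPred_eq, F_mem_SG 0 hx, hx, F_height_zero, true_and]
  constructor <;> intro h <;> linarith

theorem mem_slice_one {lam : ℝ} (h : lam ∈ Ico (0 : ℝ) 1) (h0 : digit lam 0 = 1) {x : Plane}
    (hx : x ∈ SG) {i : Fin 3} (hi : i ≠ 0) : F i x ∈ slice lam ↔ x ∈ slice (shift lam) := by
  rw [slice, slice, shift_of_digit_one h h0]
  simp only [mem_ofPred_eq, F_mem_SG i hx, hx, F_height_of_ne hi, true_and]
  constructor <;> intro h <;> linarith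

theorem notMem_slice_of_digit_zero {lam : ℝ} (h : lam ∈ Ico (0 : ℝ) 1) (h0 : digit lam 0 = 0)
    {x : Plane} (hx : x ∈ SG) {i : Fin 3} (hi : i ≠ 0) : F i x ∉ slice lam := by
  rintro ⟨-, h1⟩
  rw [F_height_of_ne hi] at h1
  linarith [height_le_one hx, lt_half_of_digit h h0]

theorem upperBoundary_zero_eq : upperBoundary 0 = {q 0} := by
  have h : (0 : ℝ) ∈ Ico (0 : ℝ) 1 := by simp
  rw [upperBoundary_of_isLeast ((isDyadicOfLevel_zero h).2 rfl) (by simp)]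
  ext x
  constructor
  · rintro ⟨⟨i, rfl⟩, -, h2⟩
    by_cases hi : i = 0
    · rw [hi]; rfl
    · rw [q_height_of_ne hi] at h2
      norm_num at h2
  · rintro rfl
    exact ⟨⟨0, rfl⟩, q_mem_SG 0, by simp [q_zero_height]⟩

/-- Either `lam` is not dyadic, or it is `0`, or it is dyadic of some least positive level. -/
theorem upperBoundary_cases {lam : ℝ} (h : lam ∈ Ico (0 : ℝ) 1) :
    (upperBoundary lam = slice lam ∧ upperBoundary (shift lam) = slice (shift lam) ∧
      lam ≠ 1 / 2) ∨ lam = 0 ∨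
    ∃ d, upperBoundary lam = V (d + 1) ∩ slice lam ∧
      upperBoundary (shift lam) = V d ∩ slice (shift lam) ∧ (lam = 1 / 2 → d = 0) := by
  by_cases hd : ∃ d, IsDyadicOfLevel lam d
  · classical
    right
    have hm : ∀ m < Nat.find hd, ¬ IsDyadicOfLevel lam m := fun m => Nat.find_min hd
    have hs := Nat.find_spec hd
    cases hn : Nat.find hd with
    | zero =>
      rw [hn, isDyadicOfLevel_zero h] at hs
      exact Or.inl hs
    | succ d =>
      rw [hn] at hs hm
      refine Or.inr ⟨d, upperBoundary_of_isLeast hs hm,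
        upperBoundary_of_isLeast ((isDyadicOfLevel_succ h d).1 hs) ?_, ?_⟩
      · intro m hmd hm'
        exact hm (m + 1) (by omega) ((isDyadicOfLevel_succ h m).2 hm')
      · rintro rfl
        by_contra h0
        exact hm 1 (by omega) ⟨1, by norm_num⟩
  · left
    refine ⟨upperBoundary_of_not_dyadic hd, upperBoundary_of_not_dyadic ?_, ?_⟩
    · rintro ⟨d, hd'⟩
      exact hd ⟨d + 1, (isDyadicOfLevel_succ h d).2 hd'⟩
    · rintro rfl
      exact hd ⟨1, 1, by norm_num⟩

theorem upperBoundary_of_digit_zero {lam : ℝ} (h : lam ∈ Ico (0 : ℝ) 1)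
    (h0 : digit lam 0 = 0) : upperBoundary lam = F 0 '' upperBoundary (shift lam) := by
  rcases upperBoundary_cases h with ⟨h1, h2, -⟩ | rfl | ⟨d, h1, h2, -⟩
  · rw [h1, h2]
    ext x
    constructor
    · intro hx
      obtain ⟨i, y, hy, rfl⟩ := exists_F_of_mem_SG hx.1
      by_cases hi : i = 0
      · subst hi
        exact ⟨y, (mem_slice_zero h h0 hy).1 hx, rfl⟩
      · exact absurd hx (notMem_slice_of_digit_zero h h0 hy hi)
    · rintro ⟨y, hy, rfl⟩
      exact (mem_slice_zero h h0 hy.1).2 hy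
  · rw [shift_zero, upperBoundary_zero_eq]
    simp [F_fixed]
  · rw [h1, h2]
    ext x
    constructor
    · rintro ⟨hx, hx'⟩
      obtain ⟨i, y, hy, rfl⟩ := mem_iUnion.1 hx
      by_cases hi : i = 0
      · subst hi
        exact ⟨y, ⟨hy, (mem_slice_zero h h0 (V_subset_SG _ hy)).1 hx'⟩, rfl⟩
      · exact absurd hx' (notMem_slice_of_digit_zero h h0 (V_subset_SG _ hy) hi)
    · rintro ⟨y, ⟨hy, hy'⟩, rfl⟩
      exact ⟨mem_iUnion.2 ⟨0, y, hy, rfl⟩, (mem_slice_zero h h0 hy'.1).2 hy'⟩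

theorem upperBoundary_of_digit_one {lam : ℝ} (h : lam ∈ Ico (0 : ℝ) 1)
    (h0 : digit lam 0 = 1) :
    upperBoundary lam = F 1 '' upperBoundary (shift lam) ∪ F 2 '' upperBoundary (shift lam) := by
  have hl := half_le_of_digit h h0
  -- A point of the top cell on the slice is possible only for `lam = 1 / 2`, at the bottom.
  have top : ∀ y ∈ SG, F 0 y ∈ slice lam → lam = 1 / 2 ∧ y 1 = 0 := by
    rintro y hy ⟨-, hy2⟩
    rw [F_height_zero] at hy2
    have := height_nonneg hy
    exact ⟨by linarith, by linarith⟩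
  have split : ∀ {y : Plane} {i : Fin 3} {A : Set Plane}, i ≠ 0 → y ∈ A →
      F i y ∈ F 1 '' A ∪ F 2 '' A := by
    intro y i A hi hy
    fin_cases i
    · exact absurd rfl hi
    · exact Or.inl ⟨y, hy, rfl⟩
    · exact Or.inr ⟨y, hy, rfl⟩
  rcases upperBoundary_cases h with ⟨h1, h2, h3⟩ | rfl | ⟨d, h1, h2, h3⟩
  · rw [h1, h2]
    ext x
    constructor
    · intro hx
      obtain ⟨i, y, hy, rfl⟩ := exists_F_of_mem_SG hx.1
      by_cases hi : i = 0
      · subst hi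
        exact absurd (top y hy hx).1 h3
      · exact split hi ((mem_slice_one h h0 hy hi).1 hx)
    · rintro (⟨y, hy, rfl⟩ | ⟨y, hy, rfl⟩)
      · exact (mem_slice_one h h0 hy.1 (by decide)).2 hy
      · exact (mem_slice_one h h0 hy.1 (by decide)).2 hy
  · norm_num at hl
  · rw [h1, h2]
    ext x
    constructor
    · rintro ⟨hx, hx'⟩
      obtain ⟨i, y, hy, rfl⟩ := mem_iUnion.1 hx
      by_cases hi : i = 0
      · subst hi
        obtain ⟨h4, h5⟩ := top y (V_subset_SG _ hy) hx'
        obtain rfl := h3 h4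
        obtain ⟨j, rfl⟩ := hy
        have hj : j ≠ 0 := by
          rintro rfl
          rw [q_zero_height] at h5
          norm_num at h5
        rw [F_q_comm] at hx' ⊢
        exact split hj ⟨⟨0, rfl⟩, (mem_slice_one h h0 (q_mem_SG 0) hj).1 hx'⟩
      · exact split hi ⟨hy, (mem_slice_one h h0 (V_subset_SG _ hy) hi).1 hx'⟩
    · rintro (⟨y, ⟨hy, hy'⟩, rfl⟩ | ⟨y, ⟨hy, hy'⟩, rfl⟩)
      · exact ⟨mem_iUnion.2 ⟨1, y, hy, rfl⟩, (mem_slice_one h h0 hy'.1 (by decide)).2 hy'⟩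
      · exact ⟨mem_iUnion.2 ⟨2, y, hy, rfl⟩, (mem_slice_one h h0 hy'.1 (by decide)).2 hy'⟩

theorem upperBoundary_subset_slice (lam : ℝ) : upperBoundary lam ⊆ slice lam := by
  unfold upperBoundary
  split_ifs
  · exact inter_subset_right
  · exact subset_rfl

theorem upperBoundary_subset_SG (lam : ℝ) : upperBoundary lam ⊆ SG :=
  fun _ hx => (upperBoundary_subset_slice lam hx).1

theorem height_of_mem_upperBoundary {lam : ℝ} {x : Plane} (hx : x ∈ upperBoundary lam) :
    x 1 = 1 - lam := (upperBoundary_subset_slice lam hx).2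

theorem finite_V (m : ℕ) : (V m).Finite := by
  induction m with
  | zero => exact finite_range q
  | succ m ih => exact finite_iUnion fun i => ih.image _

theorem isCompact_slice (lam : ℝ) : IsCompact (slice lam) := by
  have : slice lam = SG ∩ {x | bary 0 x = 1 - lam} := rfl
  rw [this]
  exact isCompact_SG.inter_right (isClosed_eq (continuous_bary 0) continuous_const)

theorem isCompact_upperBoundary (lam : ℝ) : IsCompact (upperBoundary lam) := by
  unfold upperBoundary
  split_ifs
  · exact ((finite_V _).inter_of_left _).isCompact
  · exact isCompact_slice lam

/-- The point of the upper boundary on the left edge of the gasket, written through its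
counterpart for `shift lam`. -/
theorem smul_q_zero_eq {lam : ℝ} (h : lam ∈ Ico (0 : ℝ) 1) :
    ∃ i, (1 - lam) • q 0 = F i ((1 - shift lam) • q 0) := by
  rcases digit_eq_zero_or_one lam 0 with h0 | h0
  · refine ⟨0, ?_⟩
    rw [shift_of_digit_zero h h0, F]
    module
  · refine ⟨1, ?_⟩
    have : q 1 = 0 := by
      ext i; fin_cases i <;> simp [q]
    rw [shift_of_digit_one h h0, F, this]
    module

theorem smul_q_zero_mem_SG {lam : ℝ} (h : lam ∈ Ico (0 : ℝ) 1) : (1 - lam) • q 0 ∈ SG := by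
  have key : ∀ (n : ℕ) (lam : ℝ), lam ∈ Ico (0 : ℝ) 1 →
      ∃ y ∈ SG, dist ((1 - lam) • q 0) y ≤ (1 / 2) ^ n * ‖q 0‖ := by
    intro n
    induction n with
    | zero =>
      intro lam h
      refine ⟨q 0, q_mem_SG 0, ?_⟩
      rw [dist_eq_norm, show (1 - lam) • q 0 - q 0 = (-lam) • q 0 by module, norm_smul]
      simp only [norm_neg, Real.norm_eq_abs, abs_of_nonneg h.1, pow_zero]
      exact mul_le_mul_of_nonneg_right h.2.le (norm_nonneg _)
    | succ n ih =>
      intro lam h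
      obtain ⟨y, hy, hd⟩ := ih _ (shift_mem h)
      obtain ⟨i, hi⟩ := smul_q_zero_eq h
      refine ⟨F i y, F_mem_SG i hy, ?_⟩
      rw [hi, dist_F, pow_succ]
      linarith
  rw [← isCompact_SG.isClosed.closure_eq, Metric.mem_closure_iff]
  intro ε hε
  have ht : Tendsto (fun n : ℕ => (1 / 2 : ℝ) ^ n * ‖q 0‖) atTop (𝓝 0) := by
    simpa using (tendsto_pow_atTop_nhds_zero_of_lt_one (r := (1 / 2 : ℝ))
      (by norm_num) (by norm_num)).mul_const ‖q 0‖
  obtain ⟨n, hn⟩ := (ht.eventually (gt_mem_nhds hε)).exists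
  obtain ⟨y, hy, hd⟩ := key n lam h
  exact ⟨y, hy, hd.trans_lt hn⟩

theorem smul_q_zero_mem_V {d : ℕ} {lam : ℝ} (h : lam ∈ Ico (0 : ℝ) 1)
    (hd : IsDyadicOfLevel lam d) : (1 - lam) • q 0 ∈ V d := by
  induction d generalizing lam with
  | zero =>
    rw [isDyadicOfLevel_zero h] at hd
    exact ⟨0, by simp [hd]⟩
  | succ d ih =>
    obtain ⟨i, hi⟩ := smul_q_zero_eq h
    rw [hi]
    exact mem_iUnion.2 ⟨i, _, ih (shift_mem h) ((isDyadicOfLevel_succ h d).1 hd), rfl⟩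

theorem smul_q_zero_mem_upperBoundary {lam : ℝ} (h : lam ∈ Ico (0 : ℝ) 1) :
    (1 - lam) • q 0 ∈ upperBoundary lam := by
  have hs : (1 - lam) • q 0 ∈ slice lam :=
    ⟨smul_q_zero_mem_SG h, by simp [q_zero_height]⟩
  classical
  unfold upperBoundary
  split_ifs with hd
  · exact ⟨smul_q_zero_mem_V h (Nat.find_spec hd), hs⟩
  · exact hs

theorem upperBoundary_nonempty {lam : ℝ} (h : lam ∈ Ico (0 : ℝ) 1) :
    (upperBoundary lam).Nonempty := ⟨_, smul_q_zero_mem_upperBoundary h⟩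

theorem F_mem_upperBoundary {lam : ℝ} (h : lam ∈ Ico (0 : ℝ) 1) {i : Fin 3}
    (hi : i = 0 ↔ digit lam 0 = 0) {x : Plane} (hx : x ∈ upperBoundary (shift lam)) :
    F i x ∈ upperBoundary lam := by
  rcases digit_eq_zero_or_one lam 0 with h0 | h0
  · rw [hi.2 h0, upperBoundary_of_digit_zero h h0]
    exact ⟨x, hx, rfl⟩
  · rw [upperBoundary_of_digit_one h h0]
    rw [h0] at hi
    fin_cases i
    · simp at hi
    · exact Or.inl ⟨x, hx, rfl⟩
    · exact Or.inr ⟨x, hx, rfl⟩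

theorem exists_of_mem_upperBoundary {lam : ℝ} (h : lam ∈ Ico (0 : ℝ) 1) {x : Plane}
    (hx : x ∈ upperBoundary lam) :
    ∃ i, (i = 0 ↔ digit lam 0 = 0) ∧ ∃ y ∈ upperBoundary (shift lam), F i y = x := by
  rcases digit_eq_zero_or_one lam 0 with h0 | h0
  · rw [upperBoundary_of_digit_zero h h0] at hx
    obtain ⟨y, hy, rfl⟩ := hx
    exact ⟨0, by simp [h0], y, hy, rfl⟩
  · rw [upperBoundary_of_digit_one h h0] at hx
    rcases hx with ⟨y, hy, rfl⟩ | ⟨y, hy, rfl⟩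
    · exact ⟨1, by simp [h0], y, hy, rfl⟩
    · exact ⟨2, by simp [h0], y, hy, rfl⟩

theorem q_notMem_upperBoundary {lam : ℝ} (h : lam ∈ Ico (0 : ℝ) 1) {i : Fin 3} (hi : i ≠ 0) :
    q i ∉ upperBoundary lam := by
  intro hx
  have := height_of_mem_upperBoundary hx
  rw [q_height_of_ne hi] at this
  linarith [h.2]

/-- Continuity on the upper boundary passes to its pieces. -/
theorem continuousOn_comp_F {lam : ℝ} (h : lam ∈ Ico (0 : ℝ) 1) {f : Plane → ℝ}
    (hf : ContinuousOn f (upperBoundary lam)) {i : Fin 3} (hi : i = 0 ↔ digit lam 0 = 0) :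
    ContinuousOn (f ∘ F i) (upperBoundary (shift lam)) :=
  hf.comp (continuous_F i).continuousOn fun _ hx => F_mem_upperBoundary h hi hx

/-! ### Functions on the gasket given by refinement rules -/

/-- A refinement rule for functions on the gasket.  A state prescribes the values of a function at
the three vertices `qᵢ`, and the states of its restrictions to the three cells `Fᵢ SG`; the values
prescribed by the children agree with those of the parent, and with each other where two cells
meet. -/
structure CellSystem (σ : Type) where
  /-- the vertex values prescribed by a state -/
  val : σ → Fin 3 → ℝ
  /-- the state of the restriction to `Fᵢ SG` -/
  child : σ → Fin 3 → σ
  corner : ∀ s i, val (child s i) i = val s i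
  glue : ∀ s i j, val (child s i) j = val (child s j) i

open Classical in
/-- The index of a cell of level one that contains `x`. -/
noncomputable def cellIndex (x : Plane) : Fin 3 :=
  if h : ∃ i, ∃ y ∈ SG, F i y = x then h.choose else 0

/-- The preimage of `x` under the contraction `F (cellIndex x)`. -/
noncomputable def expand (x : Plane) : Plane := (2 : ℝ) • x - q (cellIndex x)

theorem expand_spec {x : Plane} (hx : x ∈ SG) : expand x ∈ SG ∧ F (cellIndex x) (expand x) = x := by
  have h := exists_F_of_mem_SG hx
  have h1 : ∃ y ∈ SG, F (cellIndex x) y = x := by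
    rw [cellIndex, dif_pos h]
    exact h.choose_spec
  obtain ⟨y, hy, hyx⟩ := h1
  have : expand x = y := by
    rw [expand]
    nth_rewrite 1 [← hyx]
    rw [F]
    module
  rw [this]
  exact ⟨hy, hyx⟩

namespace CellSystem

variable {σ : Type} (S : CellSystem σ)

/-- The state of the restriction to the cell of a word. -/
def descend : σ → List (Fin 3) → σ
  | s, [] => s
  | s, i :: w => descend (S.child s i) w

/-- After finitely many subdivisions, all vertex values on each cell differ by at most `ε`. -/
inductive EventuallyNarrow (ε : ℝ) : σ → Prop
  | narrow (s : σ) (L : ℝ) (h : ∀ w i, S.val (S.descend s w) i ∈ Icc L (L + ε)) :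
      EventuallyNarrow ε s
  | split (s : σ) (h : ∀ i, EventuallyNarrow ε (S.child s i)) : EventuallyNarrow ε s

/-- A state is tame if its vertex values define a continuous function. -/
def Tame (s : σ) : Prop := ∀ ε > 0, S.EventuallyNarrow ε s

theorem EventuallyNarrow.child {S : CellSystem σ} {ε : ℝ} {s : σ} (h : S.EventuallyNarrow ε s)
    (i : Fin 3) : S.EventuallyNarrow ε (S.child s i) := by
  cases h with
  | narrow _ L h => exact .narrow _ L fun w j => h (i :: w) j
  | split _ h => exact h i

theorem Tame.child {S : CellSystem σ} {s : σ} (h : S.Tame s) (i : Fin 3) :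
    S.Tame (S.child s i) := fun ε hε => (h ε hε).child i

/-- The state of the `n`-th cell in a decreasing sequence of cells that contain `x`. -/
noncomputable def stateAt : ℕ → σ → Plane → σ
  | 0, s, _ => s
  | n + 1, s, x => stateAt n (S.child s (cellIndex x)) (expand x)

theorem stateAt_eq_descend (n : ℕ) (s : σ) (x : Plane) :
    ∃ w, S.stateAt n s x = S.descend s w := by
  induction n generalizing s x with
  | zero => exact ⟨[], rfl⟩
  | succ n ih =>
    obtain ⟨w, hw⟩ := ih (S.child s (cellIndex x)) (expand x)
    exact ⟨cellIndex x :: w, hw⟩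

/-- The function on the gasket with the vertex values prescribed by the state `s`. -/
noncomputable def toFun (s : σ) (x : Plane) : ℝ :=
  limUnder atTop (fun n => S.val (S.stateAt n s x) 0)

theorem EventuallyNarrow.cauchy {S : CellSystem σ} {ε : ℝ} {s : σ}
    (h : S.EventuallyNarrow ε s) (x : Plane) :
    ∃ N, ∀ n ≥ N, ∀ m ≥ N, |S.val (S.stateAt n s x) 0 - S.val (S.stateAt m s x) 0| ≤ ε := by
  induction h generalizing x with
  | narrow s L h =>
    refine ⟨0, fun n _ m _ => ?_⟩
    obtain ⟨w, hw⟩ := S.stateAt_eq_descend n s x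
    obtain ⟨v, hv⟩ := S.stateAt_eq_descend m s x
    have h1 := h w 0
    have h2 := h v 0
    rw [hw, hv, abs_le]
    constructor <;> linarith [h1.1, h1.2, h2.1, h2.2]
  | split s h ih =>
    obtain ⟨N, hN⟩ := ih (cellIndex x) (expand x)
    refine ⟨N + 1, fun n hn m hm => ?_⟩
    obtain ⟨n, rfl⟩ := Nat.exists_eq_add_of_le' (show 1 ≤ n by omega)
    obtain ⟨m, rfl⟩ := Nat.exists_eq_add_of_le' (show 1 ≤ m by omega)
    exact hN n (by omega) m (by omega)

theorem Tame.tendsto {S : CellSystem σ} {s : σ} (h : S.Tame s) (x : Plane) :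
    Tendsto (fun n => S.val (S.stateAt n s x) 0) atTop (𝓝 (S.toFun s x)) := by
  apply tendsto_nhds_limUnder
  apply cauchySeq_tendsto_of_complete
  rw [Metric.cauchySeq_iff']
  intro ε hε
  obtain ⟨N, hN⟩ := (h (ε / 2) (by linarith)).cauchy x
  refine ⟨N, fun n hn => ?_⟩
  rw [Real.dist_eq]
  linarith [hN n hn N le_rfl]

theorem toFun_expand {S : CellSystem σ} {s : σ} (h : S.Tame s) (x : Plane) :
    S.toFun s x = S.toFun (S.child s (cellIndex x)) (expand x) :=
  tendsto_nhds_unique ((tendsto_add_atTop_iff_nat 1).2 (h.tendsto x))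
    ((h.child _).tendsto (expand x))

theorem toFun_mem_Icc {S : CellSystem σ} {s : σ} (hs : S.Tame s) {L U : ℝ}
    (h : ∀ w i, S.val (S.descend s w) i ∈ Icc L U) (x : Plane) : S.toFun s x ∈ Icc L U := by
  refine isClosed_Icc.mem_of_tendsto (hs.tendsto x) (Eventually.of_forall fun n => ?_)
  obtain ⟨w, hw⟩ := S.stateAt_eq_descend n s x
  rw [hw]
  exact h w 0

theorem cellIndex_q (j : Fin 3) : cellIndex (q j) = j ∧ expand (q j) = q j := by
  obtain ⟨h1, h2⟩ := expand_spec (q_mem_SG j)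
  exact eq_of_F_eq_q h1 h2

theorem toFun_q {S : CellSystem σ} {s : σ} (hs : S.Tame s) (j : Fin 3) :
    S.toFun s (q j) = S.val s j := by
  have key : ∀ ε > 0, |S.toFun s (q j) - S.val s j| ≤ ε := by
    intro ε hε
    have h := hs ε hε
    induction h with
    | narrow s L h =>
      have h1 := toFun_mem_Icc hs h (q j)
      have h2 := h [] j
      rw [descend] at h2
      rw [abs_le]
      constructor <;> linarith [h1.1, h1.2, h2.1, h2.2]
    | split s h ih =>
      rw [toFun_expand hs, (cellIndex_q j).1, (cellIndex_q j).2, ← S.corner]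
      exact ih j (hs.child j)
  have : |S.toFun s (q j) - S.val s j| ≤ 0 := le_of_forall_pos_le_add (by simpa using key)
  exact sub_eq_zero.1 (abs_nonpos_iff.1 this)

theorem toFun_F {S : CellSystem σ} {s : σ} (hs : S.Tame s) (i : Fin 3) {y : Plane}
    (hy : y ∈ SG) : S.toFun s (F i y) = S.toFun (S.child s i) y := by
  obtain ⟨h1, h2⟩ := expand_spec (F_mem_SG i hy)
  rw [toFun_expand hs]
  by_cases hk : cellIndex (F i y) = i
  · rw [hk] at h2 ⊢
    rw [F_injective i h2]
  · obtain ⟨h3, h4⟩ := eq_q_of_F_eq hk h1 hy h2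
    rw [h3, congrArg (S.toFun (S.child s i)) h4, toFun_q (hs.child _), toFun_q (hs.child _), S.glue]

theorem toFun_cellMap {S : CellSystem σ} {s : σ} (hs : S.Tame s) (w : List (Fin 3)) {y : Plane}
    (hy : y ∈ SG) : S.toFun s (cellMap w y) = S.toFun (S.descend s w) y := by
  induction w generalizing s with
  | nil => rfl
  | cons i w ih =>
    rw [cellMap, Function.comp_apply, toFun_F hs i (cellMap_mem_SG w hy), ih (hs.child i)]
    rfl

theorem continuousOn_toFun {S : CellSystem σ} {s : σ} (hs : S.Tame s) :
    ContinuousOn (S.toFun s) SG := by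
  have key : ∀ ε > 0, ∀ x ∈ SG, ∀ᶠ y in 𝓝[SG] x, |S.toFun s y - S.toFun s x| ≤ ε := by
    intro ε hε
    have h := hs ε hε
    induction h with
    | narrow s L h =>
      refine fun x _ => Eventually.of_forall fun y => ?_
      have h1 := toFun_mem_Icc hs h x
      have h2 := toFun_mem_Icc hs h y
      rw [abs_le]
      constructor <;> linarith [h1.1, h1.2, h2.1, h2.2]
    | split s h ih =>
      intro x hx
      have hcell : ∀ i, ∀ᶠ y in 𝓝[SG] x, ∀ z ∈ SG, F i z = y →
          |S.toFun s y - S.toFun s x| ≤ ε := by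
        intro i
        by_cases hxi : x ∈ F i '' SG
        · obtain ⟨x', hx', rfl⟩ := hxi
          have h1 := eventually_nhdsWithin_iff.1 (ih i (hs.child i) x' hx')
          have h2 : Tendsto (fun y : Plane => (2 : ℝ) • y - q i) (𝓝 (F i x')) (𝓝 x') := by
            have : Continuous (fun y : Plane => (2 : ℝ) • y - q i) := by fun_prop
            convert! this.tendsto (F i x') using 2
            rw [F]
            module
          refine mem_nhdsWithin_of_mem_nhds ?_
          filter_upwards [h2.eventually h1] with y hy z hz hzy
          have h3 : (2 : ℝ) • y - q i = z := by
            rw [← hzy, F]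
            module
          rw [h3] at hy
          rw [← hzy, toFun_F hs i hz, toFun_F hs i hx']
          exact hy hz
        · have hcl : IsClosed (F i '' SG) := (isCompact_SG.image (continuous_F i)).isClosed
          refine mem_nhdsWithin_of_mem_nhds ?_
          filter_upwards [hcl.isOpen_compl.mem_nhds hxi] with y hy z hz hzy
          exact absurd ⟨z, hz, hzy⟩ hy
      filter_upwards [eventually_all.2 hcell, self_mem_nhdsWithin] with y hy hy'
      obtain ⟨i, z, hz, hzy⟩ := exists_F_of_mem_SG hy'
      exact hy i z hz hzy
  intro x hx
  rw [ContinuousWithinAt, Metric.tendsto_nhds]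
  intro ε hε
  filter_upwards [key (ε / 2) (by linarith) x hx] with y hy
  rw [Real.dist_eq]
  linarith

end CellSystem

/-! ### The response coefficients of a lower domain -/

/-- How the pair `(a - b, a + b)` for `shift lam` determines the pair for `lam`, where `a`, `b` are
the coefficients of the boundary response: for vanishing data on the upper boundary and values
`x₁`, `x₂` at `q₁`, `q₂`, the normal derivative at `q₁` is `a x₁ - b x₂`.  The components of the
pair are the responses to the data `(1, 1)` and `(1, -1)`. -/
noncomputable def responseStep (e : Fin 2) (c : ℝ × ℝ) : ℝ × ℝ :=
  if e = 0 then (5 * c.1 / (2 * c.1 + 3), 5 * (2 * c.2 + 3) / (3 * (c.2 + 2)))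
  else (10 * (c.1 * c.2) / (3 * (c.1 + c.2)), 5 * (c.1 + c.2) / 6)

/-- The response of the lower domain that results when the `n`-th shift of `lam` is replaced by
`0`. -/
noncomputable def responseApprox : ℕ → ℝ → ℝ × ℝ
  | 0, _ => (1, 3)
  | n + 1, lam => responseStep (digit lam 0) (responseApprox n (shift lam))

/-- The response `a - b` of the lower domain to symmetric data. -/
noncomputable def symResponse (lam : ℝ) : ℝ := ⨆ n, (responseApprox n lam).1

/-- The response `a + b` of the lower domain to antisymmetric data. -/
noncomputable def antiResponse (lam : ℝ) : ℝ := ⨆ n, (responseApprox n lam).2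

theorem responseStep_bounds (e : Fin 2) {c : ℝ × ℝ} (h1 : 1 ≤ c.1) (h2 : 3 ≤ c.2)
    (h3 : c.1 ≤ c.2) :
    1 ≤ (responseStep e c).1 ∧ 3 ≤ (responseStep e c).2 ∧
      (responseStep e c).1 ≤ (responseStep e c).2 := by
  obtain ⟨p, r⟩ := c
  simp only at h1 h2 h3
  unfold responseStep
  split_ifs
  · simp only
    refine ⟨?_, ?_, ?_⟩
    · rw [le_div_iff₀ (by linarith)]; linarith
    · rw [le_div_iff₀ (by linarith)]; linarith
    · rw [div_le_div_iff₀ (by linarith) (by linarith)]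
      nlinarith [mul_nonneg (by linarith : (0 : ℝ) ≤ p) (by linarith : (0 : ℝ) ≤ r)]
  · simp only
    refine ⟨?_, ?_, ?_⟩
    · rw [le_div_iff₀ (by linarith)]
      nlinarith [mul_nonneg (by linarith : (0 : ℝ) ≤ p - 1) (by linarith : (0 : ℝ) ≤ r - 3)]
    · linarith
    · rw [div_le_div_iff₀ (by linarith) (by linarith)]
      nlinarith [sq_nonneg (p - r)]

theorem responseStep_mono (e : Fin 2) {c d : ℝ × ℝ} (h1 : 1 ≤ c.1) (h2 : 3 ≤ c.2)
    (h3 : c.1 ≤ d.1) (h4 : c.2 ≤ d.2) :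
    (responseStep e c).1 ≤ (responseStep e d).1 ∧ (responseStep e c).2 ≤ (responseStep e d).2 := by
  obtain ⟨p, r⟩ := c
  obtain ⟨p', r'⟩ := d
  simp only at h1 h2 h3 h4
  unfold responseStep
  split_ifs
  · simp only
    constructor
    · rw [div_le_div_iff₀ (by linarith) (by linarith)]; nlinarith
    · rw [div_le_div_iff₀ (by linarith) (by linarith)]; nlinarith
  · simp only
    constructor
    · rw [div_le_div_iff₀ (by linarith) (by linarith)]
      have e1 : 0 ≤ p * p' * (r' - r) := by
        have : 0 ≤ p * p' := mul_nonneg (by linarith) (by linarith)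
        exact mul_nonneg this (by linarith)
      have e2 : 0 ≤ r * r' * (p' - p) := by
        have : 0 ≤ r * r' := mul_nonneg (by linarith) (by linarith)
        exact mul_nonneg this (by linarith)
      nlinarith
    · linarith

theorem responseApprox_bounds (n : ℕ) (lam : ℝ) :
    1 ≤ (responseApprox n lam).1 ∧ 3 ≤ (responseApprox n lam).2 ∧
      (responseApprox n lam).1 ≤ (responseApprox n lam).2 := by
  induction n generalizing lam with
  | zero => simp [responseApprox]
  | succ n ih =>
    obtain ⟨h1, h2, h3⟩ := ih (shift lam)
    exact responseStep_bounds _ h1 h2 h3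

theorem responseApprox_le {lam : ℝ} (h : lam ∈ Ico (0 : ℝ) 1) (n : ℕ) :
    (responseApprox n lam).2 ≤ 10 / 3 / (1 - lam) := by
  induction n generalizing lam with
  | zero =>
    rw [responseApprox, le_div_iff₀ (by linarith [h.2])]
    linarith [h.1]
  | succ n ih =>
    obtain ⟨h1, h2, h3⟩ := responseApprox_bounds n (shift lam)
    have ih' := ih (shift_mem h)
    have hs := shift_mem h
    rw [le_div_iff₀ (by linarith [h.2])]
    rw [le_div_iff₀ (by linarith [hs.2])] at ih'
    rcases digit_eq_zero_or_one lam 0 with h0 | h0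
    · rw [responseApprox, h0, responseStep, if_pos rfl]
      simp only
      have : 5 * (2 * (responseApprox n (shift lam)).2 + 3) /
          (3 * ((responseApprox n (shift lam)).2 + 2)) ≤ 10 / 3 := by
        rw [div_le_div_iff₀ (by linarith) (by norm_num)]
        linarith
      nlinarith [h.1, h.2]
    · rw [responseApprox, h0, responseStep, if_neg (by decide)]
      rw [shift_of_digit_one h h0] at ih' h3 h2 ⊢
      simp only
      nlinarith [h.1, h.2]

theorem responseApprox_mono (lam : ℝ) (n : ℕ) :
    (responseApprox n lam).1 ≤ (responseApprox (n + 1) lam).1 ∧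
      (responseApprox n lam).2 ≤ (responseApprox (n + 1) lam).2 := by
  induction n generalizing lam with
  | zero =>
    have := responseApprox_bounds 1 lam
    exact ⟨this.1, this.2.1⟩
  | succ n ih =>
    obtain ⟨h1, h2, -⟩ := responseApprox_bounds n (shift lam)
    obtain ⟨h3, h4⟩ := ih (shift lam)
    exact responseStep_mono _ h1 h2 h3 h4

theorem tendsto_symResponse {lam : ℝ} (h : lam ∈ Ico (0 : ℝ) 1) :
    Tendsto (fun n => (responseApprox n lam).1) atTop (𝓝 (symResponse lam)) := by
  refine tendsto_atTop_ciSup (monotone_nat_of_le_succ fun n => (responseApprox_mono lam n).1)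
    ⟨10 / 3 / (1 - lam), ?_⟩
  rintro _ ⟨n, rfl⟩
  exact (responseApprox_bounds n lam).2.2.trans (responseApprox_le h n)

theorem tendsto_antiResponse {lam : ℝ} (h : lam ∈ Ico (0 : ℝ) 1) :
    Tendsto (fun n => (responseApprox n lam).2) atTop (𝓝 (antiResponse lam)) := by
  refine tendsto_atTop_ciSup (monotone_nat_of_le_succ fun n => (responseApprox_mono lam n).2)
    ⟨10 / 3 / (1 - lam), ?_⟩
  rintro _ ⟨n, rfl⟩
  exact responseApprox_le h n

theorem one_le_symResponse {lam : ℝ} (h : lam ∈ Ico (0 : ℝ) 1) : 1 ≤ symResponse lam :=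
  ge_of_tendsto' (tendsto_symResponse h) fun n => (responseApprox_bounds n lam).1

theorem three_le_antiResponse {lam : ℝ} (h : lam ∈ Ico (0 : ℝ) 1) : 3 ≤ antiResponse lam :=
  ge_of_tendsto' (tendsto_antiResponse h) fun n => (responseApprox_bounds n lam).2.1

theorem symResponse_le_antiResponse {lam : ℝ} (h : lam ∈ Ico (0 : ℝ) 1) :
    symResponse lam ≤ antiResponse lam :=
  le_of_tendsto_of_tendsto' (tendsto_symResponse h) (tendsto_antiResponse h)
    fun n => (responseApprox_bounds n lam).2.2

theorem response_of_digit_zero {lam : ℝ} (h : lam ∈ Ico (0 : ℝ) 1) (h0 : digit lam 0 = 0) :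
    symResponse lam = 5 * symResponse (shift lam) / (2 * symResponse (shift lam) + 3) ∧
    antiResponse lam =
      5 * (2 * antiResponse (shift lam) + 3) / (3 * (antiResponse (shift lam) + 2)) := by
  have hs := shift_mem h
  have h1 := one_le_symResponse hs
  have h2 := three_le_antiResponse hs
  have t1 := tendsto_symResponse hs
  have t2 := tendsto_antiResponse hs
  constructor
  · refine tendsto_nhds_unique ((tendsto_add_atTop_iff_nat 1).2 (tendsto_symResponse h)) ?_
    simp only [responseApprox, h0, responseStep, if_pos]
    exact (t1.const_mul 5).div ((t1.const_mul 2).add_const 3) (by linarith)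
  · refine tendsto_nhds_unique ((tendsto_add_atTop_iff_nat 1).2 (tendsto_antiResponse h)) ?_
    simp only [responseApprox, h0, responseStep, if_pos]
    exact (((t2.const_mul 2).add_const 3).const_mul 5).div ((t2.add_const 2).const_mul 3)
      (by linarith)

theorem response_of_digit_one {lam : ℝ} (h : lam ∈ Ico (0 : ℝ) 1) (h0 : digit lam 0 = 1) :
    symResponse lam = 10 * (symResponse (shift lam) * antiResponse (shift lam)) /
      (3 * (symResponse (shift lam) + antiResponse (shift lam))) ∧
    antiResponse lam = 5 * (symResponse (shift lam) + antiResponse (shift lam)) / 6 := by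
  have hs := shift_mem h
  have h1 := one_le_symResponse hs
  have h2 := three_le_antiResponse hs
  have t1 := tendsto_symResponse hs
  have t2 := tendsto_antiResponse hs
  constructor
  · refine tendsto_nhds_unique ((tendsto_add_atTop_iff_nat 1).2 (tendsto_symResponse h)) ?_
    simp only [responseApprox, h0, responseStep, if_neg (show (1 : Fin 2) ≠ 0 by decide)]
    exact ((t1.mul t2).const_mul 10).div ((t1.add t2).const_mul 3) (by linarith)
  · refine tendsto_nhds_unique ((tendsto_add_atTop_iff_nat 1).2 (tendsto_antiResponse h)) ?_
    simp only [responseApprox, h0, responseStep, if_neg (show (1 : Fin 2) ≠ 0 by decide)]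
    exact ((t1.add t2).const_mul 5).div_const 6

/-! ### The harmonic means of the boundary data -/

/-- The value at `F₀ q₁` of a harmonic function in the case `digit lam 0 = 0`; here `p`, `r` are
the responses for `shift lam`, `x`, `x'` are the values at `q₁`, `q₂`, and `m`, `m'` are the two
harmonic means of the data on the upper boundary. -/
noncomputable def upperValue (p r x x' m m' : ℝ) : ℝ :=
  ((3 * (x + x') + 2 * p * (m + m')) / (2 * p + 3) + ((x - x') + p * (m - m')) / (r + 2)) / 2

/-- The value at `F₁ q₂` of a harmonic function in the case `digit lam 0 = 1`; here `m` and `m'`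
are the harmonic means of the data seen from the point `F₁ q₂` in the left and in the right
cell. -/
noncomputable def middleValue (p r x x' m m' : ℝ) : ℝ :=
  ((r - p) * (x + x') + 2 * p * (m + m')) / (2 * (p + r))

theorem upperValue_convex {p r : ℝ} (hp : 1 ≤ p) (hr : 3 ≤ r) (hpr : p ≤ r) :
    ∃ α β γ δ : ℝ, 0 ≤ α ∧ 0 ≤ β ∧ 0 ≤ γ ∧ 0 ≤ δ ∧ α + β + γ + δ = 1 ∧ α + β ≤ 3 / 5 ∧
      ∀ x x' m m', upperValue p r x x' m m' = α * x + β * x' + γ * m + δ * m' := by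
  have h1 : 0 < 2 * p + 3 := by linarith
  have h2 : 0 < r + 2 := by linarith
  refine ⟨(3 / (2 * p + 3) + 1 / (r + 2)) / 2, (3 / (2 * p + 3) - 1 / (r + 2)) / 2,
    p * (2 / (2 * p + 3) + 1 / (r + 2)) / 2, p * (2 / (2 * p + 3) - 1 / (r + 2)) / 2,
    by positivity, ?_, by positivity, ?_, by field_simp; ring, ?_, ?_⟩
  · have : 1 / (r + 2) ≤ 3 / (2 * p + 3) := by
      rw [div_le_div_iff₀ h2 h1]; linarith
    linarith
  · have : 1 / (r + 2) ≤ 2 / (2 * p + 3) := by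
      rw [div_le_div_iff₀ h2 h1]; linarith
    have h3 := mul_nonneg (by linarith : 0 ≤ p) (sub_nonneg.2 this)
    linarith
  · have : 3 / (2 * p + 3) ≤ 3 / 5 := by
      rw [div_le_div_iff₀ h1 (by norm_num)]; linarith
    linarith
  · intro x x' m m'
    unfold upperValue
    field_simp
    ring

theorem middleValue_convex {p r : ℝ} (hp : 1 ≤ p) (hr : 3 ≤ r) (hpr : p ≤ r) :
    ∃ α γ : ℝ, 0 ≤ α ∧ 0 ≤ γ ∧ 2 * α + 2 * γ = 1 ∧
      ∀ x x' m m', middleValue p r x x' m m' = α * x + α * x' + γ * m + γ * m' := by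
  have h1 : 0 < p + r := by linarith
  refine ⟨(r - p) / (2 * (p + r)), p / (p + r), div_nonneg (by linarith) (by linarith),
    by positivity, by field_simp; ring, fun x x' m m' => ?_⟩
  unfold middleValue
  field_simp
  ring

/-- The two harmonic means for `lam` in the case `digit lam 0 = 0`, in terms of those for
`shift lam`. -/
noncomputable def meanStepZero (p r : ℝ) (m : ℝ × ℝ) : ℝ × ℝ :=
  ((m.1 + m.2) / 2 + (2 * p + 3) / (3 * (r + 2)) * (m.1 - m.2) / 2,
    (m.1 + m.2) / 2 - (2 * p + 3) / (3 * (r + 2)) * (m.1 - m.2) / 2)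

/-- The two harmonic means for `lam` in the case `digit lam 0 = 1`, in terms of those of the left
piece `m` and of the right piece `m'` of the data. -/
noncomputable def meanStepOne (p r : ℝ) (m m' : ℝ × ℝ) : ℝ × ℝ :=
  ((2 * (p + r) * m.1 + (r - p) * (m.2 + m'.1)) / (4 * r),
    (2 * (p + r) * m'.2 + (r - p) * (m.2 + m'.1)) / (4 * r))

/-- Approximations of the harmonic means of boundary data `f`, by repeated averaging down to
level `n`. -/
noncomputable def meanApprox : ℕ → ℝ → (Plane → ℝ) → ℝ × ℝ
  | 0, lam, f => (f ((1 - lam) • q 0), f ((1 - lam) • q 0))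
  | n + 1, lam, f =>
    if digit lam 0 = 0 then
      meanStepZero (symResponse (shift lam)) (antiResponse (shift lam))
        (meanApprox n (shift lam) (f ∘ F 0))
    else
      meanStepOne (symResponse (shift lam)) (antiResponse (shift lam))
        (meanApprox n (shift lam) (f ∘ F 1)) (meanApprox n (shift lam) (f ∘ F 2))

/-- The harmonic mean of the data `f` on the upper boundary, as seen from `q₁`: it is the integral
of `f` for the first boundary measure. -/
noncomputable def mean₁ (lam : ℝ) (f : Plane → ℝ) : ℝ :=
  limUnder atTop (fun n => (meanApprox n lam f).1)

/-- The harmonic mean of the data `f` on the upper boundary, as seen from `q₂`. -/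
noncomputable def mean₂ (lam : ℝ) (f : Plane → ℝ) : ℝ :=
  limUnder atTop (fun n => (meanApprox n lam f).2)

theorem meanStepZero_convex {p r : ℝ} (hp : 1 ≤ p) (hr : 3 ≤ r) (hpr : p ≤ r) :
    ∃ α β : ℝ, 0 ≤ α ∧ 0 ≤ β ∧ α + β = 1 ∧
      ∀ m, meanStepZero p r m = (α * m.1 + β * m.2, β * m.1 + α * m.2) := by
  have h1 : 0 < 3 * (r + 2) := by linarith
  have h2 : (2 * p + 3) / (3 * (r + 2)) ≤ 1 := by
    rw [div_le_one h1]; linarith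
  have h3 : 0 ≤ (2 * p + 3) / (3 * (r + 2)) := by positivity
  refine ⟨(1 + (2 * p + 3) / (3 * (r + 2))) / 2, (1 - (2 * p + 3) / (3 * (r + 2))) / 2,
    by linarith, by linarith, by ring, fun m => ?_⟩
  unfold meanStepZero
  ext <;> simp only <;> ring

theorem meanStepOne_convex {p r : ℝ} (hp : 1 ≤ p) (hr : 3 ≤ r) (hpr : p ≤ r) :
    ∃ α β : ℝ, 0 ≤ α ∧ 0 ≤ β ∧ α + 2 * β = 1 ∧
      ∀ m m', meanStepOne p r m m' =
        (α * m.1 + β * m.2 + β * m'.1, α * m'.2 + β * m.2 + β * m'.1) := by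
  have h1 : 0 < r := by linarith
  refine ⟨(p + r) / (2 * r), (r - p) / (4 * r), by positivity,
    div_nonneg (by linarith) (by linarith), by field_simp; ring, fun m m' => ?_⟩
  unfold meanStepOne
  ext <;> simp only <;> field_simp <;> ring

theorem convex_two {L U α β x y : ℝ} (hα : 0 ≤ α) (hβ : 0 ≤ β) (h : α + β = 1)
    (hx : x ∈ Icc L U) (hy : y ∈ Icc L U) : α * x + β * y ∈ Icc L U :=
  convex_Icc L U hx hy hα hβ h

theorem convex_three {L U α β γ x y z : ℝ} (hα : 0 ≤ α) (hβ : 0 ≤ β) (hγ : 0 ≤ γ)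
    (h : α + β + γ = 1) (hx : x ∈ Icc L U) (hy : y ∈ Icc L U) (hz : z ∈ Icc L U) :
    α * x + β * y + γ * z ∈ Icc L U := by
  obtain ⟨hx1, hx2⟩ := hx
  obtain ⟨hy1, hy2⟩ := hy
  obtain ⟨hz1, hz2⟩ := hz
  obtain rfl : α = 1 - β - γ := by linarith
  constructor <;> nlinarith

theorem meanApprox_mem_Icc {lam : ℝ} (h : lam ∈ Ico (0 : ℝ) 1) (n : ℕ) {f : Plane → ℝ} {L U : ℝ}
    (hf : ∀ x ∈ upperBoundary lam, f x ∈ Icc L U) :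
    (meanApprox n lam f).1 ∈ Icc L U ∧ (meanApprox n lam f).2 ∈ Icc L U := by
  induction n generalizing lam f with
  | zero =>
    have := hf _ (smul_q_zero_mem_upperBoundary h)
    exact ⟨this, this⟩
  | succ n ih =>
    have hs := shift_mem h
    have hp := one_le_symResponse hs
    have hr := three_le_antiResponse hs
    have hpr := symResponse_le_antiResponse hs
    rcases digit_eq_zero_or_one lam 0 with h0 | h0
    · obtain ⟨h1, h2⟩ := ih hs (f := f ∘ F 0)
        fun x hx => hf _ (F_mem_upperBoundary h (by simp [h0]) hx)
      obtain ⟨α, β, hα, hβ, hαβ, he⟩ := meanStepZero_convex hp hr hpr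
      rw [meanApprox, if_pos h0, he]
      exact ⟨convex_two hα hβ hαβ h1 h2, convex_two hβ hα (by linarith) h1 h2⟩
    · obtain ⟨h1, h2⟩ := ih hs (f := f ∘ F 1)
        fun x hx => hf _ (F_mem_upperBoundary h (by simp [h0]) hx)
      obtain ⟨h3, h4⟩ := ih hs (f := f ∘ F 2)
        fun x hx => hf _ (F_mem_upperBoundary h (by simp [h0]) hx)
      obtain ⟨α, β, hα, hβ, hαβ, he⟩ := meanStepOne_convex hp hr hpr
      rw [meanApprox, if_neg (by simp [h0]), he]
      exact ⟨convex_three hα hβ hβ (by linarith) h1 h2 h3,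
        convex_three hα hβ hβ (by linarith) h4 h2 h3⟩

/-- After finitely many subdivisions, the oscillation of `f` on each piece of the upper boundary
is at most `ε`. -/
inductive NarrowData (ε : ℝ) : ℝ → (Plane → ℝ) → Prop
  | narrow (lam : ℝ) (f : Plane → ℝ)
      (h : ∀ x ∈ upperBoundary lam, ∀ y ∈ upperBoundary lam, |f x - f y| ≤ ε) :
      NarrowData ε lam f
  | split (lam : ℝ) (f : Plane → ℝ)
      (h : ∀ i : Fin 3, (i = 0 ↔ digit lam 0 = 0) → NarrowData ε (shift lam) (f ∘ F i)) :
      NarrowData ε lam f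

theorem narrowData_of_continuousOn {lam : ℝ} (h : lam ∈ Ico (0 : ℝ) 1) {f : Plane → ℝ}
    (hf : ContinuousOn f (upperBoundary lam)) {ε : ℝ} (hε : 0 < ε) : NarrowData ε lam f := by
  obtain ⟨C, hC⟩ := Metric.isBounded_iff.1 isCompact_SG.isBounded
  have key : ∀ (n : ℕ) (lam : ℝ) (f : Plane → ℝ) (δ : ℝ), lam ∈ Ico (0 : ℝ) 1 → C < 2 ^ n * δ →
      (∀ x ∈ upperBoundary lam, ∀ y ∈ upperBoundary lam, dist x y < δ → |f x - f y| ≤ ε) →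
      NarrowData ε lam f := by
    intro n
    induction n with
    | zero =>
      intro lam f δ h hδ hf
      refine .narrow lam f fun x hx y hy => hf x hx y hy ?_
      refine (hC (upperBoundary_subset_SG _ hx) (upperBoundary_subset_SG _ hy)).trans_lt ?_
      linarith
    | succ n ih =>
      intro lam f δ h hδ hf
      refine .split lam f fun i hi => ih _ _ (2 * δ) (shift_mem h) ?_ fun x hx y hy hxy => ?_
      · rw [pow_succ] at hδ
        linarith
      · refine hf _ (F_mem_upperBoundary h hi hx) _ (F_mem_upperBoundary h hi hy) ?_
        rw [dist_F]
        linarith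
  have hu := (isCompact_upperBoundary lam).uniformContinuousOn_of_continuous hf
  obtain ⟨δ, hδ, hfδ⟩ := Metric.uniformContinuousOn_iff.1 hu ε hε
  obtain ⟨n, hn⟩ := pow_unbounded_of_one_lt (C / δ) (one_lt_two (α := ℝ))
  rw [div_lt_iff₀ hδ] at hn
  exact key n lam f δ h hn fun x hx y hy hxy => (hfδ x hx y hy hxy).le

theorem NarrowData.meanApprox_cauchy {ε lam : ℝ} {f : Plane → ℝ} (hf : NarrowData ε lam f)
    (h : lam ∈ Ico (0 : ℝ) 1) : ∃ N, ∀ n ≥ N, ∀ k ≥ N,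
      |(meanApprox n lam f).1 - (meanApprox k lam f).1| ≤ 2 * ε ∧
      |(meanApprox n lam f).2 - (meanApprox k lam f).2| ≤ 2 * ε := by
  induction hf with
  | narrow lam f hf =>
    refine ⟨0, fun n _ k _ => ?_⟩
    have hI : ∀ x ∈ upperBoundary lam,
        f x ∈ Icc (f ((1 - lam) • q 0) - ε) (f ((1 - lam) • q 0) + ε) := by
      intro x hx
      have := abs_le.1 (hf x hx _ (smul_q_zero_mem_upperBoundary h))
      constructor <;> linarith [this.1, this.2]
    obtain ⟨⟨h1, h2⟩, h3, h4⟩ := meanApprox_mem_Icc h n hI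
    obtain ⟨⟨h5, h6⟩, h7, h8⟩ := meanApprox_mem_Icc h k hI
    constructor <;> rw [abs_le] <;> constructor <;> linarith
  | split lam f _ ih =>
    have hs := shift_mem h
    have hp := one_le_symResponse hs
    have hr := three_le_antiResponse hs
    have hpr := symResponse_le_antiResponse hs
    rcases digit_eq_zero_or_one lam 0 with h0 | h0
    · obtain ⟨N, hN⟩ := ih 0 (by simp [h0]) hs
      obtain ⟨α, β, hα, hβ, hαβ, he⟩ := meanStepZero_convex hp hr hpr
      refine ⟨N + 1, fun n hn k hk => ?_⟩
      obtain ⟨n, rfl⟩ := Nat.exists_eq_add_of_le' (show 1 ≤ n by omega)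
      obtain ⟨k, rfl⟩ := Nat.exists_eq_add_of_le' (show 1 ≤ k by omega)
      obtain ⟨h1, h2⟩ := hN n (by omega) k (by omega)
      rw [meanApprox, meanApprox, if_pos h0, if_pos h0, he, he]
      rw [abs_le, ← mem_Icc] at h1 h2 ⊢
      have h3 := convex_two hα hβ hαβ h1 h2
      have h4 := convex_two hβ hα (by linarith) h1 h2
      constructor
      · convert! h3 using 1
        ring
      · rw [abs_le, ← mem_Icc]
        convert! h4 using 1
        ring
    · obtain ⟨N, hN⟩ := ih 1 (by simp [h0]) hs
      obtain ⟨N', hN'⟩ := ih 2 (by simp [h0]) hs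
      obtain ⟨α, β, hα, hβ, hαβ, he⟩ := meanStepOne_convex hp hr hpr
      refine ⟨max N N' + 1, fun n hn k hk => ?_⟩
      have hM := le_max_left N N'
      have hM' := le_max_right N N'
      obtain ⟨n, rfl⟩ := Nat.exists_eq_add_of_le' (show 1 ≤ n by omega)
      obtain ⟨k, rfl⟩ := Nat.exists_eq_add_of_le' (show 1 ≤ k by omega)
      obtain ⟨h1, h2⟩ := hN n (by omega) k (by omega)
      obtain ⟨h3, h4⟩ := hN' n (by omega) k (by omega)
      rw [meanApprox, meanApprox, if_neg (by simp [h0]), if_neg (by simp [h0]), he, he]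
      rw [abs_le, ← mem_Icc] at h1 h2 h3 h4 ⊢
      have h5 := convex_three hα hβ hβ (by linarith) h1 h2 h3
      have h6 := convex_three hα hβ hβ (by linarith) h4 h2 h3
      constructor
      · convert! h5 using 1
        ring
      · rw [abs_le, ← mem_Icc]
        convert! h6 using 1
        ring

theorem tendsto_mean {lam : ℝ} (h : lam ∈ Ico (0 : ℝ) 1) {f : Plane → ℝ}
    (hf : ContinuousOn f (upperBoundary lam)) :
    Tendsto (fun n => (meanApprox n lam f).1) atTop (𝓝 (mean₁ lam f)) ∧
    Tendsto (fun n => (meanApprox n lam f).2) atTop (𝓝 (mean₂ lam f)) := by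
  constructor
  · apply tendsto_nhds_limUnder
    apply cauchySeq_tendsto_of_complete
    rw [Metric.cauchySeq_iff']
    intro ε hε
    obtain ⟨N, hN⟩ := (narrowData_of_continuousOn h hf (ε := ε / 3) (by linarith)).meanApprox_cauchy h
    refine ⟨N, fun n hn => ?_⟩
    rw [Real.dist_eq]
    linarith [(hN n hn N le_rfl).1]
  · apply tendsto_nhds_limUnder
    apply cauchySeq_tendsto_of_complete
    rw [Metric.cauchySeq_iff']
    intro ε hε
    obtain ⟨N, hN⟩ := (narrowData_of_continuousOn h hf (ε := ε / 3) (by linarith)).meanApprox_cauchy h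
    refine ⟨N, fun n hn => ?_⟩
    rw [Real.dist_eq]
    linarith [(hN n hn N le_rfl).2]

theorem mean_mem_Icc {lam : ℝ} (h : lam ∈ Ico (0 : ℝ) 1) {f : Plane → ℝ}
    (hf : ContinuousOn f (upperBoundary lam)) {L U : ℝ}
    (hL : ∀ x ∈ upperBoundary lam, f x ∈ Icc L U) :
    mean₁ lam f ∈ Icc L U ∧ mean₂ lam f ∈ Icc L U :=
  ⟨isClosed_Icc.mem_of_tendsto (tendsto_mean h hf).1
      (Eventually.of_forall fun n => (meanApprox_mem_Icc h n hL).1),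
    isClosed_Icc.mem_of_tendsto (tendsto_mean h hf).2
      (Eventually.of_forall fun n => (meanApprox_mem_Icc h n hL).2)⟩

theorem mean_of_digit_zero {lam : ℝ} (h : lam ∈ Ico (0 : ℝ) 1) (h0 : digit lam 0 = 0)
    {f : Plane → ℝ} (hf : ContinuousOn f (upperBoundary lam)) :
    (mean₁ lam f, mean₂ lam f) =
      meanStepZero (symResponse (shift lam)) (antiResponse (shift lam))
        (mean₁ (shift lam) (f ∘ F 0), mean₂ (shift lam) (f ∘ F 0)) := by
  have hs := shift_mem h
  obtain ⟨α, β, hα, hβ, hαβ, he⟩ := meanStepZero_convex (one_le_symResponse hs)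
    (three_le_antiResponse hs) (symResponse_le_antiResponse hs)
  obtain ⟨t1, t2⟩ := tendsto_mean h hf
  obtain ⟨t3, t4⟩ := tendsto_mean hs (continuousOn_comp_F h hf (i := 0) (by simp [h0]))
  rw [he]
  ext
  · refine tendsto_nhds_unique ((tendsto_add_atTop_iff_nat 1).2 t1) ?_
    simp only [meanApprox, h0, if_pos, he]
    exact (t3.const_mul α).add (t4.const_mul β)
  · refine tendsto_nhds_unique ((tendsto_add_atTop_iff_nat 1).2 t2) ?_
    simp only [meanApprox, h0, if_pos, he]
    exact (t3.const_mul β).add (t4.const_mul α)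

theorem mean_of_digit_one {lam : ℝ} (h : lam ∈ Ico (0 : ℝ) 1) (h0 : digit lam 0 = 1)
    {f : Plane → ℝ} (hf : ContinuousOn f (upperBoundary lam)) :
    (mean₁ lam f, mean₂ lam f) =
      meanStepOne (symResponse (shift lam)) (antiResponse (shift lam))
        (mean₁ (shift lam) (f ∘ F 1), mean₂ (shift lam) (f ∘ F 1))
        (mean₁ (shift lam) (f ∘ F 2), mean₂ (shift lam) (f ∘ F 2)) := by
  have hs := shift_mem h
  obtain ⟨α, β, hα, hβ, hαβ, he⟩ := meanStepOne_convex (one_le_symResponse hs)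
    (three_le_antiResponse hs) (symResponse_le_antiResponse hs)
  obtain ⟨t1, t2⟩ := tendsto_mean h hf
  obtain ⟨t3, t4⟩ := tendsto_mean hs (continuousOn_comp_F h hf (i := 1) (by simp [h0]))
  obtain ⟨t5, t6⟩ := tendsto_mean hs (continuousOn_comp_F h hf (i := 2) (by simp [h0]))
  rw [he]
  ext
  · refine tendsto_nhds_unique ((tendsto_add_atTop_iff_nat 1).2 t1) ?_
    simp only [meanApprox, h0, if_neg (show (1 : Fin 2) ≠ 0 by decide), he]
    exact ((t3.const_mul α).add (t4.const_mul β)).add (t5.const_mul β)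
  · refine tendsto_nhds_unique ((tendsto_add_atTop_iff_nat 1).2 t2) ?_
    simp only [meanApprox, h0, if_neg (show (1 : Fin 2) ≠ 0 by decide), he]
    exact ((t6.const_mul α).add (t4.const_mul β)).add (t5.const_mul β)

/-! ### Harmonic functions, harmonic splines and solutions on lower domains -/

/-- The vertex values on the cell `Fᵢ SG` of the harmonic function with vertex values `c`. -/
noncomputable def harmExt (c : Fin 3 → ℝ) (i : Fin 3) : Fin 3 → ℝ :=
  fun j => if j = i then c i else (c i + c j + (c 0 + c 1 + c 2)) / 5

/-- The states of the refinement rule that generates the functions needed below. -/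
inductive State : Type
  /-- the harmonic function on the gasket with given vertex values -/
  | harm (c : Fin 3 → ℝ)
  /-- the function that agrees with `G` on `V n` and is harmonic on each cell of level `n` -/
  | spline (n : ℕ) (G : Plane → ℝ)
  /-- the solution on the lower domain of `lam` with data `f` on the upper boundary, value `x` at
  `q₁` and `x'` at `q₂`; it is continued to the rest of the gasket by harmonic functions, and `τ`
  is the value given to it at `q₀` -/
  | lower (lam : ℝ) (f : Plane → ℝ) (τ x x' : ℝ)

/-- The values of the solution on a lower domain at `F₀ q₁` and `F₀ q₂`, if the first digit
is `0`. -/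
noncomputable def upperValues (lam : ℝ) (f : Plane → ℝ) (x x' : ℝ) : ℝ × ℝ :=
  (upperValue (symResponse (shift lam)) (antiResponse (shift lam)) x x'
      (mean₁ (shift lam) (f ∘ F 0)) (mean₂ (shift lam) (f ∘ F 0)),
    upperValue (symResponse (shift lam)) (antiResponse (shift lam)) x' x
      (mean₂ (shift lam) (f ∘ F 0)) (mean₁ (shift lam) (f ∘ F 0)))

/-- The value of the solution on a lower domain at `F₁ q₂`. -/
noncomputable def bottomValue (lam : ℝ) (f : Plane → ℝ) (x x' : ℝ) : ℝ :=
  if digit lam 0 = 0 then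
    ((upperValues lam f x x').1 + (upperValues lam f x x').2 + x + x') / 4
  else
    middleValue (symResponse (shift lam)) (antiResponse (shift lam)) x x'
      (mean₂ (shift lam) (f ∘ F 1)) (mean₁ (shift lam) (f ∘ F 2))

namespace State

/-- The vertex values of a state. -/
noncomputable def val : State → Fin 3 → ℝ
  | harm c => c
  | spline _ G => fun i => G (q i)
  | lower _ _ τ x x' => ![τ, x, x']

/-- The restriction of a state to the cells of level one. -/
noncomputable def child : State → Fin 3 → State
  | harm c, i => harm (harmExt c i)
  | spline 0 G, i => harm (harmExt (fun j => G (q j)) i)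
  | spline (n + 1) G, i => spline n (G ∘ F i)
  | lower lam f τ x x', i =>
    if digit lam 0 = 0 then
      ![lower (shift lam) (f ∘ F 0) τ (upperValues lam f x x').1 (upperValues lam f x x').2,
        harm ![(upperValues lam f x x').1, x, bottomValue lam f x x'],
        harm ![(upperValues lam f x x').2, bottomValue lam f x x', x']] i
    else
      ![harm ![τ, f (F 1 ((1 - shift lam) • q 0)), f (F 2 ((1 - shift lam) • q 0))],
        lower (shift lam) (f ∘ F 1) (f (F 1 ((1 - shift lam) • q 0))) x (bottomValue lam f x x'),
        lower (shift lam) (f ∘ F 2) (f (F 2 ((1 - shift lam) • q 0)))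
          (bottomValue lam f x x') x'] i

theorem harmExt_corner (c : Fin 3 → ℝ) (i : Fin 3) : harmExt c i i = c i := by simp [harmExt]

theorem harmExt_comm (c : Fin 3 → ℝ) (i j : Fin 3) : harmExt c i j = harmExt c j i := by
  unfold harmExt
  by_cases h : j = i
  · rw [h]
  · rw [if_neg h, if_neg (Ne.symm h)]; ring

/-- The refinement rule for the states. -/
noncomputable def system : CellSystem State where
  val := val
  child := child
  corner := by
    rintro (c | ⟨_ | n, G⟩ | ⟨lam, f, τ, x, x'⟩) i
    · exact harmExt_corner c i
    · exact harmExt_corner (fun j => G (q j)) i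
    · simp [child, val, F_fixed]
    · simp only [child]
      split_ifs <;> fin_cases i <;> simp [val]
  glue := by
    rintro (c | ⟨_ | n, G⟩ | ⟨lam, f, τ, x, x'⟩) i j
    · exact harmExt_comm c i j
    · exact harmExt_comm (fun j => G (q j)) i j
    · simp [child, val, F_q_comm]
    · simp only [child]
      split_ifs <;> fin_cases i <;> fin_cases j <;> simp [val]

@[simp] theorem system_val (s : State) : system.val s = s.val := rfl

@[simp] theorem system_child (s : State) (i : Fin 3) : system.child s i = s.child i := rfl

/-- All data of the state lie in the interval `[L, U]`. -/
def InRange (L U : ℝ) : State → Prop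
  | harm c => ∀ i, c i ∈ Icc L U
  | spline _ G => ∀ x, G x ∈ Icc L U
  | lower lam f τ x x' => lam ∈ Ico (0 : ℝ) 1 ∧ ContinuousOn f (upperBoundary lam) ∧
      (∀ y ∈ upperBoundary lam, f y ∈ Icc L U) ∧ τ ∈ Icc L U ∧ x ∈ Icc L U ∧ x' ∈ Icc L U

theorem harmExt_mem_Icc {c : Fin 3 → ℝ} {L U : ℝ} (hc : ∀ i, c i ∈ Icc L U) (i j : Fin 3) :
    harmExt c i j ∈ Icc L U := by
  unfold harmExt
  split_ifs
  · exact hc i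
  · have hi := hc i
    have hj := hc j
    have h0 := hc 0
    have h1 := hc 1
    have h2 := hc 2
    simp only [mem_Icc] at *
    constructor <;> linarith

theorem upperValues_mem {lam : ℝ} (h : lam ∈ Ico (0 : ℝ) 1) (h0 : digit lam 0 = 0)
    {f : Plane → ℝ} (hf : ContinuousOn f (upperBoundary lam)) {L U δ x x' : ℝ} (hδ : 0 ≤ δ)
    (hI : ∀ y ∈ upperBoundary lam, f y ∈ Icc L U) (hx : x ∈ Icc (L - δ) (U + δ))
    (hx' : x' ∈ Icc (L - δ) (U + δ)) :
    (upperValues lam f x x').1 ∈ Icc (L - 3 / 5 * δ) (U + 3 / 5 * δ) ∧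
      (upperValues lam f x x').2 ∈ Icc (L - 3 / 5 * δ) (U + 3 / 5 * δ) := by
  have hs := shift_mem h
  obtain ⟨α, β, γ, ζ, hα, hβ, hγ, hζ, hsum, hαβ, he⟩ := upperValue_convex (one_le_symResponse hs)
    (three_le_antiResponse hs) (symResponse_le_antiResponse hs)
  obtain ⟨⟨h1, h2⟩, h3, h4⟩ := mean_mem_Icc hs
    (continuousOn_comp_F h hf (i := 0) (by simp [h0])) (L := L) (U := U)
    fun y hy => hI _ (F_mem_upperBoundary h (by simp [h0]) hy)
  obtain ⟨h5, h6⟩ := hx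
  obtain ⟨h7, h8⟩ := hx'
  simp only [upperValues, he]
  generalize mean₁ (shift lam) (f ∘ F 0) = m at *
  generalize mean₂ (shift lam) (f ∘ F 0) = m' at *
  have hδ' := mul_le_mul_of_nonneg_right hαβ hδ
  have hL : L = α * L + β * L + γ * L + ζ * L := by rw [← add_mul, ← add_mul, ← add_mul, hsum, one_mul]
  have hU : U = α * U + β * U + γ * U + ζ * U := by rw [← add_mul, ← add_mul, ← add_mul, hsum, one_mul]
  have a1 := mul_le_mul_of_nonneg_left h5 hα
  have a2 := mul_le_mul_of_nonneg_left h6 hα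
  have a3 := mul_le_mul_of_nonneg_left h7 hα
  have a4 := mul_le_mul_of_nonneg_left h8 hα
  have b1 := mul_le_mul_of_nonneg_left h5 hβ
  have b2 := mul_le_mul_of_nonneg_left h6 hβ
  have b3 := mul_le_mul_of_nonneg_left h7 hβ
  have b4 := mul_le_mul_of_nonneg_left h8 hβ
  have c1 := mul_le_mul_of_nonneg_left h1 hγ
  have c2 := mul_le_mul_of_nonneg_left h2 hγ
  have c3 := mul_le_mul_of_nonneg_left h3 hγ
  have c4 := mul_le_mul_of_nonneg_left h4 hγ
  have d1 := mul_le_mul_of_nonneg_left h1 hζ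
  have d2 := mul_le_mul_of_nonneg_left h2 hζ
  have d3 := mul_le_mul_of_nonneg_left h3 hζ
  have d4 := mul_le_mul_of_nonneg_left h4 hζ
  refine ⟨⟨?_, ?_⟩, ?_, ?_⟩ <;> linarith

theorem bottomValue_mem_of_digit_one {lam : ℝ} (h : lam ∈ Ico (0 : ℝ) 1) (h0 : digit lam 0 = 1)
    {f : Plane → ℝ} (hf : ContinuousOn f (upperBoundary lam)) {L U δ x x' : ℝ} (hδ : 0 ≤ δ)
    (hI : ∀ y ∈ upperBoundary lam, f y ∈ Icc L U) (hx : x ∈ Icc (L - δ) (U + δ))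
    (hx' : x' ∈ Icc (L - δ) (U + δ)) :
    bottomValue lam f x x' ∈ Icc (L - δ) (U + δ) := by
  have hs := shift_mem h
  obtain ⟨α, γ, hα, hγ, hsum, he⟩ := middleValue_convex (one_le_symResponse hs)
    (three_le_antiResponse hs) (symResponse_le_antiResponse hs)
  obtain ⟨-, h3, h4⟩ := mean_mem_Icc hs
    (continuousOn_comp_F h hf (i := 1) (by simp [h0])) (L := L) (U := U)
    fun y hy => hI _ (F_mem_upperBoundary h (by simp [h0]) hy)
  obtain ⟨⟨h1, h2⟩, -⟩ := mean_mem_Icc hs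
    (continuousOn_comp_F h hf (i := 2) (by simp [h0])) (L := L) (U := U)
    fun y hy => hI _ (F_mem_upperBoundary h (by simp [h0]) hy)
  rw [bottomValue, if_neg (by simp [h0]), he]
  have h5 := convex_two (x := (x + x') / 2)
    (y := (mean₂ (shift lam) (f ∘ F 1) + mean₁ (shift lam) (f ∘ F 2)) / 2)
    (L := L - δ) (U := U + δ) (by linarith : 0 ≤ 2 * α) (by linarith : 0 ≤ 2 * γ) (by linarith)
    ⟨by linarith [hx.1, hx'.1], by linarith [hx.2, hx'.2]⟩ ⟨by linarith, by linarith⟩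
  convert! h5 using 1
  ring

theorem bottomValue_mem_of_digit_zero {lam : ℝ} (h0 : digit lam 0 = 0) {f : Plane → ℝ}
    {L U x x' : ℝ} (hx : x ∈ Icc L U) (hx' : x' ∈ Icc L U)
    (hu : (upperValues lam f x x').1 ∈ Icc L U) (hu' : (upperValues lam f x x').2 ∈ Icc L U) :
    bottomValue lam f x x' ∈ Icc L U := by
  rw [bottomValue, if_pos h0]
  simp only [mem_Icc] at *
  constructor <;> linarith

theorem InRange.child {L U : ℝ} {s : State} (hs : s.InRange L U) (i : Fin 3) :
    (s.child i).InRange L U := by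
  rcases s with c | ⟨_ | n, G⟩ | ⟨lam, f, τ, x, x'⟩
  · exact harmExt_mem_Icc hs i
  · exact harmExt_mem_Icc (fun j => hs (q j)) i
  · exact fun x => hs _
  · obtain ⟨h, hf, hI, hτ, hx, hx'⟩ := hs
    rcases digit_eq_zero_or_one lam 0 with h0 | h0
    · obtain ⟨h1, h2⟩ := upperValues_mem h h0 hf le_rfl hI (x := x) (x' := x')
        (by simpa using hx) (by simpa using hx')
      simp only [mul_zero, sub_zero, add_zero] at h1 h2
      have h3 := bottomValue_mem_of_digit_zero h0 hx hx' h1 h2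
      rw [State.child, if_pos h0]
      fin_cases i
      · exact ⟨shift_mem h, continuousOn_comp_F h hf (by simp [h0]),
          fun y hy => hI _ (F_mem_upperBoundary h (by simp [h0]) hy), hτ, h1, h2⟩
      · intro j; fin_cases j <;> assumption
      · intro j; fin_cases j <;> assumption
    · have h3 := bottomValue_mem_of_digit_one h h0 hf le_rfl hI (x := x) (x' := x')
        (by simpa using hx) (by simpa using hx')
      simp only [sub_zero, add_zero] at h3
      have h1 := hI _ (F_mem_upperBoundary h (i := 1) (by simp [h0])
        (smul_q_zero_mem_upperBoundary (shift_mem h)))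
      have h2 := hI _ (F_mem_upperBoundary h (i := 2) (by simp [h0])
        (smul_q_zero_mem_upperBoundary (shift_mem h)))
      rw [State.child, if_neg (by simp [h0])]
      fin_cases i
      · intro j; fin_cases j <;> assumption
      · exact ⟨shift_mem h, continuousOn_comp_F h hf (by simp [h0]),
          fun y hy => hI _ (F_mem_upperBoundary h (by simp [h0]) hy), h1, hx, h3⟩
      · exact ⟨shift_mem h, continuousOn_comp_F h hf (by simp [h0]),
          fun y hy => hI _ (F_mem_upperBoundary h (by simp [h0]) hy), h2, h3, hx'⟩

theorem InRange.val_mem {L U : ℝ} {s : State} (hs : s.InRange L U) (i : Fin 3) :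
    s.val i ∈ Icc L U := by
  rcases s with c | ⟨n, G⟩ | ⟨lam, f, τ, x, x'⟩
  · exact hs i
  · exact hs (q i)
  · obtain ⟨-, -, -, hτ, hx, hx'⟩ := hs
    fin_cases i <;> assumption

theorem InRange.descend {L U : ℝ} {s : State} (hs : s.InRange L U) (w : List (Fin 3)) :
    InRange L U (system.descend s w) := by
  induction w generalizing s with
  | nil => exact hs
  | cons i w ih => exact ih (hs.child i)

theorem InRange.eventuallyNarrow {L ε : ℝ} {s : State} (hs : s.InRange L (L + ε)) :
    system.EventuallyNarrow ε s :=
  .narrow s L fun w i => (hs.descend w).val_mem i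

theorem tame_harm (c : Fin 3 → ℝ) : system.Tame (harm c) := by
  have key : ∀ (ε : ℝ), 0 < ε → ∀ (k : ℕ) (c : Fin 3 → ℝ),
      (∀ i j, c i - c j ≤ (5 / 3) ^ k * ε) → system.EventuallyNarrow (2 * ε) (harm c) := by
    intro ε hε k
    induction k with
    | zero =>
      intro c hc
      refine InRange.eventuallyNarrow (L := c 0 - ε) fun i => ⟨?_, ?_⟩
      · linarith [hc 0 i]
      · linarith [hc i 0]
    | succ k ih =>
      intro c hc
      refine .split _ fun i => ih _ fun j l => ?_
      have h : ∀ i j, c i - c j ≤ 5 / 3 * ((5 / 3) ^ k * ε) := fun i j =>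
        (hc i j).trans_eq (by ring)
      have hpos : 0 ≤ (5 / 3) ^ k * ε := by positivity
      have h01 := h 0 1
      have h02 := h 0 2
      have h10 := h 1 0
      have h12 := h 1 2
      have h20 := h 2 0
      have h21 := h 2 1
      unfold harmExt
      fin_cases i <;> fin_cases j <;> fin_cases l <;> simp <;> linarith
  intro ε hε
  have hM : ∀ i, |c i| ≤ |c 0| + |c 1| + |c 2| := by
    intro i
    have h0 := abs_nonneg (c 0)
    have h1 := abs_nonneg (c 1)
    have h2 := abs_nonneg (c 2)
    fin_cases i <;> simp <;> linarith
  obtain ⟨k, hk⟩ := pow_unbounded_of_one_lt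
    (2 * (|c 0| + |c 1| + |c 2|) / (ε / 2)) (by norm_num : (1 : ℝ) < 5 / 3)
  rw [div_lt_iff₀ (by linarith)] at hk
  have := key (ε / 2) (by linarith) k c fun i j => by
    have h1 := abs_le.1 (hM i)
    have h2 := abs_le.1 (hM j)
    linarith [h1.2, h2.1]
  rwa [mul_div_cancel₀ _ (two_ne_zero)] at this

theorem tame_spline (n : ℕ) (G : Plane → ℝ) : system.Tame (spline n G) := by
  intro ε hε
  induction n generalizing G with
  | zero => exact .split _ fun i => tame_harm _ ε hε
  | succ n ih => exact .split _ fun i => ih _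

/-- To prove a property of the states `lower`, it suffices to prove it if all data lie in a short
interval, and to deduce it from the property of the children of the same kind.  The reason is that
the data `f` have small oscillation on small pieces, and that each digit `0` brings the values at
`q₁`, `q₂` closer to the range of `f`. -/
theorem lower_induction {ε : ℝ} (hε : 0 < ε) {P : State → Prop}
    (narrow : ∀ lam f τ x x' L, InRange L (L + ε) (lower lam f τ x x') → P (lower lam f τ x x'))
    (split : ∀ lam f τ x x', lam ∈ Ico (0 : ℝ) 1 → ContinuousOn f (upperBoundary lam) →
      (∀ i, (i = 0 ↔ digit lam 0 = 0) → P ((lower lam f τ x x').child i)) →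
      P (lower lam f τ x x'))
    {lam : ℝ} (h : lam ∈ Ico (0 : ℝ) 1) {f : Plane → ℝ}
    (hf : ContinuousOn f (upperBoundary lam)) {τ : ℝ} (hτ : τ ∈ f '' upperBoundary lam)
    (x x' : ℝ) : P (lower lam f τ x x') := by
  have decay : ∀ (k : ℕ) (lam : ℝ), lam ∈ Ico (0 : ℝ) 1 → ∀ (f : Plane → ℝ) (τ x x' l δ : ℝ),
      ContinuousOn f (upperBoundary lam) → (∀ y ∈ upperBoundary lam, f y ∈ Icc l (l + ε / 3)) →
      τ ∈ Icc l (l + ε / 3) → 0 ≤ δ → δ ≤ (5 / 3) ^ k * (ε / 3) →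
      x ∈ Icc (l - δ) (l + ε / 3 + δ) → x' ∈ Icc (l - δ) (l + ε / 3 + δ) →
      P (lower lam f τ x x') := by
    intro k
    induction k with
    | zero =>
      rintro lam h f τ x x' l δ hf hI ⟨hτ, hτ'⟩ hδ hδ' ⟨h1, h2⟩ ⟨h3, h4⟩
      refine narrow _ _ _ _ _ (l - ε / 3) ⟨h, hf, fun y hy => ?_, ?_, ?_, ?_⟩
      · have := hI y hy
        exact ⟨by linarith [this.1], by linarith [this.2]⟩
      all_goals constructor <;> linarith
    | succ k ih =>
      refine digit_induction ?_ ?_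
      · intro lam h h0 f τ x x' l δ hf hI hτ hδ hδ' hx hx'
        refine split _ _ _ _ _ h hf fun i hi => ?_
        obtain rfl := hi.2 h0
        rw [child, if_pos h0]
        obtain ⟨h1, h2⟩ := upperValues_mem h h0 hf hδ hI hx hx'
        refine ih _ (shift_mem h) _ _ _ _ l (3 / 5 * δ) (continuousOn_comp_F h hf hi)
          (fun y hy => hI _ (F_mem_upperBoundary h hi hy)) hτ (by linarith) ?_ h1 h2
        rw [pow_succ] at hδ'
        linarith
      · intro lam h h0 ih' f τ x x' l δ hf hI hτ hδ hδ' hx hx'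
        refine split _ _ _ _ _ h hf fun i hi => ?_
        have hb := bottomValue_mem_of_digit_one h h0 hf hδ hI hx hx'
        have hm : f (F i ((1 - shift lam) • q 0)) ∈ Icc l (l + ε / 3) :=
          hI _ (F_mem_upperBoundary h hi (smul_q_zero_mem_upperBoundary (shift_mem h)))
        rw [child, if_neg (by simp [h0])]
        have hc := continuousOn_comp_F h hf hi
        have hI' : ∀ y ∈ upperBoundary (shift lam), (f ∘ F i) y ∈ Icc l (l + ε / 3) :=
          fun y hy => hI _ (F_mem_upperBoundary h hi hy)
        fin_cases i
        · simp [h0] at hi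
        · exact ih' _ _ _ _ l δ hc hI' hm hδ hδ' hx hb
        · exact ih' _ _ _ _ l δ hc hI' hm hδ hδ' hb hx'
  have main : ∀ lam f, NarrowData (ε / 6) lam f → lam ∈ Ico (0 : ℝ) 1 →
      ContinuousOn f (upperBoundary lam) → ∀ τ ∈ f '' upperBoundary lam, ∀ x x',
      P (lower lam f τ x x') := by
    intro lam f hn
    induction hn with
    | narrow lam f hn =>
      rintro h hf _ ⟨z, hz, rfl⟩ x x'
      have hI : ∀ y ∈ upperBoundary lam, f y ∈ Icc (f z - ε / 6) (f z - ε / 6 + ε / 3) := by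
        intro y hy
        have := abs_le.1 (hn y hy z hz)
        constructor <;> linarith [this.1, this.2]
      obtain ⟨k, hk⟩ := pow_unbounded_of_one_lt
        ((|x - f z| + |x' - f z|) / (ε / 3)) (by norm_num : (1 : ℝ) < 5 / 3)
      rw [div_lt_iff₀ (by linarith)] at hk
      have h1 := neg_abs_le (x - f z)
      have h2 := le_abs_self (x - f z)
      have h3 := neg_abs_le (x' - f z)
      have h4 := le_abs_self (x' - f z)
      have h5 := abs_nonneg (x - f z)
      have h6 := abs_nonneg (x' - f z)
      refine decay k lam h f (f z) x x' (f z - ε / 6) (|x - f z| + |x' - f z|) hf hI (hI z hz)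
        (by positivity) hk.le ?_ ?_ <;> constructor <;> linarith
    | split lam f _ ih =>
      intro h hf τ hτ x x'
      refine split _ _ _ _ _ h hf fun i hi => ?_
      have hc := continuousOn_comp_F h hf hi
      have ih' := ih i hi (shift_mem h) hc
      have hm : f (F i ((1 - shift lam) • q 0)) ∈ (f ∘ F i) '' upperBoundary (shift lam) :=
        ⟨_, smul_q_zero_mem_upperBoundary (shift_mem h), rfl⟩
      rcases digit_eq_zero_or_one lam 0 with h0 | h0
      · obtain rfl := hi.2 h0
        rw [child, if_pos h0]
        refine ih' _ ?_ _ _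
        rwa [upperBoundary_of_digit_zero h h0, ← image_comp] at hτ
      · rw [child, if_neg (by simp [h0])]
        fin_cases i
        · simp [h0] at hi
        · exact ih' _ hm _ _
        · exact ih' _ hm _ _
  exact main lam f (narrowData_of_continuousOn h hf (by linarith)) h hf τ hτ x x'

theorem tame_lower {lam : ℝ} (h : lam ∈ Ico (0 : ℝ) 1) {f : Plane → ℝ}
    (hf : ContinuousOn f (upperBoundary lam)) {τ : ℝ} (hτ : τ ∈ f '' upperBoundary lam)
    (x x' : ℝ) : system.Tame (lower lam f τ x x') := by
  intro ε hε
  refine lower_induction hε (P := system.EventuallyNarrow ε)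
    (fun lam f τ x x' L hI => hI.eventuallyNarrow) (fun lam f τ x x' h hf ih => ?_) h hf hτ x x'
  refine .split _ fun i => ?_
  by_cases hi : i = 0 ↔ digit lam 0 = 0
  · exact ih i hi
  · rw [system_child, child]
    rcases digit_eq_zero_or_one lam 0 with h0 | h0
    · rw [if_pos h0]
      fin_cases i
      · simp [h0] at hi
      · exact tame_harm _ ε hε
      · exact tame_harm _ ε hε
    · rw [if_neg (by simp [h0])]
      fin_cases i
      · exact tame_harm _ ε hε
      · simp [h0] at hi
      · simp [h0] at hi

/-- The solution takes the prescribed values on the upper boundary. -/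
theorem toFun_lower_of_mem {lam : ℝ} (h : lam ∈ Ico (0 : ℝ) 1) {f : Plane → ℝ}
    (hf : ContinuousOn f (upperBoundary lam)) {τ : ℝ} (hτ : τ ∈ f '' upperBoundary lam)
    (x x' : ℝ) {y : Plane} (hy : y ∈ upperBoundary lam) :
    system.toFun (lower lam f τ x x') y = f y := by
  have key : ∀ ε > 0, |system.toFun (lower lam f τ x x') y - f y| ≤ ε := by
    intro ε hε
    have := lower_induction hε (P := fun s => system.Tame s →
        ∀ lam f τ x x', s = lower lam f τ x x' → ∀ y ∈ upperBoundary lam,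
        |system.toFun s y - f y| ≤ ε)
      (fun lam f τ x x' L hI ht lam' f' τ' x₁ x₁' he y hy => ?_)
      (fun lam f τ x x' h hf ih ht lam' f' τ' x₁ x₁' he y hy => ?_) h hf hτ x x'
    · exact this (tame_lower h hf hτ x x') _ _ _ _ _ rfl y hy
    · cases he
      have h1 := CellSystem.toFun_mem_Icc ht (fun w i => (hI.descend w).val_mem i) y
      have h2 := hI.2.2.1 y hy
      rw [abs_le]
      constructor <;> linarith [h1.1, h1.2, h2.1, h2.2]
    · cases he
      obtain ⟨i, hi, z, hz, rfl⟩ := exists_of_mem_upperBoundary h hy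
      rw [CellSystem.toFun_F ht i (upperBoundary_subset_SG _ hz)]
      have hc : ∃ τ' x₁ x₁',
          (lower lam f τ x x').child i = lower (shift lam) (f ∘ F i) τ' x₁ x₁' := by
        rw [child]
        rcases digit_eq_zero_or_one lam 0 with h0 | h0
        · obtain rfl := hi.2 h0
          rw [if_pos h0]
          exact ⟨_, _, _, rfl⟩
        · rw [if_neg (by simp [h0])]
          fin_cases i
          · simp [h0] at hi
          · exact ⟨_, _, _, rfl⟩
          · exact ⟨_, _, _, rfl⟩
      obtain ⟨τ', x₁, x₁', hc⟩ := hc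
      exact ih i hi (ht.child i) _ _ _ _ _ hc z hz
  have : |system.toFun (lower lam f τ x x') y - f y| ≤ 0 :=
    le_of_forall_pos_le_add (by simpa using key)
  exact sub_eq_zero.1 (abs_nonpos_iff.1 this)

end State

/-! ### Discrete harmonicity -/

/-- The flux of `g` through the vertex `qᵢ`, computed from the three vertices `q₀, q₁, q₂`. -/
noncomputable def outflow (i : Fin 3) (g : Plane → ℝ) : ℝ :=
  2 * g (q i) - g (q (i + 1)) - g (q (i - 1))

theorem outflow_eq (i : Fin 3) (g : Plane → ℝ) :
    outflow i g = 3 * g (q i) - (g (q 0) + g (q 1) + g (q 2)) := by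
  unfold outflow
  fin_cases i
  · show 2 * g (q 0) - g (q 1) - g (q 2) = 3 * g (q 0) - (g (q 0) + g (q 1) + g (q 2))
    ring
  · show 2 * g (q 1) - g (q 2) - g (q 0) = 3 * g (q 1) - (g (q 0) + g (q 1) + g (q 2))
    ring
  · show 2 * g (q 2) - g (q 0) - g (q 1) = 3 * g (q 2) - (g (q 0) + g (q 1) + g (q 2))
    ring

theorem outflow_of_ne {i j k : Fin 3} (hij : i ≠ j) (hik : i ≠ k) (hjk : j ≠ k)
    (g : Plane → ℝ) : outflow i g = 2 * g (q i) - g (q j) - g (q k) := by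
  rw [outflow_eq]
  fin_cases i <;> fin_cases j <;> fin_cases k <;>
    first
    | exact absurd rfl hij
    | exact absurd rfl hik
    | exact absurd rfl hjk
    | (simp; ring)

theorem outflow_sub (i : Fin 3) (g h : Plane → ℝ) :
    outflow i (fun x => g x - h x) = outflow i g - outflow i h := by
  unfold outflow; ring

/-- The harmonic extension rule from `V 0` to `V 1`. -/
def ExtRule (g : Plane → ℝ) : Prop :=
  ∀ i j, i ≠ j → 5 * g (F i (q j)) = g (q i) + g (q j) + (g (q 0) + g (q 1) + g (q 2))

/-- The harmonic extension rule on every cell. -/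
def IsHarmonicOnCells (g : Plane → ℝ) : Prop := ∀ w, ExtRule (g ∘ cellMap w)

theorem ExtRule.outflow_F {g : Plane → ℝ} (hg : ExtRule g) (i : Fin 3) :
    outflow i (g ∘ F i) = 3 / 5 * outflow i g := by
  obtain ⟨j, k, hij, hik, hjk⟩ : ∃ j k : Fin 3, i ≠ j ∧ i ≠ k ∧ j ≠ k := by
    fin_cases i <;> decide
  have h1 := hg i j hij
  have h2 := hg i k hik
  have h3 := outflow_eq i g
  rw [outflow_of_ne hij hik hjk g] at h3
  rw [outflow_of_ne hij hik hjk g, outflow_of_ne hij hik hjk (g ∘ F i)]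
  simp only [Function.comp_apply, F_fixed]
  linarith

/-- The three junctions of the cells of level one, with zero total flux. -/
theorem ExtRule.junction {g : Plane → ℝ} (hg : ExtRule g) {i j : Fin 3} (hij : i ≠ j) :
    outflow j (g ∘ F i) + outflow i (g ∘ F j) = 0 := by
  have h01 := hg 0 1 (by decide)
  have h02 := hg 0 2 (by decide)
  have h12 := hg 1 2 (by decide)
  simp only [outflow_eq, Function.comp_apply]
  fin_cases i <;> fin_cases j <;> simp [F_fixed] at hij ⊢ <;>
    simp only [F_q_comm 1 0, F_q_comm 2 0, F_q_comm 2 1] <;> linarith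

theorem extRule_of_junction {g : Plane → ℝ}
    (h : ∀ i j, i ≠ j → outflow j (g ∘ F i) + outflow i (g ∘ F j) = 0) : ExtRule g := by
  have h01 := h 0 1 (by decide)
  have h02 := h 0 2 (by decide)
  have h12 := h 1 2 (by decide)
  simp only [outflow_eq, Function.comp_apply, F_fixed, F_q_comm 1 0, F_q_comm 2 0,
    F_q_comm 2 1] at h01 h02 h12
  intro i j hij
  fin_cases i <;> fin_cases j <;> simp at hij ⊢ <;>
    first
    | linarith
    | (rw [F_q_comm 1 0]; linarith)
    | (rw [F_q_comm 2 0]; linarith)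
    | (rw [F_q_comm 2 1]; linarith)

theorem IsHarmonicOnCells.comp {g : Plane → ℝ} (hg : IsHarmonicOnCells g) (w : List (Fin 3)) :
    IsHarmonicOnCells (g ∘ cellMap w) := by
  intro v
  have := hg (w ++ v)
  rwa [cellMap_append, ← Function.comp_assoc] at this

theorem cellMap_singleton (i : Fin 3) : cellMap [i] = F i := rfl

theorem cellMap_cons (i : Fin 3) (w : List (Fin 3)) : cellMap (i :: w) = F i ∘ cellMap w := rfl

theorem IsHarmonicOnCells.comp_F {g : Plane → ℝ} (hg : IsHarmonicOnCells g) (i : Fin 3) :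
    IsHarmonicOnCells (g ∘ F i) := hg.comp [i]

theorem IsHarmonicOnCells.outflow_replicate {g : Plane → ℝ} (hg : IsHarmonicOnCells g)
    (i : Fin 3) (k : ℕ) :
    outflow i (g ∘ cellMap (List.replicate k i)) = (3 / 5) ^ k * outflow i g := by
  induction k with
  | zero => simp [cellMap]
  | succ k ih =>
    rw [List.replicate_succ', cellMap_append, ← Function.comp_assoc]
    have h := hg (List.replicate k i)
    rw [cellMap_singleton, h.outflow_F i, ih, pow_succ]
    ring

/-- The two cells `F_v F_i F_j^k SG` and `F_v F_j F_i^k SG` meet at the vertex `F_v F_i q_j`, and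
the total flux of `u` through this vertex vanishes. -/
def BalancedAt (u : Plane → ℝ) (v : List (Fin 3)) (i j : Fin 3) (k : ℕ) : Prop :=
  outflow j (u ∘ cellMap (v ++ i :: List.replicate k j)) +
    outflow i (u ∘ cellMap (v ++ j :: List.replicate k i)) = 0

theorem balancedAt_cons (u : Plane → ℝ) (a : Fin 3) (v : List (Fin 3)) (i j : Fin 3) (k : ℕ) :
    BalancedAt u (a :: v) i j k ↔ BalancedAt (u ∘ F a) v i j k := Iff.rfl

theorem balancedAt_comp (u : Plane → ℝ) (w v : List (Fin 3)) (i j : Fin 3) (k : ℕ) :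
    BalancedAt u (w ++ v) i j k ↔ BalancedAt (u ∘ cellMap w) v i j k := by
  unfold BalancedAt
  rw [List.append_assoc, List.append_assoc, cellMap_append w, cellMap_append w]
  rfl

theorem balancedAt_nil (u : Plane → ℝ) (i j : Fin 3) (k : ℕ) :
    BalancedAt u [] i j k ↔
      outflow j ((u ∘ F i) ∘ cellMap (List.replicate k j)) +
        outflow i ((u ∘ F j) ∘ cellMap (List.replicate k i)) = 0 := Iff.rfl

theorem BalancedAt.sub {u u' : Plane → ℝ} {v : List (Fin 3)} {i j : Fin 3} {k : ℕ}
    (h : BalancedAt u v i j k) (h' : BalancedAt u' v i j k) :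
    BalancedAt (fun x => u x - u' x) v i j k := by
  unfold BalancedAt at *
  have e : ∀ w, (fun x => u x - u' x) ∘ cellMap w =
    fun x => (u ∘ cellMap w) x - (u' ∘ cellMap w) x := fun w => rfl
  rw [e, e, outflow_sub, outflow_sub]
  linarith

theorem BalancedAt.congr {u u' : Plane → ℝ} {v : List (Fin 3)} {i j : Fin 3} {k : ℕ}
    (h : EqOn u u' SG) : BalancedAt u v i j k ↔ BalancedAt u' v i j k := by
  unfold BalancedAt outflow
  simp only [Function.comp_apply, h (cellMap_mem_SG _ (q_mem_SG _))]

theorem IsHarmonicOnCells.balancedAt {g : Plane → ℝ} (hg : IsHarmonicOnCells g)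
    (v : List (Fin 3)) {i j : Fin 3} (hij : i ≠ j) (k : ℕ) : BalancedAt g v i j k := by
  have h0 := hg.comp v
  rw [← List.append_nil v, balancedAt_comp, balancedAt_nil,
    (h0.comp_F i).outflow_replicate, (h0.comp_F j).outflow_replicate, ← mul_add,
    ExtRule.junction (hg v) hij, mul_zero]

theorem extRule_of_balancedAt {g : Plane → ℝ} (w : List (Fin 3))
    (h : ∀ i j, i ≠ j → BalancedAt g w i j 0) : ExtRule (g ∘ cellMap w) := by
  refine extRule_of_junction fun i j hij => ?_
  have := h i j hij
  rw [← List.append_nil w, balancedAt_comp, balancedAt_nil] at this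
  exact this

/-- If both cells at the vertex are harmonic, the balance does not depend on the scale. -/
theorem BalancedAt.of_succ {u : Plane → ℝ} {v : List (Fin 3)} {i j : Fin 3} {k : ℕ}
    (h : BalancedAt u v i j (k + 1))
    (h1 : ExtRule (u ∘ cellMap (v ++ i :: List.replicate k j)))
    (h2 : ExtRule (u ∘ cellMap (v ++ j :: List.replicate k i))) : BalancedAt u v i j k := by
  have e : ∀ a b : Fin 3, v ++ a :: List.replicate (k + 1) b =
      (v ++ a :: List.replicate k b) ++ [b] := fun a b => by
    rw [List.replicate_succ']; simp
  have e1 := h1.outflow_F j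
  have e2 := h2.outflow_F i
  unfold BalancedAt at h ⊢
  rw [e, e, cellMap_append _ [j], cellMap_append _ [i], ← Function.comp_assoc,
    ← Function.comp_assoc, cellMap_singleton, cellMap_singleton, e1, e2] at h
  linarith

theorem ExtRule.congr {g h : Plane → ℝ} (hgh : EqOn g h SG) (hg : ExtRule g) : ExtRule h := by
  intro i j hij
  have := hg i j hij
  rwa [hgh (F_mem_SG i (q_mem_SG j)), hgh (q_mem_SG i), hgh (q_mem_SG j), hgh (q_mem_SG 0),
    hgh (q_mem_SG 1), hgh (q_mem_SG 2)] at this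

namespace State

theorem descend_harm (c : Fin 3 → ℝ) (w : List (Fin 3)) :
    ∃ c', system.descend (harm c) w = harm c' := by
  induction w generalizing c with
  | nil => exact ⟨c, rfl⟩
  | cons i w ih => exact ih _

theorem isHarmonicOnCells_harm (c : Fin 3 → ℝ) :
    IsHarmonicOnCells (system.toFun (harm c)) := by
  intro w
  obtain ⟨c', hc'⟩ := descend_harm c w
  refine ExtRule.congr (g := system.toFun (harm c')) (fun y hy => ?_) ?_
  · rw [Function.comp_apply, CellSystem.toFun_cellMap (tame_harm c) w hy, hc']
  · intro i j hij
    have ht := tame_harm c'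
    rw [CellSystem.toFun_F ht i (q_mem_SG j), CellSystem.toFun_q (ht.child i)]
    simp only [CellSystem.toFun_q ht]
    simp only [system_child, system_val, child, val, harmExt, if_neg (Ne.symm hij)]
    ring

end State

/-! ### Harmonicity at a vertex of the gasket -/

/-- A function that is continuous at `q_a` and harmonic in the complement of `q_a` is harmonic:
along the cells that shrink to `q_a`, the distance to the harmonic function with the same vertex
values is a sequence which starts at `0`, tends to `0`, and cannot decrease once it has
increased. -/
theorem extRule_of_corner {g : Plane → ℝ} (a : Fin 3) (hg : ContinuousOn g SG)
    (hn : ∀ v i j k, i ≠ j → (∃ b ∈ v ++ i :: List.replicate k j, b ≠ a) →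
      (∃ b ∈ v ++ j :: List.replicate k i, b ≠ a) → BalancedAt g v i j k) : ExtRule g := by
  obtain ⟨b, c, hab, hac, hbc, hall⟩ : ∃ b c : Fin 3, a ≠ b ∧ a ≠ c ∧ b ≠ c ∧
      ∀ i, i = a ∨ i = b ∨ i = c := by
    fin_cases a <;> decide
  set h := State.system.toFun (State.harm fun i => g (q i)) with hh
  have hH : IsHarmonicOnCells h := State.isHarmonicOnCells_harm _
  have hq : ∀ i, h (q i) = g (q i) := fun i =>
    CellSystem.toFun_q (State.tame_harm _) i
  set e : Plane → ℝ := fun x => g x - h x with he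
  have heq : ∀ i, e (q i) = 0 := fun i => by simp [he, hq]
  have hec : ContinuousOn e SG := hg.sub (CellSystem.continuousOn_toFun (State.tame_harm _))
  have hb : ∀ v i j k, i ≠ j → (∃ b ∈ v ++ i :: List.replicate k j, b ≠ a) →
      (∃ b ∈ v ++ j :: List.replicate k i, b ≠ a) → BalancedAt e v i j k :=
    fun v i j k hij h1 h2 => (hn v i j k hij h1 h2).sub (hH.balancedAt v hij k)
  set R : ℕ → List (Fin 3) := fun m => List.replicate m a with hR
  have hRs : ∀ m (x : Plane), cellMap (R (m + 1)) x = cellMap (R m) (F a x) := by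
    intro m x
    rw [hR]
    simp only [List.replicate_succ', cellMap_append, cellMap_singleton, Function.comp_apply]
  have hex : ∀ m {b' : Fin 3}, b' ≠ a → ExtRule (e ∘ cellMap (R m ++ [b'])) := by
    intro m b' hb'
    exact extRule_of_balancedAt _ fun i j hij => hb _ _ _ _ hij
      ⟨b', by simp, hb'⟩ ⟨b', by simp, hb'⟩
  set A : Fin 3 → ℕ → ℝ := fun b' m => e (cellMap (R m) (q b')) with hA
  set C : ℕ → ℝ := fun m => e (cellMap (R m) (F b (q c))) with hC
  have hC' : ∀ m, C m = e (cellMap (R m) (F c (q b))) := fun m => by rw [hC, F_q_comm]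
  have hCe : ∀ m, 4 * C m = A b m + A c m + A b (m + 1) + A c (m + 1) := by
    intro m
    have h1 := hb (R m) b c 0 hbc ⟨b, by simp, hab.symm⟩ ⟨c, by simp, hac.symm⟩
    rw [← List.append_nil (R m), balancedAt_comp, balancedAt_nil,
      outflow_of_ne hbc.symm hac.symm hab.symm, outflow_of_ne hbc hab.symm hac.symm] at h1
    simp only [List.replicate_zero, cellMap, Function.comp_apply, id, F_fixed] at h1
    have h2 := hC' m
    simp only [hA, hC, hRs, F_q_comm a] at h2 ⊢
    linarith
  have hAe : ∀ {b' c' : Fin 3}, a ≠ b' → a ≠ c' → b' ≠ c' →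
      (∀ m, C m = e (cellMap (R m) (F b' (q c')))) → ∀ m,
      16 / 5 * A b' (m + 1) =
        A b' (m + 2) + C (m + 1) + 3 / 5 * A b' m + 3 / 5 * C m := by
    intro b' c' hab hac hbc hCC m
    have h1 := hb (R m) a b' 1 hab ⟨b', by simp, hab.symm⟩ ⟨b', by simp, hab.symm⟩
    unfold BalancedAt at h1
    have e1 : R m ++ a :: List.replicate 1 b' = R (m + 1) ++ [b'] := by
      simp [hR, List.replicate_succ']
    have e2 : R m ++ b' :: List.replicate 1 a = (R m ++ [b']) ++ [a] := by simp
    rw [e1, e2, cellMap_append _ [a], ← Function.comp_assoc, cellMap_singleton,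
      (hex m hab.symm).outflow_F, outflow_of_ne hab.symm hbc hac, outflow_of_ne hab hac hbc] at h1
    simp only [cellMap_append, cellMap_singleton, Function.comp_apply, F_fixed] at h1
    have h2 := hCC m
    have h3 := hCC (m + 1)
    simp only [hA, hRs, F_q_comm a] at h1 h2 h3 ⊢
    linarith
  have hAb := hAe hab hac hbc fun m => rfl
  have hAc := hAe hac hab hbc.symm hC'
  set M : ℕ → ℝ := fun m => max |A b m| |A c m| with hM
  have hMb : ∀ m, |A b m| ≤ M m := fun m => le_max_left _ _
  have hMc : ∀ m, |A c m| ≤ M m := fun m => le_max_right _ _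
  have hMC : ∀ m, |C m| ≤ (M m + M (m + 1)) / 2 := by
    intro m
    have h0 := hCe m
    have h1 := abs_le.1 (hMb m)
    have h2 := abs_le.1 (hMc m)
    have h3 := abs_le.1 (hMb (m + 1))
    have h4 := abs_le.1 (hMc (m + 1))
    rw [abs_le]
    constructor <;> linarith [h1.1, h1.2, h2.1, h2.2, h3.1, h3.2, h4.1, h4.2]
  have hMle : ∀ m, 12 / 5 * M (m + 1) ≤ 3 / 2 * M (m + 2) + 9 / 10 * M m := by
    intro m
    have h1 := abs_le.1 (hMC m)
    have h2 := abs_le.1 (hMC (m + 1))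
    have key : ∀ x : ℕ → ℝ, (∀ m, |x m| ≤ M m) →
        16 / 5 * x (m + 1) = x (m + 2) + C (m + 1) + 3 / 5 * x m + 3 / 5 * C m →
        16 / 5 * |x (m + 1)| ≤ 3 / 2 * M (m + 2) + 9 / 10 * M m + 4 / 5 * M (m + 1) := by
      intro x hx hxe
      have h3 := abs_le.1 (hx m)
      have h4 := abs_le.1 (hx (m + 2))
      rcases abs_cases (x (m + 1)) with ⟨h5, -⟩ | ⟨h5, -⟩ <;> rw [h5] <;>
        linarith [h1.1, h1.2, h2.1, h2.2, h3.1, h3.2, h4.1, h4.2]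
    have k1 := key _ hMb (hAb m)
    have k2 := key _ hMc (hAc m)
    have : M (m + 1) = max |A b (m + 1)| |A c (m + 1)| := rfl
    rcases max_choice |A b (m + 1)| |A c (m + 1)| with h5 | h5 <;> rw [h5] at this <;>
      linarith
  have hM0 : M 0 = 0 := by
    simp [hM, hA, hR, cellMap, heq]
  have hmono : ∀ m, M m ≤ M (m + 1) := by
    intro m
    induction m with
    | zero => rw [hM0]; exact (abs_nonneg _).trans (hMb _)
    | succ m ih => linarith [hMle m]
  have hlim : Tendsto M atTop (𝓝 0) := by
    have hpt : ∀ b', Tendsto (fun m => A b' m) atTop (𝓝 0) := by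
      intro b'
      have h1 : Tendsto (fun m => cellMap (R m) (q b')) atTop (𝓝[SG] (q a)) := by
        refine tendsto_nhdsWithin_iff.2 ⟨?_, Eventually.of_forall fun m =>
          cellMap_mem_SG _ (q_mem_SG _)⟩
        rw [tendsto_iff_dist_tendsto_zero]
        have h2 : ∀ m, dist (cellMap (R m) (q b')) (q a) = (1 / 2) ^ m * dist (q b') (q a) := by
          intro m
          have := dist_cellMap (R m) (q b') (q a)
          rwa [hR, cellMap_replicate_q, List.length_replicate] at this
        simp only [h2]
        simpa using (tendsto_pow_atTop_nhds_zero_of_lt_one (r := (1 / 2 : ℝ))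
          (by norm_num) (by norm_num)).mul_const (dist (q b') (q a))
      have h2 := (hec (q a) (q_mem_SG a)).tendsto.comp h1
      rwa [heq] at h2
    have := ((hpt b).abs).max ((hpt c).abs)
    simpa using this
  have hM1 : M 1 ≤ 0 :=
    ge_of_tendsto hlim ((eventually_ge_atTop 1).mono fun m hm => monotone_nat_of_le_succ hmono hm)
  have hA1 : A b 1 = 0 := abs_nonpos_iff.1 ((hMb 1).trans hM1)
  have hA2 : A c 1 = 0 := abs_nonpos_iff.1 ((hMc 1).trans hM1)
  have hC0 : C 0 = 0 := by
    have h1 := hCe 0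
    have h2 : A b 0 = 0 := heq b
    have h3 : A c 0 = 0 := heq c
    linarith
  have e1 : e (F a (q b)) = 0 := hA1
  have e2 : e (F a (q c)) = 0 := hA2
  have e3 : e (F b (q c)) = 0 := hC0
  have hz : ∀ i j, i ≠ j → g (F i (q j)) = h (F i (q j)) := by
    intro i j hij
    apply sub_eq_zero.1
    show e (F i (q j)) = 0
    rcases hall i with rfl | rfl | rfl <;> rcases hall j with rfl | rfl | rfl <;>
      first
      | exact absurd rfl hij
      | assumption
      | (rw [F_q_comm]; assumption)
  intro i j hij
  have := hH [] i j hij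
  simp only [cellMap, Function.comp_id, hq] at this
  rw [hz i j hij, this]

/-! ### The energy as a sum over vertices -/

theorem sum_words_succ (m : ℕ) (Φ : List (Fin 3) → ℝ) :
    ∑ w : Fin (m + 1) → Fin 3, Φ (List.ofFn w) =
      ∑ a : Fin 3, ∑ w : Fin m → Fin 3, Φ (a :: List.ofFn w) := by
  rw [← (Fin.consEquiv (fun _ : Fin (m + 1) => Fin 3)).sum_comp, Fintype.sum_prod_type]
  simp [Fin.consEquiv]

theorem sum_words_zero (Φ : List (Fin 3) → ℝ) :
    ∑ w : Fin 0 → Fin 3, Φ (List.ofFn w) = Φ [] := by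
  simp

/-- The sum of `φ` times the flux of `u` over the vertices of the cells of level `m`. -/
noncomputable def fluxSum (m : ℕ) (u φ : Plane → ℝ) : ℝ :=
  ∑ w : Fin m → Fin 3, ∑ i : Fin 3,
    φ (cellMap (List.ofFn w) (q i)) * outflow i (u ∘ cellMap (List.ofFn w))

theorem fluxSum_zero (u φ : Plane → ℝ) : fluxSum 0 u φ = ∑ i, φ (q i) * outflow i u := by
  unfold fluxSum
  rw [sum_words_zero (fun w => ∑ i : Fin 3, φ (cellMap w (q i)) * outflow i (u ∘ cellMap w))]
  rfl

theorem fluxSum_succ (m : ℕ) (u φ : Plane → ℝ) :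
    fluxSum (m + 1) u φ = ∑ a, fluxSum m (u ∘ F a) (φ ∘ F a) := by
  unfold fluxSum
  rw [sum_words_succ m (fun w => ∑ i : Fin 3, φ (cellMap w (q i)) * outflow i (u ∘ cellMap w))]
  rfl

theorem graphEnergy_eq_fluxSum (m : ℕ) (u φ : Plane → ℝ) :
    graphEnergy m u φ = (5 / 3 : ℝ) ^ m * fluxSum m u φ := by
  unfold graphEnergy fluxSum
  congr 1
  refine Finset.sum_congr rfl fun w _ => ?_
  rw [Fin.sum_univ_three, Fin.sum_univ_three, outflow_eq, outflow_eq, outflow_eq]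
  simp only [Function.comp_apply, zero_add, show (1 + 1 : Fin 3) = 2 by decide,
    show (2 + 1 : Fin 3) = 0 by decide]
  ring

theorem graphEnergy_comm (m : ℕ) (u v : Plane → ℝ) : graphEnergy m u v = graphEnergy m v u := by
  unfold graphEnergy
  simp only [mul_comm]

theorem graphEnergy_succ (m : ℕ) (u φ : Plane → ℝ) :
    graphEnergy (m + 1) u φ = 5 / 3 * ∑ a, graphEnergy m (u ∘ F a) (φ ∘ F a) := by
  simp only [graphEnergy_eq_fluxSum, fluxSum_succ, pow_succ, Finset.mul_sum]
  refine Finset.sum_congr rfl fun a _ => ?_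
  ring

/-- Summation by parts: if at each inner vertex `φ` vanishes or `u` is balanced, then only the
three boundary vertices contribute. -/
theorem fluxSum_eq_of_balanced (m : ℕ) (u φ : Plane → ℝ)
    (h : ∀ v i j k, i ≠ j → v.length + 1 + k = m →
      φ (cellMap v (F i (q j))) = 0 ∨ BalancedAt u v i j k) :
    fluxSum m u φ = ∑ i, φ (q i) * outflow i (u ∘ cellMap (List.replicate m i)) := by
  induction m generalizing u φ with
  | zero => exact fluxSum_zero u φ
  | succ m ih =>
    have h1 : ∀ a, fluxSum m (u ∘ F a) (φ ∘ F a) =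
        ∑ i, φ (F a (q i)) * outflow i ((u ∘ F a) ∘ cellMap (List.replicate m i)) := by
      intro a
      refine ih _ _ fun v i j k hij hk => ?_
      have := h (a :: v) i j k hij (by simp; omega)
      rwa [balancedAt_cons] at this
    have h2 : ∀ i j, i ≠ j → φ (F i (q j)) *
        (outflow j ((u ∘ F i) ∘ cellMap (List.replicate m j)) +
          outflow i ((u ∘ F j) ∘ cellMap (List.replicate m i))) = 0 := by
      intro i j hij
      rcases h [] i j m hij (by simp; omega) with h3 | h3
      · rw [cellMap, id] at h3
        rw [h3, zero_mul]
      · rw [(balancedAt_nil _ _ _ _).1 h3, mul_zero]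
    have h01 := h2 0 1 (by decide)
    have h02 := h2 0 2 (by decide)
    have h12 := h2 1 2 (by decide)
    have e : ∀ i, u ∘ cellMap (List.replicate (m + 1) i) =
        (u ∘ F i) ∘ cellMap (List.replicate m i) := fun i => rfl
    rw [fluxSum_succ, Fin.sum_univ_three]
    simp only [h1, e, Fin.sum_univ_three, F_fixed, F_q_comm 1 0, F_q_comm 2 0, F_q_comm 2 1]
    linarith

theorem graphEnergy_of_isHarmonicOnCells {ψ : Plane → ℝ} (hψ : IsHarmonicOnCells ψ)
    (u : Plane → ℝ) (m : ℕ) : graphEnergy m u ψ = graphEnergy 0 u ψ := by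
  rw [graphEnergy_comm, graphEnergy_comm 0, graphEnergy_eq_fluxSum, graphEnergy_eq_fluxSum,
    fluxSum_eq_of_balanced m ψ u fun v i j k hij _ => Or.inr (hψ.balancedAt v hij k),
    fluxSum_zero, pow_zero, one_mul, Finset.mul_sum]
  refine Finset.sum_congr rfl fun i _ => ?_
  rw [hψ.outflow_replicate]
  have : (5 / 3 : ℝ) ^ m * (3 / 5) ^ m = 1 := by rw [← mul_pow]; norm_num
  linear_combination (u (q i) * outflow i ψ) * this

theorem graphEnergy_of_piecewise_harmonic {n : ℕ} {ψ : Plane → ℝ}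
    (hψ : ∀ w : List (Fin 3), w.length = n → IsHarmonicOnCells (ψ ∘ cellMap w))
    (u : Plane → ℝ) (m : ℕ) : graphEnergy (n + m) u ψ = graphEnergy n u ψ := by
  induction n generalizing u ψ with
  | zero => rw [zero_add]; exact graphEnergy_of_isHarmonicOnCells (hψ [] rfl) u m
  | succ n ih =>
    rw [show n + 1 + m = (n + m) + 1 by omega, graphEnergy_succ, graphEnergy_succ]
    congr 1
    exact Finset.sum_congr rfl fun a _ => ih (fun w hw => hψ (a :: w) (by simp [hw])) _

theorem finiteEnergy_of_isHarmonicOnCells {g : Plane → ℝ} (hg : IsHarmonicOnCells g) :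
    FiniteEnergy g :=
  ⟨graphEnergy 0 g g, by
    simp only [graphEnergy_of_isHarmonicOnCells hg g]
    exact tendsto_const_nhds⟩

theorem IsHarmonicOnCells.congr {g h : Plane → ℝ} (hgh : EqOn g h SG)
    (hg : IsHarmonicOnCells g) : IsHarmonicOnCells h := fun w =>
  (hg w).congr fun _ hx => hgh (cellMap_mem_SG w hx)

/-! ### Test functions -/

namespace State

theorem toFun_spline_zero (G : Plane → ℝ) :
    system.toFun (spline 0 G) = system.toFun (harm fun i => G (q i)) := by
  funext x
  unfold CellSystem.toFun
  congr 1
  funext n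
  cases n <;> rfl

theorem toFun_spline_cellMap (G : Plane → ℝ) (w : List (Fin 3)) {y : Plane} (hy : y ∈ SG) :
    system.toFun (spline w.length G) (cellMap w y) =
      system.toFun (harm fun i => G (cellMap w (q i))) y := by
  induction w generalizing G with
  | nil => exact congrFun (toFun_spline_zero G) y
  | cons a w ih =>
    rw [cellMap_cons, Function.comp_apply,
      CellSystem.toFun_F (tame_spline _ _) a (cellMap_mem_SG w hy)]
    exact ih (G ∘ F a)

theorem toFun_harm_zero : system.toFun (harm fun _ => 0) = fun _ => 0 := by
  funext x
  have h : InRange 0 0 (harm fun _ => 0) := fun i => ⟨le_rfl, le_rfl⟩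
  have := CellSystem.toFun_mem_Icc (tame_harm fun _ => 0)
    (fun w i => (h.descend w).val_mem i) x
  exact le_antisymm this.2 this.1

end State

open Classical in
/-- The harmonic spline of level `n` with the value `1` at the point `x` of `V n`, and `0` at all
other points of `V n`. -/
noncomputable def tent (n : ℕ) (x : Plane) : Plane → ℝ :=
  State.system.toFun (State.spline n fun y => if y = x then 1 else 0)

open Classical in
theorem tent_cellMap {n : ℕ} (x : Plane) {w : List (Fin 3)} (hw : w.length = n) {y : Plane}
    (hy : y ∈ SG) : tent n x (cellMap w y) =
      State.system.toFun (State.harm fun i => if cellMap w (q i) = x then 1 else 0) y := by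
  subst hw
  exact State.toFun_spline_cellMap _ w hy

open Classical in
theorem tent_vertex {n : ℕ} (x : Plane) {w : List (Fin 3)} (hw : w.length = n) (i : Fin 3) :
    tent n x (cellMap w (q i)) = if cellMap w (q i) = x then 1 else 0 := by
  rw [tent_cellMap x hw (q_mem_SG i), CellSystem.toFun_q (State.tame_harm _)]
  rfl

theorem exists_cellMap_eq {x : Plane} (hx : x ∈ SG) (n : ℕ) :
    ∃ w : List (Fin 3), w.length = n ∧ ∃ y ∈ SG, cellMap w y = x :=
  exists_cellMap SG_selfSimilar n x hx

/-- A weakly harmonic function is balanced at each vertex whose two cells lie in the domain. -/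
theorem IsHarmonicIn.balancedAt {Ω : Set Plane} {u : Plane → ℝ} (hu : IsHarmonicIn Ω u)
    {v : List (Fin 3)} {i j : Fin 3} {k : ℕ} (hij : i ≠ j)
    (h1 : cellMap (v ++ i :: List.replicate k j) '' SG ⊆ Ω)
    (h2 : cellMap (v ++ j :: List.replicate k i) '' SG ⊆ Ω) : BalancedAt u v i j k := by
  classical
  set n := v.length + 1 + k with hn
  set W := v ++ i :: List.replicate k j with hW
  set W' := v ++ j :: List.replicate k i with hW'
  have hWl : W.length = n := by simp [hW, hn]; omega
  have hWl' : W'.length = n := by simp [hW', hn]; omega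
  set x := cellMap W (q j) with hx
  have hx' : cellMap W' (q i) = x := by
    rw [hx, hW, hW']
    simp only [cellMap_append, cellMap_cons, Function.comp_apply, cellMap_replicate_q, F_q_comm]
  have hWne : W ≠ W' := by
    intro h
    have := List.append_cancel_left h
    simp only [List.cons.injEq] at this
    exact hij this.1
  -- The point `x` is a vertex of exactly two cells of level `n`.
  have hvert : ∀ w : List (Fin 3), w.length = n → ∀ y ∈ SG, cellMap w y = x →
      (w = W ∧ y = q j) ∨ (w = W' ∧ y = q i) := by
    intro w hw y hy hyx
    rcases cellMap_eq_cellMap (hWl.trans hw.symm) (q_mem_SG j) hy (hx.symm.trans hyx.symm) with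
      ⟨h3, h4⟩ | ⟨v', a, b, l, hab, h3, h4, h5, h6⟩
    · exact Or.inl ⟨h3.symm, h4.symm⟩
    · right
      obtain rfl := q_injective h5
      rcases cellMap_eq_cellMap (hWl'.trans hw.symm) (q_mem_SG i) hy (hx'.trans hyx.symm) with
        ⟨h7, h8⟩ | ⟨v'', c, d, l', hcd, h7, h8, h9, h10⟩
      · exact ⟨h7.symm, h8.symm⟩
      · -- Both alternatives together would give `v ++ [i]` and `v ++ [j]` as prefixes of `w`.
        exfalso
        obtain rfl := q_injective h9
        obtain rfl : a = c := q_injective (h6.symm.trans h10)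
        have key : ∀ (v v' : List (Fin 3)) (b c e : Fin 3) (k l : ℕ), e ≠ b → c ≠ b →
            v ++ e :: List.replicate k b = v' ++ c :: List.replicate l b → v = v' ∧ e = c := by
          intro v v' b c e k l heb hcb h
          have h' := congrArg List.reverse h
          simp only [List.reverse_append, List.reverse_cons, List.reverse_replicate,
            List.append_assoc, List.singleton_append] at h'
          clear h
          induction k generalizing l with
          | zero =>
            cases l with
            | zero =>
              simp only [List.replicate_zero, List.nil_append, List.cons.injEq,
                List.reverse_inj] at h'
              exact ⟨h'.2, h'.1⟩
            | succ l =>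
              rw [List.replicate_succ] at h'
              simp at h'
              exact absurd h'.1 heb
          | succ k ih =>
            cases l with
            | zero =>
              rw [List.replicate_succ] at h'
              simp at h'
              exact absurd h'.1.symm hcb
            | succ l =>
              rw [List.replicate_succ, List.replicate_succ] at h'
              simp at h'
              exact ih l (by simpa using h')
        obtain ⟨h11, h12⟩ := key v v' j a i k l hij hab h3
        obtain ⟨h13, h14⟩ := key v v'' i a j k l' hij.symm hcd h7
        exact hij (h12.trans h14.symm)
  set ψ := tent n x with hψ
  have hharm : ∀ w : List (Fin 3), w.length = n → IsHarmonicOnCells (ψ ∘ cellMap w) := by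
    intro w hw
    exact (State.isHarmonicOnCells_harm _).congr fun y hy => (tent_cellMap x hw hy).symm
  have htest : IsTestFunction Ω ψ := by
    refine ⟨CellSystem.continuousOn_toFun (State.tame_spline _ _), ⟨graphEnergy n ψ ψ, ?_⟩,
      cellMap W '' SG ∪ cellMap W' '' SG, union_subset h1 h2,
      (isCompact_SG.image (continuous_cellMap _)).union
        (isCompact_SG.image (continuous_cellMap _)), ?_⟩
    · rw [← tendsto_add_atTop_iff_nat n]
      simp only [add_comm _ n, graphEnergy_of_piecewise_harmonic hharm ψ]
      exact tendsto_const_nhds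
    · rintro y ⟨hy, hy'⟩
      obtain ⟨w, hw, z, hz, rfl⟩ := exists_cellMap_eq hy n
      have hne : ∀ a, cellMap w (q a) ≠ x := by
        intro a ha
        apply hy'
        rcases hvert w hw _ (q_mem_SG a) ha with ⟨rfl, -⟩ | ⟨rfl, -⟩
        · exact Or.inl ⟨z, hz, rfl⟩
        · exact Or.inr ⟨z, hz, rfl⟩
      rw [hψ, tent_cellMap x hw hz]
      simp only [if_neg (hne _), State.toFun_harm_zero]
  have hlim := hu.2 ψ htest
  rw [← tendsto_add_atTop_iff_nat n] at hlim
  simp only [add_comm _ n, graphEnergy_of_piecewise_harmonic hharm u] at hlim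
  have h0 := tendsto_nhds_unique hlim tendsto_const_nhds
  rw [graphEnergy_eq_fluxSum] at h0
  have h3 := (mul_eq_zero.1 h0.symm).resolve_left (by positivity)
  unfold fluxSum at h3
  rw [← Fintype.sum_prod_type' (fun (w : Fin n → Fin 3) (a : Fin 3) =>
    ψ (cellMap (List.ofFn w) (q a)) * outflow a (u ∘ cellMap (List.ofFn w)))] at h3
  obtain ⟨ω, hω⟩ : ∃ ω : Fin n → Fin 3, List.ofFn ω = W := by
    rw [← hWl]
    exact ⟨W.get, List.ofFn_get W⟩
  obtain ⟨ω', hω'⟩ : ∃ ω : Fin n → Fin 3, List.ofFn ω = W' := by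
    rw [← hWl']
    exact ⟨W'.get, List.ofFn_get W'⟩
  rw [Fintype.sum_eq_add (ω, j) (ω', i)] at h3
  · simp only [hω, hω', hψ] at h3
    rw [tent_vertex x hWl, tent_vertex x hWl', if_pos hx.symm, if_pos hx', one_mul, one_mul] at h3
    exact h3
  · intro h
    exact hij (congrArg Prod.snd h).symm
  · rintro ⟨w, a⟩ ⟨hwa, hwa'⟩
    simp only [hψ]
    rw [tent_vertex x (List.length_ofFn), if_neg, zero_mul]
    intro h
    rcases hvert _ (List.length_ofFn) _ (q_mem_SG a) h with ⟨h5, h6⟩ | ⟨h5, h6⟩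
    · exact hwa (Prod.ext (List.ofFn_injective (h5.trans hω.symm)) (q_injective h6))
    · exact hwa' (Prod.ext (List.ofFn_injective (h5.trans hω'.symm)) (q_injective h6))

/-! ### Cells below the slice -/

/-- The cell of the word `w` lies strictly below the slice of `lam`. -/
def Below (lam : ℝ) (w : List (Fin 3)) : Prop := cellMap w (q 0) 1 < 1 - lam

theorem not_below_nil {lam : ℝ} (h : lam ∈ Ico (0 : ℝ) 1) : ¬ Below lam [] := by
  simp only [Below, cellMap, id, q_zero_height]
  linarith [h.1]

theorem cellMap_height_le (w : List (Fin 3)) {x : Plane} (hx : x ∈ SG) :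
    cellMap w x 1 ≤ cellMap w (q 0) 1 := by
  rw [cellMap_height w x]
  have : 0 ≤ (1 / 2 : ℝ) ^ w.length * (1 - x 1) :=
    mul_nonneg (by positivity) (by linarith [height_le_one hx])
  linarith

theorem Below.append {lam : ℝ} {w : List (Fin 3)} (h : Below lam w) (v : List (Fin 3)) :
    Below lam (w ++ v) := by
  unfold Below at *
  rw [cellMap_append]
  exact (cellMap_height_le w (cellMap_mem_SG v (q_mem_SG 0))).trans_lt h

theorem below_zero_cons {lam : ℝ} (h : lam ∈ Ico (0 : ℝ) 1) (h0 : digit lam 0 = 0)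
    (w : List (Fin 3)) : Below lam (0 :: w) ↔ Below (shift lam) w := by
  rw [Below, Below, cellMap_cons, Function.comp_apply, F_height_zero, shift_of_digit_zero h h0]
  constructor <;> intro h <;> linarith

theorem below_cons_of_digit_zero {lam : ℝ} (h : lam ∈ Ico (0 : ℝ) 1) (h0 : digit lam 0 = 0)
    {i : Fin 3} (hi : i ≠ 0) (w : List (Fin 3)) : Below lam (i :: w) := by
  rw [Below, cellMap_cons, Function.comp_apply, F_height_of_ne hi]
  have := height_le_one (cellMap_mem_SG w (q_mem_SG 0))
  linarith [lt_half_of_digit h h0]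

theorem not_below_zero_cons {lam : ℝ} (h : lam ∈ Ico (0 : ℝ) 1) (h0 : digit lam 0 = 1)
    (w : List (Fin 3)) : ¬ Below lam (0 :: w) := by
  rw [Below, cellMap_cons, Function.comp_apply, F_height_zero]
  have := height_nonneg (cellMap_mem_SG w (q_mem_SG 0))
  linarith [half_le_of_digit h h0]

theorem below_cons_of_digit_one {lam : ℝ} (h : lam ∈ Ico (0 : ℝ) 1) (h0 : digit lam 0 = 1)
    {i : Fin 3} (hi : i ≠ 0) (w : List (Fin 3)) : Below lam (i :: w) ↔ Below (shift lam) w := by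
  rw [Below, Below, cellMap_cons, Function.comp_apply, F_height_of_ne hi, shift_of_digit_one h h0]
  constructor <;> intro h <;> linarith

theorem exists_below_replicate {lam : ℝ} (h : lam ∈ Ico (0 : ℝ) 1) {i : Fin 3} (hi : i ≠ 0) :
    ∃ N, ∀ K ≥ N, Below lam (List.replicate K i) := by
  have h1 : ∀ K, cellMap (List.replicate K i) (q 0) 1 = (1 / 2) ^ K := by
    intro K
    have h2 := cellMap_height (List.replicate K i) (q i)
    rw [cellMap_replicate_q, q_height_of_ne hi, List.length_replicate] at h2
    linarith
  have ht := tendsto_pow_atTop_nhds_zero_of_lt_one (r := (1 / 2 : ℝ)) (by norm_num) (by norm_num)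
  obtain ⟨N, hN⟩ := eventually_atTop.1 (ht.eventually (gt_mem_nhds (sub_pos.2 h.2)))
  exact ⟨N, fun K hK => by rw [Below, h1]; exact hN K hK⟩

theorem cell_subset_closedLowerDomain {lam : ℝ} (h : lam ∈ Ico (0 : ℝ) 1) {w : List (Fin 3)}
    (hw : Below lam w) : cellMap w '' SG ⊆ closedLowerDomain lam := by
  rintro _ ⟨y, hy, rfl⟩
  have h1 : cellMap w y 1 < 1 - lam := (cellMap_height_le w hy).trans_lt hw
  by_cases hV : cellMap w y ∈ V 0
  · obtain ⟨a, ha⟩ := hV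
    rw [← ha] at h1 ⊢
    refine Or.inr (Or.inr ?_)
    fin_cases a
    · simp only [Fin.zero_eta, q_zero_height] at h1
      linarith [h.1]
    · exact Or.inl rfl
    · exact Or.inr rfl
  · exact Or.inl ⟨⟨cellMap_mem_SG w hy, hV⟩, h1⟩

theorem cell_subset_lowerDomain {lam : ℝ} {w : List (Fin 3)}
    (hw : Below lam w) (hn : ∀ a, ∃ b ∈ w, b ≠ a) : cellMap w '' SG ⊆ lowerDomain lam := by
  rintro _ ⟨y, hy, rfl⟩
  refine ⟨⟨cellMap_mem_SG w hy, ?_⟩, (cellMap_height_le w hy).trans_lt hw⟩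
  rintro ⟨a, ha⟩
  obtain ⟨h1, -⟩ := eq_replicate_of_cellMap_eq_q hy ha.symm
  obtain ⟨b, hb, hba⟩ := hn a
  rw [h1] at hb
  exact hba (List.eq_of_mem_replicate hb)

/-! ### Weak harmonicity and balance of fluxes -/

/-- The fluxes of `u` are balanced at all vertices whose two cells lie below the slice of `lam`.
In contrast to the weak formulation, the cells may contain `q₁` or `q₂`. -/
def IsBalanced (lam : ℝ) (u : Plane → ℝ) : Prop :=
  ∀ v i j k, i ≠ j → Below lam (v ++ i :: List.replicate k j) →
    Below lam (v ++ j :: List.replicate k i) → BalancedAt u v i j k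

theorem IsBalanced.sub {lam : ℝ} {u u' : Plane → ℝ} (h : IsBalanced lam u)
    (h' : IsBalanced lam u') : IsBalanced lam (fun x => u x - u' x) :=
  fun v i j k hij h1 h2 => (h v i j k hij h1 h2).sub (h' v i j k hij h1 h2)

theorem IsBalanced.isHarmonicOnCells {lam : ℝ} {u : Plane → ℝ} (hu : IsBalanced lam u)
    {w : List (Fin 3)} (hw : Below lam w) : IsHarmonicOnCells (u ∘ cellMap w) := by
  intro v
  rw [Function.comp_assoc, ← cellMap_append]
  refine extRule_of_balancedAt _ fun i j hij => hu _ _ _ _ hij ?_ ?_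
  · exact (hw.append v).append [i]
  · exact (hw.append v).append [j]

theorem isBalanced_of_isHarmonicIn {lam : ℝ} (h : lam ∈ Ico (0 : ℝ) 1) {u : Plane → ℝ}
    (hc : ContinuousOn u (closedLowerDomain lam)) (hu : IsHarmonicIn (lowerDomain lam) u) :
    IsBalanced lam u := by
  have hne : ∀ v i j k, i ≠ j → Below lam (v ++ i :: List.replicate k j) →
      Below lam (v ++ j :: List.replicate k i) →
      (∀ a, ∃ b ∈ v ++ i :: List.replicate k j, b ≠ a) →
      (∀ a, ∃ b ∈ v ++ j :: List.replicate k i, b ≠ a) → BalancedAt u v i j k :=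
    fun v i j k hij h1 h2 h3 h4 => hu.balancedAt hij (cell_subset_lowerDomain h1 h3)
      (cell_subset_lowerDomain h2 h4)
  have hext : ∀ w, Below lam w → ExtRule (u ∘ cellMap w) := by
    intro w hw
    by_cases hcon : ∃ a, ∀ b ∈ w, b = a
    · -- The cell contains the vertex `q_a`, where the test functions give no information.
      obtain ⟨a, ha⟩ := hcon
      have haw : a ∈ w := by
        cases w with
        | nil => exact absurd hw (not_below_nil h)
        | cons b w => rw [ha b (by simp)]; simp
      have hlift : ∀ v : List (Fin 3), (∃ b ∈ v, b ≠ a) → ∀ a', ∃ b ∈ w ++ v, b ≠ a' := by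
        rintro v ⟨b, hb, hba⟩ a'
        by_cases h' : a' = a
        · exact ⟨b, List.mem_append_right _ hb, by rwa [h']⟩
        · exact ⟨a, List.mem_append_left _ haw, Ne.symm h'⟩
      refine extRule_of_corner a ?_ fun v i j k hij h1 h2 => ?_
      · exact hc.comp (continuous_cellMap w).continuousOn
          fun y hy => cell_subset_closedLowerDomain h hw ⟨y, hy, rfl⟩
      · rw [← balancedAt_comp]
        refine hne _ _ _ _ hij ?_ ?_ ?_ ?_
        · rw [List.append_assoc]; exact hw.append _
        · rw [List.append_assoc]; exact hw.append _
        · rw [List.append_assoc]; exact hlift _ h1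
        · rw [List.append_assoc]; exact hlift _ h2
    · push Not at hcon
      refine extRule_of_balancedAt _ fun i j hij => hne _ _ _ _ hij (hw.append [i])
        (hw.append [j]) ?_ ?_
      · intro a
        obtain ⟨b, hb, hba⟩ := hcon a
        exact ⟨b, List.mem_append_left _ hb, hba⟩
      · intro a
        obtain ⟨b, hb, hba⟩ := hcon a
        exact ⟨b, List.mem_append_left _ hb, hba⟩
  intro v i j k hij h1 h2
  have e : ∀ a b : Fin 3, v ++ a :: List.replicate (k + 1) b =
      (v ++ a :: List.replicate k b) ++ [b] := fun a b => by
    rw [List.replicate_succ']; simp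
  refine BalancedAt.of_succ ?_ (hext _ h1) (hext _ h2)
  have hmix : ∀ a b : Fin 3, a ≠ b → ∀ c, ∃ d ∈ v ++ a :: List.replicate (k + 1) b, d ≠ c := by
    intro a b hab c
    by_cases hc : c = a
    · exact ⟨b, by simp, by rw [hc]; exact hab.symm⟩
    · exact ⟨a, by simp, Ne.symm hc⟩
  refine hne _ _ _ _ hij ?_ ?_ (hmix i j hij) (hmix j i hij.symm)
  · rw [e]; exact h1.append _
  · rw [e]; exact h2.append _

theorem isHarmonicIn_of_isBalanced {lam : ℝ} {u : Plane → ℝ}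
    (hu : IsBalanced lam u) : IsHarmonicIn (lowerDomain lam) u := by
  constructor
  · intro w hw
    refine finiteEnergy_of_isHarmonicOnCells (hu.isHarmonicOnCells ?_)
    exact (hw ⟨q 0, q_mem_SG 0, rfl⟩).2
  · rintro v ⟨-, -, K, hKΩ, hK, hv⟩
    -- Cells of high level that meet the support of the test function lie below the slice.
    obtain ⟨m, hm⟩ : ∃ m : ℝ, m < 1 - lam ∧ ∀ x ∈ K, x 1 ≤ m := by
      rcases K.eq_empty_or_nonempty with rfl | hne
      · exact ⟨-lam, by linarith, by simp⟩
      · obtain ⟨x, hx, hmax⟩ := hK.exists_isMaxOn hne (continuous_bary 0).continuousOn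
        exact ⟨x 1, (hKΩ hx).2, fun y hy => hmax hy⟩
    have ht := tendsto_pow_atTop_nhds_zero_of_lt_one (r := (1 / 2 : ℝ)) (by norm_num) (by norm_num)
    obtain ⟨N, hN⟩ := eventually_atTop.1 (ht.eventually (gt_mem_nhds (sub_pos.2 hm.1)))
    refine tendsto_const_nhds.congr' ?_
    filter_upwards [eventually_ge_atTop N] with n hn
    have hcell : ∀ (w : List (Fin 3)) (y : Plane), w.length = n → y ∈ SG → v (cellMap w y) ≠ 0 →
        Below lam w := by
      intro w y hw hy hvy
      have hyK : cellMap w y ∈ K := by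
        by_contra hyK
        exact hvy (hv _ ⟨cellMap_mem_SG w hy, hyK⟩)
      have h1 := hm.2 _ hyK
      rw [cellMap_height, hw] at h1
      have h2 := hN n hn
      have h3 : (1 / 2 : ℝ) ^ n * (1 - y 1) ≤ (1 / 2 : ℝ) ^ n * 1 :=
        mul_le_mul_of_nonneg_left (by linarith [height_nonneg hy]) (by positivity)
      rw [Below]
      linarith
    have hq : ∀ i, v (q i) = 0 := by
      intro i
      refine hv _ ⟨q_mem_SG i, fun hi => ?_⟩
      exact (hKΩ hi).1.2 ⟨i, rfl⟩
    rw [graphEnergy_eq_fluxSum, fluxSum_eq_of_balanced]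
    · simp [hq]
    · intro w i j k hij hk
      by_cases hz : v (cellMap w (F i (q j))) = 0
      · exact Or.inl hz
      · right
        refine hu w i j k hij ?_ ?_
        · refine hcell _ (q j) (by simp; omega) (q_mem_SG j) ?_
          rwa [cellMap_append, cellMap_cons, Function.comp_apply, Function.comp_apply,
            cellMap_replicate_q]
        · refine hcell _ (q i) (by simp; omega) (q_mem_SG i) ?_
          rwa [cellMap_append, cellMap_cons, Function.comp_apply, Function.comp_apply,
            cellMap_replicate_q, F_q_comm]

/-! ### The maximum principle -/

theorem IsBalanced.comp_F_zero {lam : ℝ} (h : lam ∈ Ico (0 : ℝ) 1) (h0 : digit lam 0 = 0)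
    {u : Plane → ℝ} (hu : IsBalanced lam u) : IsBalanced (shift lam) (u ∘ F 0) := by
  intro v i j k hij h1 h2
  rw [← balancedAt_cons]
  exact hu _ _ _ _ hij ((below_zero_cons h h0 _).2 h1) ((below_zero_cons h h0 _).2 h2)

theorem IsBalanced.comp_F_of_ne {lam : ℝ} (h : lam ∈ Ico (0 : ℝ) 1) (h0 : digit lam 0 = 1)
    {u : Plane → ℝ} (hu : IsBalanced lam u) {a : Fin 3} (ha : a ≠ 0) :
    IsBalanced (shift lam) (u ∘ F a) := by
  intro v i j k hij h1 h2
  rw [← balancedAt_cons]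
  exact hu _ _ _ _ hij ((below_cons_of_digit_one h h0 ha _).2 h1)
    ((below_cons_of_digit_one h h0 ha _).2 h2)

theorem IsBalanced.isHarmonicOnCells_F {lam : ℝ} (h : lam ∈ Ico (0 : ℝ) 1)
    (h0 : digit lam 0 = 0) {u : Plane → ℝ} (hu : IsBalanced lam u) {a : Fin 3} (ha : a ≠ 0) :
    IsHarmonicOnCells (u ∘ F a) :=
  hu.isHarmonicOnCells (w := [a]) (below_cons_of_digit_zero h h0 ha [])

/-- The flux balance at `F₀ qᵢ`, if the first digit is `0`. -/
theorem IsBalanced.upper {lam : ℝ} (h : lam ∈ Ico (0 : ℝ) 1) (h0 : digit lam 0 = 0)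
    {u : Plane → ℝ} (hu : IsBalanced lam u) {i : Fin 3} (hi : i ≠ 0) {K : ℕ}
    (hK : Below (shift lam) (List.replicate K i)) :
    (5 / 3) ^ K * outflow i ((u ∘ F 0) ∘ cellMap (List.replicate K i)) + outflow 0 (u ∘ F i) = 0 := by
  have h1 := hu [] 0 i K hi.symm ((below_zero_cons h h0 _).2 hK)
    (below_cons_of_digit_zero h h0 hi _)
  rw [balancedAt_nil, (hu.isHarmonicOnCells_F h h0 hi).outflow_replicate] at h1
  have : (5 / 3 : ℝ) ^ K * (3 / 5) ^ K = 1 := by rw [← mul_pow]; norm_num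
  linear_combination (5 / 3) ^ K * h1 - outflow 0 (u ∘ F i) * this

/-- The flux balance at `F₁ q₂`, if the first digit is `0`. -/
theorem IsBalanced.bottom {lam : ℝ} (h : lam ∈ Ico (0 : ℝ) 1) (h0 : digit lam 0 = 0)
    {u : Plane → ℝ} (hu : IsBalanced lam u) {i j : Fin 3} (hi : i ≠ 0) (hj : j ≠ 0)
    (hij : i ≠ j) :
    4 * u (F i (q j)) = u (F 0 (q i)) + u (F 0 (q j)) + u (q i) + u (q j) := by
  have h1 := hu [] i j 0 hij (below_cons_of_digit_zero h h0 hi _)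
    (below_cons_of_digit_zero h h0 hj _)
  rw [balancedAt_nil, outflow_of_ne hij.symm hj hi, outflow_of_ne hij hi hj] at h1
  simp only [List.replicate_zero, cellMap, Function.comp_apply, id, F_fixed, F_q_comm j i,
    F_q_comm i 0, F_q_comm j 0] at h1
  linarith

/-- The flux balance at `F₁ q₂`, if the first digit is `1`. -/
theorem IsBalanced.middle {lam : ℝ} (h : lam ∈ Ico (0 : ℝ) 1) (h0 : digit lam 0 = 1)
    {u : Plane → ℝ} (hu : IsBalanced lam u) {i j : Fin 3} (hi : i ≠ 0) (hj : j ≠ 0)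
    (hij : i ≠ j) {K : ℕ} (hK : Below (shift lam) (List.replicate K i))
    (hK' : Below (shift lam) (List.replicate K j)) :
    outflow j ((u ∘ F i) ∘ cellMap (List.replicate K j)) +
      outflow i ((u ∘ F j) ∘ cellMap (List.replicate K i)) = 0 :=
  (balancedAt_nil _ _ _ _).1 (hu [] i j K hij ((below_cons_of_digit_one h h0 hi _).2 hK')
    ((below_cons_of_digit_one h h0 hj _).2 hK))

theorem isBoundaryWord_cons {lam : ℝ} (h : lam ∈ Ico (0 : ℝ) 1) (i : Fin 3) (w : List (Fin 3)) :
    IsBoundaryWord lam (i :: w) ↔ (i = 0 ↔ digit lam 0 = 0) ∧ IsBoundaryWord (shift lam) w := by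
  constructor
  · intro hw
    refine ⟨hw 0 (by simp), fun k hk => ?_⟩
    rw [digit_shift h]
    exact hw (k + 1) (by simpa using hk)
  · rintro ⟨h1, h2⟩ k hk
    cases k with
    | zero => exact h1
    | succ k =>
      rw [← digit_shift h]
      exact h2 k (by simpa using hk)

/-- The values of `u` at the lower vertices of the cells of level `n` around the upper boundary
are at most `c`. -/
def LevelLe (n : ℕ) (lam : ℝ) (u : Plane → ℝ) (c : ℝ) : Prop :=
  ∀ w, w.length = n → IsBoundaryWord lam w → ∀ i, i ≠ 0 → u (cellMap w (q i)) ≤ c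

theorem LevelLe.comp {n : ℕ} {lam : ℝ} (h : lam ∈ Ico (0 : ℝ) 1) {u : Plane → ℝ} {c : ℝ}
    (hu : LevelLe (n + 1) lam u c) {a : Fin 3} (ha : a = 0 ↔ digit lam 0 = 0) :
    LevelLe n (shift lam) (u ∘ F a) c := fun w hw hb i hi =>
  hu (a :: w) (by simp [hw]) ((isBoundaryWord_cons h a w).2 ⟨ha, hb⟩) i hi

/-- A sign form of the maximum principle: if the value of `u` at `qᵢ` exceeds the value at the
other bottom corner and all values near the upper boundary, then there is a positive flux
at `qᵢ`. -/
theorem outflow_pos (n : ℕ) {lam : ℝ} (h : lam ∈ Ico (0 : ℝ) 1) {u : Plane → ℝ} {c : ℝ}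
    (hu : IsBalanced lam u) (hc : LevelLe n lam u c) {i j : Fin 3} (hi : i ≠ 0) (hj : j ≠ 0)
    (hij : i ≠ j) (hle : u (q j) ≤ u (q i)) (hlt : c < u (q i)) {K : ℕ}
    (hK : Below lam (List.replicate K i)) : 0 < outflow i (u ∘ cellMap (List.replicate K i)) := by
  induction n generalizing lam u i j K with
  | zero =>
    have := hc [] rfl (fun k hk => absurd hk (by simp)) i hi
    exact absurd hlt (not_lt.2 this)
  | succ n ih =>
    have hs := shift_mem h
    cases K with
    | zero => exact absurd hK (not_below_nil h)
    | succ K =>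
    have e : u ∘ cellMap (List.replicate (K + 1) i) =
        (u ∘ F i) ∘ cellMap (List.replicate K i) := rfl
    rw [e]
    obtain ⟨N, hN⟩ := exists_below_replicate hs hi
    obtain ⟨N', hN'⟩ := exists_below_replicate hs hj
    rcases digit_eq_zero_or_one lam 0 with h0 | h0
    · rw [(hu.isHarmonicOnCells_F h h0 hi).outflow_replicate]
      refine mul_pos (by positivity) ?_
      have hz := hu.bottom h h0 hi hj hij
      have hX : ∀ {a b : Fin 3} (ha : a ≠ 0) (hb : b ≠ 0) (hab : a ≠ b),
          u (F 0 (q b)) ≤ u (F 0 (q a)) → c < u (F 0 (q a)) →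
          2 * u (F 0 (q a)) < u (q a) + u (F a (q b)) := by
        intro a b ha hb hab h1 h2
        obtain ⟨N, hN⟩ := exists_below_replicate hs ha
        have h3 := ih hs (hu.comp_F_zero h h0) (hc.comp h (by simp [h0])) ha hb hab h1 h2
          (hN N le_rfl)
        have h4 := hu.upper h h0 ha (hN N le_rfl)
        have h5 : 0 < (5 / 3 : ℝ) ^ N * outflow a ((u ∘ F 0) ∘ cellMap (List.replicate N a)) :=
          mul_pos (by positivity) h3
        rw [outflow_of_ne ha.symm hb.symm hab] at h4
        simp only [Function.comp_apply, F_fixed, F_q_comm a 0] at h4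
        linarith
      rw [outflow_of_ne hi hij hj.symm]
      simp only [Function.comp_apply, F_fixed, F_q_comm i 0]
      have h1 := hX hi hj hij
      have h2 := hX hj hi hij.symm
      rw [F_q_comm j i] at h2
      by_contra hcon
      rcases le_total (u (F 0 (q j))) (u (F 0 (q i))) with h3 | h3
      · have h4 := h1 h3 (by linarith)
        linarith
      · have h4 := h2 h3 (by linarith)
        linarith
    · have hK' := (below_cons_of_digit_one h h0 hi _).1 hK
      have hci := hc.comp h (a := i) (by simp [h0, hi])
      have hcj := hc.comp h (a := j) (by simp [h0, hj])
      have hui := hu.comp_F_of_ne h h0 hi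
      have huj := hu.comp_F_of_ne h h0 hj
      rcases le_or_gt (u (F i (q j))) (u (q i)) with h1 | h1
      · exact ih hs hui hci hi hj hij (by simpa [F_fixed] using h1) (by simpa [F_fixed] using hlt)
          hK'
      · exfalso
        set L := max N N'
        have h2 := ih hs hui hci hj hi hij.symm (by simpa [F_fixed] using h1.le)
          (by simpa using hlt.trans h1) (hN' L (le_max_right _ _))
        have h3 := ih hs huj hcj hi hj hij
          (by simpa [F_fixed, F_q_comm j i] using hle.trans h1.le)
          (by simpa [F_q_comm j i] using hlt.trans h1) (hN L (le_max_left _ _))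
        have h4 := hu.middle h h0 hi hj hij (hN L (le_max_left _ _)) (hN' L (le_max_right _ _))
        linarith

theorem IsHarmonicOnCells.le {g : Plane → ℝ} (hg : IsHarmonicOnCells g) {c : ℝ}
    (hc : ∀ i, g (q i) ≤ c) (w : List (Fin 3)) (i : Fin 3) : g (cellMap w (q i)) ≤ c := by
  induction w generalizing g i with
  | nil => exact hc i
  | cons a w ih =>
    refine ih (hg.comp_F a) (fun j => ?_) i
    by_cases haj : a = j
    · rw [Function.comp_apply, haj, F_fixed]; exact hc j
    · have := hg [] a j haj
      simp only [cellMap, Function.comp_id] at this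
      have h0 := hc 0
      have h1 := hc 1
      have h2 := hc 2
      have h3 := hc a
      have h4 := hc j
      rw [Function.comp_apply]
      linarith

/-- The maximum principle on the part of the lower domain outside the cells of level `n` around
the upper boundary. -/
theorem IsBalanced.le_of_levelLe {lam : ℝ} (h : lam ∈ Ico (0 : ℝ) 1) {u : Plane → ℝ} {c : ℝ}
    (hu : IsBalanced lam u) {w : List (Fin 3)} {n : ℕ} (hn : w.length ≤ n)
    (hc : LevelLe n lam u c) (hq : ∀ i, i ≠ 0 → u (q i) ≤ c) (hw : Below lam w) (i : Fin 3) :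
    u (cellMap w (q i)) ≤ c := by
  induction w generalizing lam u n with
  | nil => exact absurd hw (not_below_nil h)
  | cons a w ih =>
    have hs := shift_mem h
    obtain ⟨n, rfl⟩ := Nat.exists_eq_add_of_le' (show 1 ≤ n by simp at hn; omega)
    have hn' : w.length ≤ n := by simpa using hn
    rcases digit_eq_zero_or_one lam 0 with h0 | h0
    · have hX : ∀ {a b : Fin 3} (ha : a ≠ 0) (hb : b ≠ 0) (hab : a ≠ b),
          u (F 0 (q b)) ≤ u (F 0 (q a)) → u (F 0 (q a)) ≤ c := by
        intro a b ha hb hab h1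
        by_contra hcon
        obtain ⟨N, hN⟩ := exists_below_replicate hs ha
        have h3 := outflow_pos n hs (hu.comp_F_zero h h0) (hc.comp h (by simp [h0])) ha hb hab h1
          (not_le.1 hcon) (hN N le_rfl)
        have h4 := hu.upper h h0 ha (hN N le_rfl)
        have h5 : 0 < (5 / 3 : ℝ) ^ N * outflow a ((u ∘ F 0) ∘ cellMap (List.replicate N a)) :=
          mul_pos (by positivity) h3
        rw [outflow_of_ne ha.symm hb.symm hab] at h4
        simp only [Function.comp_apply, F_fixed, F_q_comm a 0] at h4
        have h6 := hu.bottom h h0 ha hb hab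
        linarith [hq a ha, hq b hb]
      have hX' : ∀ a, a ≠ 0 → u (F 0 (q a)) ≤ c := by
        intro a ha
        obtain ⟨b, hb, hab⟩ : ∃ b : Fin 3, b ≠ 0 ∧ a ≠ b := by fin_cases a <;> decide
        rcases le_total (u (F 0 (q b))) (u (F 0 (q a))) with h1 | h1
        · exact hX ha hb hab h1
        · exact h1.trans (hX hb ha hab.symm h1)
      by_cases ha : a = 0
      · subst ha
        exact ih hs (hu.comp_F_zero h h0) hn' (hc.comp h (by simp [h0])) hX'
          ((below_zero_cons h h0 w).1 hw)
      · refine (hu.isHarmonicOnCells_F h h0 ha).le (fun j => ?_) w i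
        rw [Function.comp_apply]
        by_cases hj : j = 0
        · rw [hj, F_q_comm]; exact hX' a ha
        · by_cases haj : a = j
          · rw [← haj, F_fixed]; exact hq a ha
          · linarith [hu.bottom h h0 ha hj haj, hX' a ha, hX' j hj, hq a ha, hq j hj]
    · have ha : a ≠ 0 := by
        rintro rfl
        exact not_below_zero_cons h h0 w hw
      refine ih hs (hu.comp_F_of_ne h h0 ha) hn' (hc.comp h (by simp [h0, ha])) ?_
        ((below_cons_of_digit_one h h0 ha w).1 hw)
      intro b hb
      rw [Function.comp_apply]
      by_cases hab : a = b
      · rw [hab, F_fixed]; exact hq b hb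
      · by_contra hcon
        rw [not_le] at hcon
        obtain ⟨N, hN⟩ := exists_below_replicate hs ha
        obtain ⟨N', hN'⟩ := exists_below_replicate hs hb
        have h2 := outflow_pos n hs (hu.comp_F_of_ne h h0 ha) (hc.comp h (by simp [h0, ha])) hb ha
          (Ne.symm hab) (by simpa [F_fixed] using ((hq a ha).trans_lt hcon).le)
          (by simpa using hcon) (hN' _ (le_max_right N N'))
        have h3 := outflow_pos n hs (hu.comp_F_of_ne h h0 hb) (hc.comp h (by simp [h0, hb])) ha hb
          hab (by simpa [F_fixed, F_q_comm b a] using ((hq b hb).trans_lt hcon).le)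
          (by simpa [F_q_comm b a] using hcon) (hN _ (le_max_left N N'))
        have h4 := hu.middle h h0 ha hb hab (hN _ (le_max_left N N')) (hN' _ (le_max_right N N'))
        linarith

/-- Each cell of a boundary word contains a point of the upper boundary that is not on the bottom
line of the cell. -/
theorem exists_mem_upperBoundary_of_word {lam : ℝ} (h : lam ∈ Ico (0 : ℝ) 1) {w : List (Fin 3)}
    (hw : IsBoundaryWord lam w) : ∃ z ∈ SG, 0 < z 1 ∧ cellMap w z ∈ upperBoundary lam := by
  induction w generalizing lam with
  | nil =>
    obtain ⟨z, hz⟩ := upperBoundary_nonempty h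
    exact ⟨z, upperBoundary_subset_SG _ hz, by
      rw [height_of_mem_upperBoundary hz]; linarith [h.2], hz⟩
  | cons i w ih =>
    obtain ⟨h1, h2⟩ := (isBoundaryWord_cons h i w).1 hw
    obtain ⟨z, hz, hz', hzw⟩ := ih (shift_mem h) h2
    exact ⟨z, hz, hz', F_mem_upperBoundary h h1 hzw⟩

/-- The maximum principle on lower domains. -/
theorem IsBalanced.le_of_boundary {lam : ℝ} (h : lam ∈ Ico (0 : ℝ) 1) {u : Plane → ℝ} {c : ℝ}
    (hu : IsBalanced lam u) (hcont : ContinuousOn u (closedLowerDomain lam))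
    (hb : ∀ x ∈ lowerBoundary lam, u x ≤ c) : ∀ x ∈ closedLowerDomain lam, u x ≤ c := by
  have hbelow : ∀ w, Below lam w → ∀ i, u (cellMap w (q i)) ≤ c := by
    intro w hw i
    refine le_of_forall_pos_le_add fun ε hε => ?_
    obtain ⟨O, hO, hOe⟩ := continuousOn_iff'.1 hcont (Iio (c + ε)) isOpen_Iio
    have hXO : upperBoundary lam ⊆ O := by
      intro x hx
      have : x ∈ u ⁻¹' Iio (c + ε) ∩ closedLowerDomain lam :=
        ⟨(hb x (Or.inl hx)).trans_lt (by linarith), Or.inr (Or.inl hx)⟩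
      rw [hOe] at this
      exact this.1
    obtain ⟨δ, hδ, hδO⟩ := (isCompact_upperBoundary lam).exists_thickening_subset_open hO hXO
    obtain ⟨C, hC⟩ := Metric.isBounded_iff.1 isCompact_SG.isBounded
    have ht : Tendsto (fun n : ℕ => (1 / 2 : ℝ) ^ n * C) atTop (𝓝 0) := by
      simpa using (tendsto_pow_atTop_nhds_zero_of_lt_one (r := (1 / 2 : ℝ))
        (by norm_num) (by norm_num)).mul_const C
    obtain ⟨N, hN⟩ := eventually_atTop.1 (ht.eventually (gt_mem_nhds hδ))
    refine hu.le_of_levelLe h (n := max N w.length) (le_max_right _ _) ?_ ?_ hw i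
    · intro v hv hvb j hj
      obtain ⟨z, hz, hz0, hzX⟩ := exists_mem_upperBoundary_of_word h hvb
      have h1 : cellMap v (q j) ∈ O := by
        refine hδO (Metric.mem_thickening_iff.2 ⟨_, hzX, ?_⟩)
        rw [dist_cellMap, hv]
        refine lt_of_le_of_lt ?_ (hN (max N w.length) (le_max_left _ _))
        exact mul_le_mul_of_nonneg_left (hC (q_mem_SG j) hz) (by positivity)
      have h2 : cellMap v (q j) 1 < 1 - lam := by
        have h3 := height_of_mem_upperBoundary hzX
        rw [cellMap_height] at h3 ⊢
        rw [q_height_of_ne hj]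
        have : (1 / 2 : ℝ) ^ v.length * (1 - z 1) < (1 / 2 : ℝ) ^ v.length * (1 - 0) :=
          mul_lt_mul_of_pos_left (by linarith) (by positivity)
        linarith
      have h3 : cellMap v (q j) ∈ closedLowerDomain lam := by
        by_cases hV : cellMap v (q j) ∈ V 0
        · obtain ⟨a, ha⟩ := hV
          rw [← ha] at h2 ⊢
          refine Or.inr (Or.inr ?_)
          fin_cases a
          · simp only [Fin.zero_eta, q_zero_height] at h2
            linarith [h.1]
          · exact Or.inl rfl
          · exact Or.inr rfl
        · exact Or.inl ⟨⟨cellMap_mem_SG v (q_mem_SG j), hV⟩, h2⟩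
      have h4 : cellMap v (q j) ∈ u ⁻¹' Iio (c + ε) ∩ closedLowerDomain lam := by
        rw [hOe]; exact ⟨h1, h3⟩
      exact le_of_lt h4.1
    · intro j hj
      refine (hb _ (Or.inr ?_)).trans (by linarith)
      fin_cases j
      · exact absurd rfl hj
      · exact Or.inl rfl
      · exact Or.inr rfl
  intro x hx
  rcases hx with hx | hx
  · have hxc : x ∈ closedLowerDomain lam := Or.inl hx
    obtain ⟨⟨hxSG, -⟩, hxh⟩ := hx
    choose w hwl y hy hwy using exists_cellMap_eq hxSG
    have ht := tendsto_pow_atTop_nhds_zero_of_lt_one (r := (1 / 2 : ℝ)) (by norm_num) (by norm_num)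
    have hev : ∀ᶠ n in atTop, Below lam (w n) := by
      filter_upwards [ht.eventually (gt_mem_nhds (sub_pos.2 hxh))] with n hn
      have h1 := cellMap_height (w n) (y n)
      rw [hwy, hwl] at h1
      have h2 : (1 / 2 : ℝ) ^ n * (1 - y n 1) ≤ (1 / 2 : ℝ) ^ n * 1 :=
        mul_le_mul_of_nonneg_left (by linarith [height_nonneg (hy n)]) (by positivity)
      rw [Below]
      linarith
    have hlim : Tendsto (fun n => cellMap (w n) (q 0)) atTop (𝓝[closedLowerDomain lam] x) := by
      refine tendsto_nhdsWithin_iff.2 ⟨?_, hev.mono fun n hn =>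
        cell_subset_closedLowerDomain h hn ⟨_, q_mem_SG 0, rfl⟩⟩
      obtain ⟨C, hC⟩ := Metric.isBounded_iff.1 isCompact_SG.isBounded
      rw [tendsto_iff_dist_tendsto_zero]
      have ht' : Tendsto (fun n : ℕ => (1 / 2 : ℝ) ^ n * C) atTop (𝓝 0) := by
        simpa using ht.mul_const C
      refine squeeze_zero (fun _ => dist_nonneg) (fun n => ?_) ht'
      nth_rewrite 1 [← hwy n]
      rw [dist_cellMap, hwl]
      exact mul_le_mul_of_nonneg_left (hC (q_mem_SG 0) (hy n)) (by positivity)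
    exact le_of_tendsto ((hcont x hxc).tendsto.comp hlim) (hev.mono fun n hn => hbelow _ hn 0)
  · exact hb x hx

/-- Solutions of the Dirichlet problem are unique. -/
theorem IsDirichletSolution.eqOn {lam : ℝ} (h : lam ∈ Ico (0 : ℝ) 1) {f u v : Plane → ℝ}
    (hu : IsDirichletSolution lam f u) (hv : IsDirichletSolution lam f v) :
    EqOn v u (closedLowerDomain lam) := by
  have key : ∀ {u v : Plane → ℝ}, IsDirichletSolution lam f u → IsDirichletSolution lam f v →
      ∀ x ∈ closedLowerDomain lam, v x - u x ≤ 0 := by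
    rintro u v ⟨hu1, hu2, hu3⟩ ⟨hv1, hv2, hv3⟩
    refine ((isBalanced_of_isHarmonicIn h hv1 hv2).sub
      (isBalanced_of_isHarmonicIn h hu1 hu2)).le_of_boundary h (hv1.sub hu1) fun x hx => ?_
    rw [hu3 x hx, hv3 x hx, sub_self]
  intro x hx
  linarith [key hu hv x hx, key hv hu x hx]

/-! ### The solution of the Dirichlet problem -/

theorem outflow_congr {g h : Plane → ℝ} (hgh : EqOn g h SG) (i : Fin 3) (w : List (Fin 3)) :
    outflow i (g ∘ cellMap w) = outflow i (h ∘ cellMap w) := by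
  unfold outflow
  simp only [Function.comp_apply, hgh (cellMap_mem_SG _ (q_mem_SG _))]

theorem balancedAt_comm {u : Plane → ℝ} {v : List (Fin 3)} {i j : Fin 3} {k : ℕ} :
    BalancedAt u v i j k ↔ BalancedAt u v j i k := by
  unfold BalancedAt
  rw [add_comm]

/-- The normal derivative at a bottom corner with value `x` of the solution with value `x'` at the
other bottom corner and harmonic mean `m` of the data on the upper boundary. -/
noncomputable def response (lam x x' m : ℝ) : ℝ :=
  ((symResponse lam + antiResponse lam) * x - (antiResponse lam - symResponse lam) * x') / 2 -
    symResponse lam * m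

theorem response_upper {lam : ℝ} (h : lam ∈ Ico (0 : ℝ) 1) (h0 : digit lam 0 = 0) (x x' m m' : ℝ) :
    5 / 3 * (2 * x - upperValue (symResponse (shift lam)) (antiResponse (shift lam)) x x' m m' -
      (upperValue (symResponse (shift lam)) (antiResponse (shift lam)) x x' m m' +
        upperValue (symResponse (shift lam)) (antiResponse (shift lam)) x' x m' m + x + x') / 4) =
    response lam x x' ((m + m') / 2 + (2 * symResponse (shift lam) + 3) /
      (3 * (antiResponse (shift lam) + 2)) * (m - m') / 2) := by
  have hs := shift_mem h
  have h1 := one_le_symResponse hs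
  have h2 := three_le_antiResponse hs
  obtain ⟨e1, e2⟩ := response_of_digit_zero h h0
  rw [response, e1, e2]
  generalize symResponse (shift lam) = p at *
  generalize antiResponse (shift lam) = r at *
  have h3 : 2 * p + 3 ≠ 0 := by linarith
  have h4 : r + 2 ≠ 0 := by linarith
  unfold upperValue
  field_simp
  ring

theorem response_junction {lam : ℝ} (h : lam ∈ Ico (0 : ℝ) 1) (x x' m m' : ℝ) :
    response lam (upperValue (symResponse lam) (antiResponse lam) x x' m m')
        (upperValue (symResponse lam) (antiResponse lam) x' x m' m) m +
      (2 * upperValue (symResponse lam) (antiResponse lam) x x' m m' - x -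
      (upperValue (symResponse lam) (antiResponse lam) x x' m m' +
        upperValue (symResponse lam) (antiResponse lam) x' x m' m + x + x') / 4) = 0 := by
  have h1 := one_le_symResponse h
  have h2 := three_le_antiResponse h
  rw [response]
  generalize symResponse lam = p at *
  generalize antiResponse lam = r at *
  have h3 : 2 * p + 3 ≠ 0 := by linarith
  have h4 : r + 2 ≠ 0 := by linarith
  unfold upperValue
  field_simp
  ring

theorem response_middle {lam : ℝ} (h : lam ∈ Ico (0 : ℝ) 1) (h0 : digit lam 0 = 1)
    (x x' m n l : ℝ) :
    5 / 3 * response (shift lam) x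
      (middleValue (symResponse (shift lam)) (antiResponse (shift lam)) x x' n l) m =
    response lam x x' ((2 * (symResponse (shift lam) + antiResponse (shift lam)) * m +
      (antiResponse (shift lam) - symResponse (shift lam)) * (n + l)) /
        (4 * antiResponse (shift lam))) := by
  have hs := shift_mem h
  have h1 := one_le_symResponse hs
  have h2 := three_le_antiResponse hs
  obtain ⟨e1, e2⟩ := response_of_digit_one h h0
  rw [response, response, e1, e2]
  generalize symResponse (shift lam) = p at *
  generalize antiResponse (shift lam) = r at *
  have h3 : p + r ≠ 0 := by linarith
  have h4 : r ≠ 0 := by linarith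
  unfold middleValue
  field_simp
  ring

theorem response_middle_junction {lam : ℝ} (h : lam ∈ Ico (0 : ℝ) 1) (x x' m m' : ℝ) :
    response lam (middleValue (symResponse lam) (antiResponse lam) x x' m m') x m +
      response lam (middleValue (symResponse lam) (antiResponse lam) x x' m m') x' m' = 0 := by
  have h1 := one_le_symResponse h
  have h2 := three_le_antiResponse h
  rw [response, response]
  generalize symResponse lam = p at *
  generalize antiResponse lam = r at *
  have h3 : p + r ≠ 0 := by linarith
  unfold middleValue
  field_simp
  ring

theorem middleValue_comm (p r x x' m m' : ℝ) :
    middleValue p r x x' m m' = middleValue p r x' x m' m := by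
  unfold middleValue
  rw [add_comm x, add_comm m]

namespace State

variable {lam : ℝ} {f : Plane → ℝ} {τ x x' : ℝ}

theorem outflow_harm (c : Fin 3 → ℝ) (i : Fin 3) (K : ℕ) :
    outflow i (system.toFun (harm c) ∘ cellMap (List.replicate K i)) =
      (3 / 5) ^ K * (3 * c i - (c 0 + c 1 + c 2)) := by
  rw [(isHarmonicOnCells_harm c).outflow_replicate, outflow_eq]
  simp only [CellSystem.toFun_q (tame_harm c)]
  rfl

theorem toFun_child (ht : system.Tame (lower lam f τ x x')) (i : Fin 3) :
    EqOn (system.toFun (lower lam f τ x x') ∘ F i)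
      (system.toFun ((lower lam f τ x x').child i)) SG :=
  fun _ hy => CellSystem.toFun_F ht i hy

/-- The flux of the solution through the two bottom corners. -/
theorem outflow_lower (h : lam ∈ Ico (0 : ℝ) 1) (hf : ContinuousOn f (upperBoundary lam))
    (ht : system.Tame (lower lam f τ x x')) (K : ℕ) :
    (Below lam (List.replicate K 1) →
      (5 / 3) ^ K * outflow 1 (system.toFun (lower lam f τ x x') ∘ cellMap (List.replicate K 1)) =
        response lam x x' (mean₁ lam f)) ∧
    (Below lam (List.replicate K 2) →
      (5 / 3) ^ K * outflow 2 (system.toFun (lower lam f τ x x') ∘ cellMap (List.replicate K 2)) =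
        response lam x' x (mean₂ lam f)) := by
  induction K generalizing lam f τ x x' with
  | zero => exact ⟨fun hK => absurd hK (not_below_nil h), fun hK => absurd hK (not_below_nil h)⟩
  | succ K ih =>
    have hs := shift_mem h
    have e : ∀ i, system.toFun (lower lam f τ x x') ∘ cellMap (List.replicate (K + 1) i) =
        (system.toFun (lower lam f τ x x') ∘ F i) ∘ cellMap (List.replicate K i) := fun _ => rfl
    have hpow : (5 / 3 : ℝ) ^ K * (3 / 5) ^ K = 1 := by rw [← mul_pow]; norm_num
    rcases digit_eq_zero_or_one lam 0 with h0 | h0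
    · have hm := mean_of_digit_zero h h0 hf
      rw [meanStepZero, Prod.mk.injEq] at hm
      constructor <;> intro hK <;> rw [e, outflow_congr (toFun_child ht _)] <;>
        simp only [child, if_pos h0] <;> simp <;> rw [outflow_harm] <;> simp
      · rw [hm.1, ← response_upper h h0]
        change _ = 5 / 3 * (2 * x - (upperValues lam f x x').1 -
          ((upperValues lam f x x').1 + (upperValues lam f x x').2 + x + x') / 4)
        simp only [bottomValue, if_pos h0]
        rw [pow_succ]
        linear_combination 5 / 3 * (2 * x - (upperValues lam f x x').1 -
          ((upperValues lam f x x').1 + (upperValues lam f x x').2 + x + x') / 4) * hpow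
      · have hm2 : mean₂ lam f = (mean₂ (shift lam) (f ∘ F 0) + mean₁ (shift lam) (f ∘ F 0)) / 2 +
            (2 * symResponse (shift lam) + 3) / (3 * (antiResponse (shift lam) + 2)) *
              (mean₂ (shift lam) (f ∘ F 0) - mean₁ (shift lam) (f ∘ F 0)) / 2 := by
          rw [hm.2]; ring
        rw [hm2, ← response_upper h h0]
        change _ = 5 / 3 * (2 * x' - (upperValues lam f x x').2 -
          ((upperValues lam f x x').2 + (upperValues lam f x x').1 + x' + x) / 4)
        simp only [bottomValue, if_pos h0]
        rw [pow_succ]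
        linear_combination 5 / 3 * (2 * x' - (upperValues lam f x x').2 -
          ((upperValues lam f x x').1 + (upperValues lam f x x').2 + x + x') / 4) * hpow
    · have hm := mean_of_digit_one h h0 hf
      rw [meanStepOne, Prod.mk.injEq] at hm
      have h0' : digit lam 0 ≠ 0 := by simp [h0]
      constructor <;> intro hK
      · have hc : (lower lam f τ x x').child 1 = lower (shift lam) (f ∘ F 1)
            (f (F 1 ((1 - shift lam) • q 0))) x (bottomValue lam f x x') := by
          simp [child, h0']
        have htc := ht.child 1
        rw [system_child, hc] at htc
        have h1 := (ih hs (continuousOn_comp_F h hf (by simp [h0])) htc).1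
          ((below_cons_of_digit_one h h0 (by decide) _).1 hK)
        rw [e, outflow_congr (toFun_child ht _), hc, pow_succ, mul_assoc, mul_left_comm, h1, hm.1,
          ← response_middle h h0 _ x', bottomValue, if_neg h0']
      · have hc : (lower lam f τ x x').child 2 = lower (shift lam) (f ∘ F 2)
            (f (F 2 ((1 - shift lam) • q 0))) (bottomValue lam f x x') x' := by
          simp [child, h0']
        have htc := ht.child 2
        rw [system_child, hc] at htc
        have h1 := (ih hs (continuousOn_comp_F h hf (by simp [h0])) htc).2
          ((below_cons_of_digit_one h h0 (by decide) _).1 hK)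
        rw [e, outflow_congr (toFun_child ht _), hc, pow_succ, mul_assoc, mul_left_comm, h1, hm.2,
          add_comm (mean₂ _ _), ← response_middle h h0 _ x, bottomValue, if_neg h0',
          middleValue_comm]

theorem isBalanced_lower (h : lam ∈ Ico (0 : ℝ) 1) (hf : ContinuousOn f (upperBoundary lam))
    (ht : system.Tame (lower lam f τ x x')) :
    IsBalanced lam (system.toFun (lower lam f τ x x')) := by
  intro v
  induction v generalizing lam f τ x x' with
  | nil =>
    have hs := shift_mem h
    have hpow : ∀ k : ℕ, (5 / 3 : ℝ) ^ k * (3 / 5) ^ k = 1 := fun k => by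
      rw [← mul_pow]; norm_num
    -- By symmetry it is enough to treat three of the six pairs of cells.
    have main : ∀ k, ∀ p ∈ [((0 : Fin 3), (1 : Fin 3)), (0, 2), (1, 2)],
        Below lam (p.1 :: List.replicate k p.2) → Below lam (p.2 :: List.replicate k p.1) →
        BalancedAt (system.toFun (lower lam f τ x x')) [] p.1 p.2 k := by
      intro k p hp h1 h2
      rw [balancedAt_nil, outflow_congr (toFun_child ht _), outflow_congr (toFun_child ht _)]
      rcases digit_eq_zero_or_one lam 0 with h0 | h0
      · have hc0 : (lower lam f τ x x').child 0 = lower (shift lam) (f ∘ F 0) τ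
            (upperValues lam f x x').1 (upperValues lam f x x').2 := by
          simp [child, h0]
        have htc := ht.child 0
        rw [system_child, hc0] at htc
        obtain ⟨o1, o2⟩ := outflow_lower hs (continuousOn_comp_F h hf (by simp [h0])) htc k
        simp only [List.mem_cons, List.not_mem_nil, or_false] at hp
        rcases hp with rfl | rfl | rfl
        · have o1' := o1 ((below_zero_cons h h0 _).1 h1)
          have j1 : response (shift lam) (upperValues lam f x x').1 (upperValues lam f x x').2
              (mean₁ (shift lam) (f ∘ F 0)) + (2 * (upperValues lam f x x').1 - x -
              ((upperValues lam f x x').1 + (upperValues lam f x x').2 + x + x') / 4) = 0 :=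
            response_junction hs x x' (mean₁ (shift lam) (f ∘ F 0)) (mean₂ (shift lam) (f ∘ F 0))
          simp only [hc0]
          simp only [child, if_pos h0, bottomValue]
          simp only [Matrix.cons_val, outflow_harm]
          linear_combination (3 / 5 : ℝ) ^ k * (o1' + j1) -
            outflow 1 (system.toFun (lower (shift lam) (f ∘ F 0) τ (upperValues lam f x x').1
              (upperValues lam f x x').2) ∘ cellMap (List.replicate k 1)) * hpow k
        · have o2' := o2 ((below_zero_cons h h0 _).1 h1)
          have j1 : response (shift lam) (upperValues lam f x x').2 (upperValues lam f x x').1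
              (mean₂ (shift lam) (f ∘ F 0)) + (2 * (upperValues lam f x x').2 - x' -
              ((upperValues lam f x x').2 + (upperValues lam f x x').1 + x' + x) / 4) = 0 :=
            response_junction hs x' x (mean₂ (shift lam) (f ∘ F 0)) (mean₁ (shift lam) (f ∘ F 0))
          simp only [hc0]
          simp only [child, if_pos h0, bottomValue]
          simp only [Matrix.cons_val, outflow_harm]
          linear_combination (3 / 5 : ℝ) ^ k * (o2' + j1) -
            outflow 2 (system.toFun (lower (shift lam) (f ∘ F 0) τ (upperValues lam f x x').1
              (upperValues lam f x x').2) ∘ cellMap (List.replicate k 2)) * hpow k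
        · simp only [child, if_pos h0, bottomValue]
          simp only [Matrix.cons_val, outflow_harm]
          ring
      · have h0' : digit lam 0 ≠ 0 := by simp [h0]
        simp only [List.mem_cons, List.not_mem_nil, or_false] at hp
        rcases hp with rfl | rfl | rfl
        · exact absurd h1 (not_below_zero_cons h h0 _)
        · exact absurd h1 (not_below_zero_cons h h0 _)
        · have hc1 : (lower lam f τ x x').child 1 = lower (shift lam) (f ∘ F 1)
              (f (F 1 ((1 - shift lam) • q 0))) x (bottomValue lam f x x') := by
            simp [child, h0']
          have hc2 : (lower lam f τ x x').child 2 = lower (shift lam) (f ∘ F 2)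
              (f (F 2 ((1 - shift lam) • q 0))) (bottomValue lam f x x') x' := by
            simp [child, h0']
          have ht1 := ht.child 1
          have ht2 := ht.child 2
          rw [system_child, hc1] at ht1
          rw [system_child, hc2] at ht2
          have o1 := (outflow_lower hs (continuousOn_comp_F h hf (by simp [h0])) ht1 k).2
            ((below_cons_of_digit_one h h0 (by decide) _).1 h1)
          have o2 := (outflow_lower hs (continuousOn_comp_F h hf (by simp [h0])) ht2 k).1
            ((below_cons_of_digit_one h h0 (by decide) _).1 h2)
          have j1 := response_middle_junction hs x x' (mean₂ (shift lam) (f ∘ F 1))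
            (mean₁ (shift lam) (f ∘ F 2))
          have hbv : bottomValue lam f x x' = middleValue (symResponse (shift lam))
              (antiResponse (shift lam)) x x' (mean₂ (shift lam) (f ∘ F 1))
              (mean₁ (shift lam) (f ∘ F 2)) := by rw [bottomValue, if_neg h0']
          rw [← hbv, ← o1, ← o2, ← mul_add] at j1
          simp only [hc1, hc2]
          exact (mul_eq_zero.1 j1).resolve_left (by positivity)
    intro i j k hij h1 h2
    simp only [List.nil_append] at h1 h2
    have hcase : (i, j) ∈ [((0 : Fin 3), (1 : Fin 3)), (0, 2), (1, 2)] ∨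
        (j, i) ∈ [((0 : Fin 3), (1 : Fin 3)), (0, 2), (1, 2)] := by
      clear h1 h2
      revert i j
      decide
    rcases hcase with hp | hp
    · exact main k (i, j) hp h1 h2
    · exact balancedAt_comm.1 (main k (j, i) hp h2 h1)
  | cons a v ih =>
    intro i j k hij h1 h2
    have hs := shift_mem h
    rw [balancedAt_cons, BalancedAt.congr (toFun_child ht a)]
    have htc := ht.child a
    rw [system_child] at htc
    rcases digit_eq_zero_or_one lam 0 with h0 | h0
    · by_cases ha : a = 0
      · subst ha
        have hc0 : (lower lam f τ x x').child 0 = lower (shift lam) (f ∘ F 0) τ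
            (upperValues lam f x x').1 (upperValues lam f x x').2 := by
          simp [child, h0]
        rw [hc0] at htc ⊢
        exact ih hs (continuousOn_comp_F h hf (by simp [h0])) htc i j k hij
          ((below_zero_cons h h0 _).1 h1) ((below_zero_cons h h0 _).1 h2)
      · have hc : ∃ c, (lower lam f τ x x').child a = harm c := by
          rw [child, if_pos h0]
          fin_cases a
          · exact absurd rfl ha
          · exact ⟨_, rfl⟩
          · exact ⟨_, rfl⟩
        obtain ⟨c, hc⟩ := hc
        rw [hc]
        exact (isHarmonicOnCells_harm c).balancedAt v hij k
    · by_cases ha : a = 0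
      · subst ha
        exact absurd h1 (not_below_zero_cons h h0 _)
      · have hc : ∃ τ' y y', (lower lam f τ x x').child a =
            lower (shift lam) (f ∘ F a) τ' y y' := by
          rw [child, if_neg (by simp [h0])]
          fin_cases a
          · exact absurd rfl ha
          · exact ⟨_, _, _, rfl⟩
          · exact ⟨_, _, _, rfl⟩
        obtain ⟨τ', y, y', hc⟩ := hc
        rw [hc] at htc ⊢
        exact ih hs (continuousOn_comp_F h hf (by simp [h0, ha])) htc i j k hij
          ((below_cons_of_digit_one h h0 ha _).1 h1) ((below_cons_of_digit_one h h0 ha _).1 h2)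

end State

/-- The state of the solution of the Dirichlet problem on the lower domain of `lam`. -/
noncomputable def solutionState (lam : ℝ) (f : Plane → ℝ) : State :=
  State.lower lam f (f ((1 - lam) • q 0)) (f (q 1)) (f (q 2))

/-- The solution of the Dirichlet problem on the lower domain of `lam` with boundary data `f`. -/
noncomputable def solution (lam : ℝ) (f : Plane → ℝ) : Plane → ℝ :=
  State.system.toFun (solutionState lam f)

theorem tame_solutionState {lam : ℝ} (h : lam ∈ Ico (0 : ℝ) 1) {f : Plane → ℝ}
    (hf : ContinuousOn f (upperBoundary lam)) : State.system.Tame (solutionState lam f) :=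
  State.tame_lower h hf ⟨_, smul_q_zero_mem_upperBoundary h, rfl⟩ _ _

theorem closedLowerDomain_subset_SG (lam : ℝ) : closedLowerDomain lam ⊆ SG := by
  rintro x (hx | hx | rfl | rfl)
  · exact hx.1.1
  · exact upperBoundary_subset_SG _ hx
  · exact q_mem_SG 1
  · exact q_mem_SG 2

theorem isDirichletSolution_solution {lam : ℝ} (h : lam ∈ Ico (0 : ℝ) 1) {f : Plane → ℝ}
    (hf : ContinuousOn f (upperBoundary lam)) : IsDirichletSolution lam f (solution lam f) := by
  have ht := tame_solutionState h hf
  refine ⟨(CellSystem.continuousOn_toFun ht).mono (closedLowerDomain_subset_SG lam),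
    isHarmonicIn_of_isBalanced (State.isBalanced_lower h hf ht), ?_⟩
  rintro x (hx | rfl | rfl)
  · exact State.toFun_lower_of_mem h hf ⟨_, smul_q_zero_mem_upperBoundary h, rfl⟩ _ _ hx
  · exact CellSystem.toFun_q ht 1
  · exact CellSystem.toFun_q ht 2

theorem iterate_F (i : Fin 3) (m : ℕ) (x : Plane) :
    (F i)^[m] x = cellMap (List.replicate m i) x := by
  induction m generalizing x with
  | zero => rfl
  | succ m ih =>
    rw [Function.iterate_succ_apply', ih]
    rfl

theorem hasNormalDeriv_of_outflow {lam : ℝ} (h : lam ∈ Ico (0 : ℝ) 1) {u v : Plane → ℝ}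
    (huv : EqOn u v (closedLowerDomain lam)) {i : Fin 3} (hi : i ≠ 0) {d : ℝ}
    (hd : ∀ K, Below lam (List.replicate K i) →
      (5 / 3) ^ K * outflow i (v ∘ cellMap (List.replicate K i)) = d) : HasNormalDeriv u i d := by
  obtain ⟨N, hN⟩ := exists_below_replicate h hi
  refine tendsto_const_nhds.congr' ?_
  filter_upwards [eventually_ge_atTop N] with K hK
  have hmem : ∀ j, cellMap (List.replicate K i) (q j) ∈ closedLowerDomain lam := fun j =>
    cell_subset_closedLowerDomain h (hN K hK) ⟨q j, q_mem_SG j, rfl⟩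
  have hqi := hmem i
  rw [cellMap_replicate_q] at hqi
  rw [← hd K (hN K hK), outflow, iterate_F, iterate_F, huv (hmem _), huv (hmem _), huv hqi]
  simp only [Function.comp_apply, cellMap_replicate_q]

theorem continuousOn_data₁ {lam : ℝ} (h : lam ∈ Ico (0 : ℝ) 1) :
    ContinuousOn data₁ (upperBoundary lam) := by
  refine (continuousOn_const (c := (0 : ℝ))).congr fun x hx => ?_
  refine indicator_of_notMem ?_ _
  rintro rfl
  exact q_notMem_upperBoundary h (by decide) hx

theorem isDirichletSolution_h₁ {lam : ℝ} (h : lam ∈ Ico (0 : ℝ) 1) :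
    IsDirichletSolution lam data₁ (h₁ lam) :=
  Classical.epsilon_spec ⟨_, isDirichletSolution_solution h (continuousOn_data₁ h)⟩

theorem hasNormalDeriv_h₁ {lam : ℝ} (h : lam ∈ Ico (0 : ℝ) 1) :
    HasNormalDeriv (h₁ lam) 1 ((symResponse lam + antiResponse lam) / 2) ∧
      HasNormalDeriv (h₁ lam) 2 (-((antiResponse lam - symResponse lam) / 2)) := by
  have hf := continuousOn_data₁ h
  have hsol := isDirichletSolution_solution h hf
  have heq := hsol.eqOn h (isDirichletSolution_h₁ h)
  have ht := tame_solutionState h hf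
  have h1 : data₁ (q 1) = 1 := indicator_of_mem (mem_singleton _) _
  have h2 : data₁ (q 2) = 0 := by
    refine indicator_of_notMem (fun hq => ?_) _
    exact absurd (q_injective (mem_singleton_iff.1 hq)) (by decide)
  obtain ⟨⟨m1, m2⟩, m3, m4⟩ := mean_mem_Icc h hf (L := 0) (U := 0) fun x hx => by
    have : data₁ x = 0 := by
      refine indicator_of_notMem ?_ _
      rintro rfl
      exact q_notMem_upperBoundary h (by decide) hx
    rw [this]; simp
  constructor
  · refine hasNormalDeriv_of_outflow h heq (by decide) fun K hK => ?_
    rw [solution, solutionState, (State.outflow_lower h hf ht K).1 hK, response, h1, h2,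
      le_antisymm m2 m1]
    ring
  · refine hasNormalDeriv_of_outflow h heq (by decide) fun K hK => ?_
    rw [solution, solutionState, (State.outflow_lower h hf ht K).2 hK, response, h1, h2,
      le_antisymm m4 m3]
    ring

theorem η₁_eq {lam : ℝ} (h : lam ∈ Ico (0 : ℝ) 1) :
    η₁ lam = (symResponse lam + antiResponse lam) / 2 :=
  (hasNormalDeriv_h₁ h).1.limUnder_eq

theorem η₂_eq {lam : ℝ} (h : lam ∈ Ico (0 : ℝ) 1) :
    η₂ lam = (antiResponse lam - symResponse lam) / 2 := by
  have h1 : normalDeriv (h₁ lam) 2 = _ := (hasNormalDeriv_h₁ h).2.limUnder_eq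
  rw [η₂, h1, neg_neg]

/-! ### Harmonic means as positive linear functionals -/

theorem meanApprox_congr {lam : ℝ} (h : lam ∈ Ico (0 : ℝ) 1) (n : ℕ) {f g : Plane → ℝ}
    (hfg : EqOn f g (upperBoundary lam)) : meanApprox n lam f = meanApprox n lam g := by
  induction n generalizing lam f g with
  | zero => simp only [meanApprox, hfg (smul_q_zero_mem_upperBoundary h)]
  | succ n ih =>
    have hs := shift_mem h
    have key : ∀ i : Fin 3, (i = 0 ↔ digit lam 0 = 0) →
        meanApprox n (shift lam) (f ∘ F i) = meanApprox n (shift lam) (g ∘ F i) :=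
      fun i hi => ih hs fun x hx => hfg (F_mem_upperBoundary h hi hx)
    rcases digit_eq_zero_or_one lam 0 with h0 | h0
    · rw [meanApprox, meanApprox, if_pos h0, if_pos h0, key 0 (by simp [h0])]
    · rw [meanApprox, meanApprox, if_neg (by simp [h0]), if_neg (by simp [h0]),
        key 1 (by simp [h0]), key 2 (by simp [h0])]

theorem meanApprox_linear (n : ℕ) (lam s t : ℝ) (f g : Plane → ℝ) :
    meanApprox n lam (fun x => s * f x + t * g x) =
      (s * (meanApprox n lam f).1 + t * (meanApprox n lam g).1,
        s * (meanApprox n lam f).2 + t * (meanApprox n lam g).2) := by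
  induction n generalizing lam f g with
  | zero => rfl
  | succ n ih =>
    have e : ∀ i : Fin 3, (fun x => s * f x + t * g x) ∘ F i =
        fun x => s * (f ∘ F i) x + t * (g ∘ F i) x := fun _ => rfl
    simp only [meanApprox, e, ih]
    split_ifs <;> simp only [meanStepZero, meanStepOne] <;> ext <;> simp only <;> ring

/-- The combination of the two harmonic means of `f` with the weights `c 0` and `c 1`. -/
noncomputable def weightedMean (lam : ℝ) (c : Fin 2 → ℝ) (f : Plane → ℝ) : ℝ :=
  c 0 * mean₁ lam f + c 1 * mean₂ lam f

theorem weightedMean_congr {lam : ℝ} (h : lam ∈ Ico (0 : ℝ) 1) (c : Fin 2 → ℝ) {f g : Plane → ℝ}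
    (hfg : EqOn f g (upperBoundary lam)) : weightedMean lam c f = weightedMean lam c g := by
  simp only [weightedMean, mean₁, mean₂, meanApprox_congr h _ hfg]

theorem weightedMean_linear {lam : ℝ} (h : lam ∈ Ico (0 : ℝ) 1) (c : Fin 2 → ℝ) (s t : ℝ)
    {f g : Plane → ℝ} (hf : ContinuousOn f (upperBoundary lam))
    (hg : ContinuousOn g (upperBoundary lam)) :
    weightedMean lam c (fun x => s * f x + t * g x) =
      s * weightedMean lam c f + t * weightedMean lam c g := by
  obtain ⟨t1, t2⟩ := tendsto_mean h hf
  obtain ⟨t3, t4⟩ := tendsto_mean h hg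
  have hfg : ContinuousOn (fun x => s * f x + t * g x) (upperBoundary lam) :=
    (continuousOn_const.mul hf).add (continuousOn_const.mul hg)
  obtain ⟨t5, t6⟩ := tendsto_mean h hfg
  have e1 : mean₁ lam (fun x => s * f x + t * g x) = s * mean₁ lam f + t * mean₁ lam g := by
    refine tendsto_nhds_unique t5 ?_
    simp only [meanApprox_linear]
    exact (t1.const_mul s).add (t3.const_mul t)
  have e2 : mean₂ lam (fun x => s * f x + t * g x) = s * mean₂ lam f + t * mean₂ lam g := by
    refine tendsto_nhds_unique t6 ?_
    simp only [meanApprox_linear]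
    exact (t2.const_mul s).add (t4.const_mul t)
  rw [weightedMean, weightedMean, weightedMean, e1, e2]
  ring

theorem weightedMean_of_eqOn_const {lam : ℝ} (h : lam ∈ Ico (0 : ℝ) 1) {c : Fin 2 → ℝ}
    {f : Plane → ℝ} {b : ℝ} (hf : ∀ x ∈ upperBoundary lam, f x = b) :
    weightedMean lam c f = (c 0 + c 1) * b := by
  obtain ⟨⟨h1, h2⟩, h3, h4⟩ := mean_mem_Icc (L := b) (U := b) h
    (continuousOn_const.congr hf) fun x hx => by simp [hf x hx]
  rw [weightedMean, le_antisymm h2 h1, le_antisymm h4 h3]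
  ring

theorem weightedMean_nonneg {lam : ℝ} (h : lam ∈ Ico (0 : ℝ) 1) {c : Fin 2 → ℝ} (hc : 0 ≤ c)
    {f : Plane → ℝ} (hf : ContinuousOn f (upperBoundary lam))
    (h0 : ∀ x ∈ upperBoundary lam, 0 ≤ f x) : 0 ≤ weightedMean lam c f := by
  obtain ⟨U, hU⟩ := ((isCompact_upperBoundary lam).image_of_continuousOn hf).bddAbove
  obtain ⟨⟨h1, -⟩, h2, -⟩ := mean_mem_Icc (L := 0) (U := U) h hf
    fun x hx => ⟨h0 x hx, hU ⟨x, hx, rfl⟩⟩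
  exact add_nonneg (mul_nonneg (hc 0) h1) (mul_nonneg (hc 1) h2)

/-! ### The pieces of the upper boundary -/

/-- The indicator function of the cell of a word. -/
noncomputable def cellIndicator (w : List (Fin 3)) : Plane → ℝ :=
  indicator (cellMap w '' SG) fun _ => 1

theorem cell_inter_upperBoundary_cons {lam : ℝ} (h : lam ∈ Ico (0 : ℝ) 1) {i : Fin 3}
    (hi : i = 0 ↔ digit lam 0 = 0) (w : List (Fin 3)) :
    cellMap (i :: w) '' SG ∩ upperBoundary lam =
      F i '' (cellMap w '' SG ∩ upperBoundary (shift lam)) := by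
  ext x
  constructor
  · rintro ⟨⟨z, hz, rfl⟩, hx⟩
    obtain ⟨j, hj, y, hy, hyz⟩ := exists_of_mem_upperBoundary h hx
    have hyz' : F j y = F i (cellMap w z) := hyz
    by_cases hij : j = i
    · subst hij
      obtain rfl := F_injective j hyz'
      exact ⟨_, ⟨⟨z, hz, rfl⟩, hy⟩, rfl⟩
    · -- The cells `i`, `j` share only `F j (q i)`, and `q i` is not on the upper boundary.
      have hy2 := (eq_q_of_F_eq hij (upperBoundary_subset_SG _ hy) (cellMap_mem_SG w hz) hyz').1
      refine absurd (hy2 ▸ hy) (q_notMem_upperBoundary (shift_mem h) fun hi0 => hij ?_)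
      rw [hi0, hj, ← hi, hi0]
  · rintro ⟨_, ⟨⟨z, hz, rfl⟩, hy⟩, rfl⟩
    exact ⟨⟨z, hz, rfl⟩, F_mem_upperBoundary h hi hy⟩

theorem cellIndicator_nil {x : Plane} (hx : x ∈ SG) : cellIndicator [] x = 1 :=
  indicator_of_mem (s := cellMap [] '' SG) ⟨x, hx, rfl⟩ _

theorem cellIndicator_cons_comp_F (i : Fin 3) (w : List (Fin 3)) :
    cellIndicator (i :: w) ∘ F i = cellIndicator w := by
  funext y
  have h1 : F i y ∈ cellMap (i :: w) '' SG ↔ y ∈ cellMap w '' SG := by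
    constructor
    · rintro ⟨z, hz, hzy⟩
      exact ⟨z, hz, F_injective i hzy⟩
    · rintro ⟨z, hz, rfl⟩
      exact ⟨z, hz, rfl⟩
  classical
  simp only [cellIndicator, Function.comp_apply, indicator_apply, h1]

theorem cellIndicator_cons_comp_F_of_ne {lam : ℝ} (h : lam ∈ Ico (0 : ℝ) 1) {i j : Fin 3}
    (hi : i = 0 ↔ digit lam 0 = 0) (hj : j = 0 ↔ digit lam 0 = 0) (hij : i ≠ j)
    (w : List (Fin 3)) :
    ∀ y ∈ upperBoundary (shift lam), (cellIndicator (i :: w) ∘ F j) y = 0 := by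
  intro y hy
  have hnot : F j y ∉ cellMap (i :: w) '' SG := by
    rintro ⟨z, hz, hzy⟩
    have hzy' : F i (cellMap w z) = F j y := hzy
    have := (eq_q_of_F_eq hij (cellMap_mem_SG w hz) (upperBoundary_subset_SG _ hy) hzy').2
    refine absurd (this ▸ hy) (q_notMem_upperBoundary (shift_mem h) fun hi0 => hij ?_)
    rw [hi0, eq_comm, hj, ← hi, hi0]
  rw [Function.comp_apply, cellIndicator, indicator_of_notMem hnot]

/-- The homeomorphism of the plane given by `F i`. -/
noncomputable def FHomeomorph (i : Fin 3) : Plane ≃ₜ Plane where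
  toFun := F i
  invFun x := (2 : ℝ) • x - q i
  left_inv x := by simp [F, smul_smul]
  right_inv x := by simp [F, smul_smul]
  continuous_toFun := continuous_F i
  continuous_invFun := by fun_prop

theorem continuousOn_image_F {f : Plane → ℝ} {i : Fin 3} {s : Set Plane}
    (hf : ContinuousOn (f ∘ F i) s) : ContinuousOn f (F i '' s) := by
  have h1 : f = (f ∘ F i) ∘ (FHomeomorph i).symm := by
    funext x
    exact (congrArg f ((FHomeomorph i).apply_symm_apply x)).symm
  rw [h1]
  refine hf.comp (FHomeomorph i).symm.continuous.continuousOn ?_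
  rintro _ ⟨y, hy, rfl⟩
  have : (FHomeomorph i).symm (F i y) = y := (FHomeomorph i).symm_apply_apply y
  rwa [this]

theorem isClosed_F_image_upperBoundary (lam : ℝ) (i : Fin 3) :
    IsClosed (F i '' upperBoundary lam) :=
  ((isCompact_upperBoundary lam).image (continuous_F i)).isClosed

theorem continuousOn_upperBoundary_of_comp_F {lam : ℝ} (h : lam ∈ Ico (0 : ℝ) 1) {f : Plane → ℝ}
    (hf : ∀ i : Fin 3, (i = 0 ↔ digit lam 0 = 0) →
      ContinuousOn (f ∘ F i) (upperBoundary (shift lam))) :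
    ContinuousOn f (upperBoundary lam) := by
  rcases digit_eq_zero_or_one lam 0 with h0 | h0
  · rw [upperBoundary_of_digit_zero h h0]
    exact continuousOn_image_F (hf 0 (by simp [h0]))
  · rw [upperBoundary_of_digit_one h h0]
    exact (continuousOn_image_F (hf 1 (by simp [h0]))).union_of_isClosed
      (continuousOn_image_F (hf 2 (by simp [h0])))
      (isClosed_F_image_upperBoundary _ 1) (isClosed_F_image_upperBoundary _ 2)

theorem continuousOn_cellIndicator {lam : ℝ} (h : lam ∈ Ico (0 : ℝ) 1) {w : List (Fin 3)}
    (hw : IsBoundaryWord lam w) : ContinuousOn (cellIndicator w) (upperBoundary lam) := by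
  induction w generalizing lam with
  | nil =>
    exact (continuousOn_const (c := (1 : ℝ))).congr fun x hx =>
      cellIndicator_nil (upperBoundary_subset_SG _ hx)
  | cons i w ih =>
    obtain ⟨hi, hw'⟩ := (isBoundaryWord_cons h i w).1 hw
    refine continuousOn_upperBoundary_of_comp_F h fun j hj => ?_
    by_cases hij : i = j
    · subst hij
      exact (cellIndicator_cons_comp_F i w).symm ▸ ih (shift_mem h) hw'
    · exact (continuousOn_const (c := (0 : ℝ))).congr
        (cellIndicator_cons_comp_F_of_ne h hi hj hij w)

/-- The vector with the normal derivatives at the two bottom corners of the harmonic function with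
values `c 0` and `c 1` there and `0` on the upper boundary. -/
noncomputable def fluxVector (lam : ℝ) (c : Fin 2 → ℝ) : Fin 2 → ℝ :=
  ![η₁ lam * c 0 - η₂ lam * c 1, η₁ lam * c 1 - η₂ lam * c 0]

/-- The values at the two bottom corners of the cell `i` of the harmonic function with values
`c 0`, `c 1` at the bottom corners of the domain and `0` on the upper boundary. -/
noncomputable def cornerValues (lam : ℝ) (i : Fin 3) (c : Fin 2 → ℝ) : Fin 2 → ℝ :=
  ![![upperValue (symResponse (shift lam)) (antiResponse (shift lam)) (c 0) (c 1) 0 0,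
      upperValue (symResponse (shift lam)) (antiResponse (shift lam)) (c 1) (c 0) 0 0],
    ![c 0, middleValue (symResponse (shift lam)) (antiResponse (shift lam)) (c 0) (c 1) 0 0],
    ![middleValue (symResponse (shift lam)) (antiResponse (shift lam)) (c 0) (c 1) 0 0, c 1]] i

/-- The matrices `M_i` transport normal derivatives: they describe how the flux of a harmonic
function through the bottom corners determines its flux through the bottom corners of a cell. -/
theorem stepMatrix_mulVec {lam : ℝ} (h : lam ∈ Ico (0 : ℝ) 1) {i : Fin 3}
    (hi : i = 0 ↔ digit lam 0 = 0) (c : Fin 2 → ℝ) :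
    (stepMatrix (η₁ (shift lam)) (η₂ (shift lam)) i).mulVec (fluxVector lam c) =
      (5 / 3 : ℝ) • fluxVector (shift lam) (cornerValues lam i c) := by
  have hs := shift_mem h
  have h1 := one_le_symResponse hs
  have h2 := three_le_antiResponse hs
  simp only [fluxVector, cornerValues, stepMatrix, η₁_eq h, η₂_eq h, η₁_eq hs, η₂_eq hs,
    upperValue, middleValue]
  rcases digit_eq_zero_or_one lam 0 with h0 | h0
  · obtain ⟨e1, e2⟩ := response_of_digit_zero h h0
    rw [e1, e2, hi.2 h0]
    generalize symResponse (shift lam) = p at *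
    generalize antiResponse (shift lam) = r at *
    have h3 : 2 * p + 3 ≠ 0 := by linarith
    have h4 : r + 2 ≠ 0 := by linarith
    have h5 : (6 + 4 * ((p + r) / 2) + 4 * ((r - p) / 2)) = 2 * (2 * r + 3) := by ring
    have h6 : 2 * r + 3 ≠ 0 := by linarith
    rw [h5]
    ext k
    fin_cases k
    · simp [Matrix.mulVec, dotProduct]
      field_simp
      ring
    · simp [Matrix.mulVec, dotProduct]
      field_simp
      ring
  · obtain ⟨e1, e2⟩ := response_of_digit_one h h0
    rw [e1, e2]
    have hi0 : i ≠ 0 := fun hi0 => by simp [h0] at hi; exact hi hi0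
    generalize symResponse (shift lam) = p at *
    generalize antiResponse (shift lam) = r at *
    have h3 : p + r ≠ 0 := by linarith
    fin_cases i
    · exact absurd rfl hi0
    all_goals
      ext k
      fin_cases k
      all_goals
        simp [Matrix.mulVec, dotProduct]
        field_simp
        ring

/-- The contributions of the cells to a weighted harmonic mean. -/
theorem weightedMean_of_digit_zero {lam : ℝ} (h : lam ∈ Ico (0 : ℝ) 1) (h0 : digit lam 0 = 0)
    (c : Fin 2 → ℝ) {f : Plane → ℝ} (hf : ContinuousOn f (upperBoundary lam)) :
    symResponse lam * weightedMean lam c f = 5 / 3 * symResponse (shift lam) *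
      weightedMean (shift lam) (cornerValues lam 0 c) (f ∘ F 0) := by
  have hs := shift_mem h
  have h1 := one_le_symResponse hs
  have h2 := three_le_antiResponse hs
  have hm := mean_of_digit_zero h h0 hf
  rw [meanStepZero, Prod.mk.injEq] at hm
  obtain ⟨e1, -⟩ := response_of_digit_zero h h0
  simp only [weightedMean, hm.1, hm.2, e1, cornerValues, upperValue, Matrix.cons_val]
  generalize symResponse (shift lam) = p at *
  generalize antiResponse (shift lam) = r at *
  have h3 : 2 * p + 3 ≠ 0 := by linarith
  have h4 : r + 2 ≠ 0 := by linarith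
  field_simp
  ring

theorem weightedMean_of_digit_one {lam : ℝ} (h : lam ∈ Ico (0 : ℝ) 1) (h0 : digit lam 0 = 1)
    (c : Fin 2 → ℝ) {f : Plane → ℝ} (hf : ContinuousOn f (upperBoundary lam)) :
    symResponse lam * weightedMean lam c f = 5 / 3 * symResponse (shift lam) *
      (weightedMean (shift lam) (cornerValues lam 1 c) (f ∘ F 1) +
        weightedMean (shift lam) (cornerValues lam 2 c) (f ∘ F 2)) := by
  have hs := shift_mem h
  have h1 := one_le_symResponse hs
  have h2 := three_le_antiResponse hs
  have hm := mean_of_digit_one h h0 hf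
  rw [meanStepOne, Prod.mk.injEq] at hm
  obtain ⟨e1, -⟩ := response_of_digit_one h h0
  simp only [weightedMean, hm.1, hm.2, e1, cornerValues, middleValue, Matrix.cons_val]
  generalize symResponse (shift lam) = p at *
  generalize antiResponse (shift lam) = r at *
  have h3 : p + r ≠ 0 := by linarith
  have h4 : r ≠ 0 := by linarith
  field_simp
  ring

/-- The weighted mean of the indicator function of a piece of the upper boundary is the value that
the matrices `M_w` prescribe. -/
theorem dotProduct_wordMatrix {lam : ℝ} (h : lam ∈ Ico (0 : ℝ) 1) {w : List (Fin 3)}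
    (hw : IsBoundaryWord lam w) (c : Fin 2 → ℝ) :
    dotProduct ![(1 : ℝ), 1] ((wordMatrix lam w).mulVec (fluxVector lam c)) =
      symResponse lam * weightedMean lam c (cellIndicator w) := by
  induction w generalizing lam c with
  | nil =>
    rw [weightedMean_of_eqOn_const h (b := 1) fun x hx =>
      cellIndicator_nil (upperBoundary_subset_SG _ hx)]
    simp only [wordMatrix, Matrix.one_mulVec, fluxVector, η₁_eq h, η₂_eq h]
    simp [dotProduct, Fin.sum_univ_two]
    ring
  | cons i w ih =>
    have hs := shift_mem h
    have hcont := continuousOn_cellIndicator h hw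
    obtain ⟨hi, hw'⟩ := (isBoundaryWord_cons h i w).1 hw
    have e : dotProduct ![(1 : ℝ), 1] ((wordMatrix lam (i :: w)).mulVec (fluxVector lam c)) =
        5 / 3 * symResponse (shift lam) *
          weightedMean (shift lam) (cornerValues lam i c) (cellIndicator w) := by
      rw [wordMatrix, ← Matrix.mulVec_mulVec, stepMatrix_mulVec h hi, Matrix.mulVec_smul,
        dotProduct_smul, ih hs hw', smul_eq_mul, mul_assoc]
    have same := congrArg (weightedMean (shift lam) (cornerValues lam i c))
      (cellIndicator_cons_comp_F i w)
    have other : ∀ j : Fin 3, (j = 0 ↔ digit lam 0 = 0) → i ≠ j →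
        weightedMean (shift lam) (cornerValues lam j c) (cellIndicator (i :: w) ∘ F j) = 0 := by
      intro j hj hij
      rw [weightedMean_of_eqOn_const hs (cellIndicator_cons_comp_F_of_ne h hi hj hij w), mul_zero]
    rw [e]
    rcases digit_eq_zero_or_one lam 0 with h0 | h0
    · obtain rfl := hi.2 h0
      rw [weightedMean_of_digit_zero h h0 c hcont, same]
    · have hi0 : i ≠ 0 := fun hi0 => by simp [h0] at hi; exact hi hi0
      rw [weightedMean_of_digit_one h h0 c hcont, ← same]
      have hi12 : i = 1 ∨ i = 2 := by
        clear hw hcont hi e same other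
        revert i; decide
      rcases hi12 with rfl | rfl
      · rw [other 2 (by simp [h0]) (by decide), add_zero]
      · rw [other 1 (by simp [h0]) (by decide), zero_add]

/-! ### Existence and uniqueness of the boundary measures -/

open CompactlySupported in
/-- A weighted harmonic mean is the integral for a probability measure on the upper boundary, by
the Riesz representation theorem. -/
theorem exists_measure_weightedMean {lam : ℝ} (h : lam ∈ Ico (0 : ℝ) 1) {c : Fin 2 → ℝ}
    (hc : 0 ≤ c) (hc1 : c 0 + c 1 = 1) :
    ∃ μ : Measure Plane, IsProbabilityMeasure μ ∧ μ (upperBoundary lam)ᶜ = 0 ∧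
      ∀ f, ContinuousOn f (upperBoundary lam) →
        ∫ x in upperBoundary lam, f x ∂μ = weightedMean lam c f := by
  have : CompactSpace (upperBoundary lam) :=
    isCompact_iff_compactSpace.1 (isCompact_upperBoundary lam)
  have hmeas : MeasurableSet (upperBoundary lam) := (isCompact_upperBoundary lam).measurableSet
  let E : (upperBoundary lam → ℝ) → Plane → ℝ := fun g => Function.extend Subtype.val g 0
  have hE : ∀ g x (hx : x ∈ upperBoundary lam), E g x = g ⟨x, hx⟩ := fun g x hx =>
    Subtype.val_injective.extend_apply g 0 ⟨x, hx⟩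
  have hEc : ∀ g : C_c(upperBoundary lam, ℝ), ContinuousOn (E g) (upperBoundary lam) := by
    intro g
    rw [continuousOn_iff_continuous_domRestrict]
    convert! g.continuous
    ext x
    exact hE _ x x.2
  let L : C_c(upperBoundary lam, ℝ) →ₗ[ℝ] ℝ :=
    { toFun := fun g => weightedMean lam c (E g)
      map_add' := fun g g' => by
        have := weightedMean_linear h c 1 1 (hEc g) (hEc g')
        rw [one_mul, one_mul] at this
        rw [← this]
        refine weightedMean_congr h c fun x hx => ?_
        simp only [hE _ x hx]
        simp
      map_smul' := fun s g => by
        have := weightedMean_linear h c s 0 (hEc g) (hEc g)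
        rw [zero_mul, add_zero] at this
        rw [RingHom.id_apply, smul_eq_mul, ← this]
        refine weightedMean_congr h c fun x hx => ?_
        simp only [hE _ x hx]
        simp }
  let Λ : C_c(upperBoundary lam, ℝ) →ₚ[ℝ] ℝ := PositiveLinearMap.mk₀ L fun g hg =>
    weightedMean_nonneg h hc (hEc g) fun x hx => by
      rw [hE _ x hx]
      exact hg ⟨x, hx⟩
  let m := RealRMK.rieszMeasure Λ
  have hm : ∀ g : C_c(upperBoundary lam, ℝ), ∫ y, g y ∂m = weightedMean lam c (E g) :=
    fun g => RealRMK.integral_rieszMeasure Λ g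
  have hemb : MeasurableEmbedding (Subtype.val : upperBoundary lam → Plane) :=
    MeasurableEmbedding.subtype_coe hmeas
  have hnull : m.map Subtype.val (upperBoundary lam)ᶜ = 0 := by
    rw [hemb.map_apply]
    simp
  have hint : ∀ f, ContinuousOn f (upperBoundary lam) →
      ∫ x in upperBoundary lam, f x ∂(m.map Subtype.val) = weightedMean lam c f := by
    intro f hf
    have hr := continuousOn_iff_continuous_domRestrict.1 hf
    rw [hemb.setIntegral_map]
    simp only [Subtype.coe_preimage_self, Measure.restrict_univ]
    rw [show ∫ y : upperBoundary lam, f y ∂m = _ from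
      hm (CompactlySupportedContinuousMap.continuousMapEquiv ⟨_, hr⟩)]
    refine weightedMean_congr h c fun x hx => ?_
    rw [hE _ x hx]
    rfl
  refine ⟨m.map Subtype.val, ?_, hnull, hint⟩
  have h1 := hint (fun _ => 1) continuousOn_const
  rw [weightedMean_of_eqOn_const h (b := 1) fun _ _ => rfl, hc1, setIntegral_const] at h1
  have h2 : (m.map Subtype.val).real (upperBoundary lam) = 1 := by simpa using h1
  have h3 : m.map Subtype.val (upperBoundary lam) = 1 := by
    rwa [Measure.real, ENNReal.toReal_eq_one_iff] at h2
  refine ⟨?_⟩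
  rw [← measure_add_measure_compl hmeas, hnull, h3, add_zero]

theorem measurableSet_cell (w : List (Fin 3)) : MeasurableSet (cellMap w '' SG) :=
  (isCompact_SG.image (continuous_cellMap w)).measurableSet

theorem isBoundaryMeasure_of_integral {lam : ℝ} (h : lam ∈ Ico (0 : ℝ) 1) {c : Fin 2 → ℝ}
    {μ : Measure Plane} (hμ : IsProbabilityMeasure μ) (h0 : μ (upperBoundary lam)ᶜ = 0)
    (hint : ∀ f, ContinuousOn f (upperBoundary lam) →
      ∫ x in upperBoundary lam, f x ∂μ = weightedMean lam c f) :
    IsBoundaryMeasure lam (fluxVector lam c) μ := by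
  refine ⟨hμ, h0, fun w hw => ?_⟩
  have h1 := one_le_symResponse h
  have e1 : η₁ lam - η₂ lam = symResponse lam := by rw [η₁_eq h, η₂_eq h]; ring
  have e2 := hint _ (continuousOn_cellIndicator h hw)
  rw [dotProduct_wordMatrix h hw, e1, ← e2]
  unfold cellIndicator
  rw [setIntegral_indicator (measurableSet_cell w), setIntegral_const, inter_comm, smul_eq_mul,
    mul_one, ← mul_assoc, one_div_mul_cancel (by linarith), one_mul]

theorem setIntegral_F_image {μ : Measure Plane} (i : Fin 3) (s : Set Plane) (f : Plane → ℝ) :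
    ∫ x in F i '' s, f x ∂μ = ∫ x in s, (f ∘ F i) x ∂(μ.comap (F i)) := by
  have hemb : MeasurableEmbedding (F i) := (FHomeomorph i).measurableEmbedding
  have hr : range (F i) = univ := (FHomeomorph i).surjective.range_eq
  have : μ = (μ.comap (F i)).map (F i) := by
    rw [hemb.map_comap, hr, Measure.restrict_univ]
  conv_lhs => rw [this]
  rw [hemb.setIntegral_map, preimage_image_eq _ (F_injective i)]
  rfl

theorem comap_F_real {μ : Measure Plane} (i : Fin 3) (s : Set Plane) :
    (μ.comap (F i)).real s = μ.real (F i '' s) := by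
  have hemb : MeasurableEmbedding (F i) := (FHomeomorph i).measurableEmbedding
  rw [Measure.real, Measure.real, hemb.comap_apply]

theorem cell_nil_inter_upperBoundary (lam : ℝ) :
    cellMap [] '' SG ∩ upperBoundary lam = upperBoundary lam := by
  rw [cellMap, image_id]
  exact inter_eq_right.2 (upperBoundary_subset_SG lam)

/-- The integral splits over the pieces of the upper boundary. -/
theorem setIntegral_upperBoundary_of_digit_one {lam : ℝ} (h : lam ∈ Ico (0 : ℝ) 1)
    (h0 : digit lam 0 = 1) {μ : Measure Plane} [IsFiniteMeasure μ] {f : Plane → ℝ}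
    (hf : ContinuousOn f (upperBoundary lam)) :
    ∫ x in upperBoundary lam, f x ∂μ =
      ∫ x in upperBoundary (shift lam), (f ∘ F 1) x ∂(μ.comap (F 1)) +
        ∫ x in upperBoundary (shift lam), (f ∘ F 2) x ∂(μ.comap (F 2)) := by
  have hint := hf.integrableOn_compact (μ := μ) (isCompact_upperBoundary lam)
  rw [upperBoundary_of_digit_one h h0] at hint ⊢
  rw [setIntegral_union ?_ (isClosed_F_image_upperBoundary _ 2).measurableSet
    (hint.mono_set subset_union_left) (hint.mono_set subset_union_right),
    setIntegral_F_image, setIntegral_F_image]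
  rw [Set.disjoint_left]
  rintro _ ⟨y, hy, rfl⟩ ⟨z, hz, hzy⟩
  have := (eq_q_of_F_eq (by decide) (upperBoundary_subset_SG _ hz)
    (upperBoundary_subset_SG _ hy) hzy).1
  exact absurd (this ▸ hz) (q_notMem_upperBoundary (shift_mem h) (by decide))

theorem setIntegral_upperBoundary_of_digit_zero {lam : ℝ} (h : lam ∈ Ico (0 : ℝ) 1)
    (h0 : digit lam 0 = 0) (μ : Measure Plane) (f : Plane → ℝ) :
    ∫ x in upperBoundary lam, f x ∂μ =
      ∫ x in upperBoundary (shift lam), (f ∘ F 0) x ∂(μ.comap (F 0)) := by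
  rw [upperBoundary_of_digit_zero h h0, setIntegral_F_image]

instance isFiniteMeasure_comap_F (μ : Measure Plane) [IsFiniteMeasure μ] (i : Fin 3) :
    IsFiniteMeasure (μ.comap (F i)) := by
  have hemb : MeasurableEmbedding (F i) := (FHomeomorph i).measurableEmbedding
  refine ⟨?_⟩
  rw [hemb.comap_apply]
  exact measure_lt_top _ _

/-- Two measures agree on the pieces of the upper boundary. -/
def AgreeOnPieces (lam : ℝ) (μ ν : Measure Plane) : Prop :=
  ∀ w, IsBoundaryWord lam w → μ.real (cellMap w '' SG ∩ upperBoundary lam) =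
    ν.real (cellMap w '' SG ∩ upperBoundary lam)

theorem AgreeOnPieces.comap_F {lam : ℝ} (h : lam ∈ Ico (0 : ℝ) 1) {μ ν : Measure Plane}
    (hμν : AgreeOnPieces lam μ ν) {i : Fin 3} (hi : i = 0 ↔ digit lam 0 = 0) :
    AgreeOnPieces (shift lam) (μ.comap (F i)) (ν.comap (F i)) := by
  intro w hw
  rw [comap_F_real, comap_F_real, ← cell_inter_upperBoundary_cons h hi]
  exact hμν _ ((isBoundaryWord_cons h i w).2 ⟨hi, hw⟩)

theorem isBoundaryWord_nil (lam : ℝ) : IsBoundaryWord lam [] := fun k hk => by simp at hk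

theorem NarrowData.abs_integral_sub_le {ε lam : ℝ} {f : Plane → ℝ} (hn : NarrowData ε lam f)
    (h : lam ∈ Ico (0 : ℝ) 1) (hf : ContinuousOn f (upperBoundary lam)) {μ ν : Measure Plane}
    [IsFiniteMeasure μ] [IsFiniteMeasure ν] (hμν : AgreeOnPieces lam μ ν) :
    |∫ x in upperBoundary lam, f x ∂μ - ∫ x in upperBoundary lam, f x ∂ν| ≤
      2 * ε * μ.real (upperBoundary lam) := by
  induction hn generalizing μ ν with
  | narrow lam f hn =>
    have hX : μ.real (upperBoundary lam) = ν.real (upperBoundary lam) := by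
      have := hμν [] (isBoundaryWord_nil lam)
      rwa [cell_nil_inter_upperBoundary] at this
    obtain ⟨z, hz⟩ := upperBoundary_nonempty h
    have key : ∀ (ρ : Measure Plane) [IsFiniteMeasure ρ],
        |∫ x in upperBoundary lam, f x ∂ρ - ρ.real (upperBoundary lam) * f z| ≤
          ε * ρ.real (upperBoundary lam) := by
      intro ρ _
      have hint := hf.integrableOn_compact (μ := ρ) (isCompact_upperBoundary lam)
      have e : ∫ x in upperBoundary lam, f x ∂ρ - ρ.real (upperBoundary lam) * f z =
          ∫ x in upperBoundary lam, (f x - f z) ∂ρ := by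
        rw [integral_sub hint (integrable_const _), setIntegral_const, smul_eq_mul]
      rw [e, ← Real.norm_eq_abs]
      exact norm_setIntegral_le_of_norm_le_const (f := fun x => f x - f z)
        (measure_lt_top _ _) fun x hx => hn x hx z hz
    have k1 := abs_le.1 (key μ)
    have k2 := abs_le.1 (key ν)
    rw [← hX] at k2
    rw [abs_le]
    constructor <;> linarith [k1.1, k1.2, k2.1, k2.2]
  | split lam f _ ih =>
    have hs := shift_mem h
    have key : ∀ i : Fin 3, (i = 0 ↔ digit lam 0 = 0) →
        |∫ x in upperBoundary (shift lam), (f ∘ F i) x ∂(μ.comap (F i)) -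
          ∫ x in upperBoundary (shift lam), (f ∘ F i) x ∂(ν.comap (F i))| ≤
        2 * ε * (μ.comap (F i)).real (upperBoundary (shift lam)) := fun i hi =>
      ih i hi hs (continuousOn_comp_F h hf hi) (hμν.comap_F h hi)
    rcases digit_eq_zero_or_one lam 0 with h0 | h0
    · have k0 := key 0 (by simp [h0])
      rw [comap_F_real, ← upperBoundary_of_digit_zero h h0] at k0
      rwa [setIntegral_upperBoundary_of_digit_zero h h0,
        setIntegral_upperBoundary_of_digit_zero h h0]
    · have k1 := abs_le.1 (key 1 (by simp [h0]))
      have k2 := abs_le.1 (key 2 (by simp [h0]))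
      have e := setIntegral_upperBoundary_of_digit_one h h0 (μ := μ) (f := fun _ => 1)
        continuousOn_const
      simp only [Function.comp_def, setIntegral_const, smul_eq_mul, mul_one] at e
      rw [setIntegral_upperBoundary_of_digit_one h h0 hf,
        setIntegral_upperBoundary_of_digit_one h h0 hf, e, abs_le]
      constructor <;> linarith [k1.1, k1.2, k2.1, k2.2]

theorem IsBoundaryMeasure.unique {lam : ℝ} (h : lam ∈ Ico (0 : ℝ) 1) {c : Fin 2 → ℝ}
    {μ ν : Measure Plane} (hμ : IsBoundaryMeasure lam c μ) (hν : IsBoundaryMeasure lam c ν) :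
    μ = ν := by
  obtain ⟨hμ1, hμ2, hμ3⟩ := hμ
  obtain ⟨hν1, hν2, hν3⟩ := hν
  have hμν : AgreeOnPieces lam μ ν := fun w hw => (hμ3 w hw).trans (hν3 w hw).symm
  have hres : ∀ ρ : Measure Plane, ρ (upperBoundary lam)ᶜ = 0 →
      ρ.restrict (upperBoundary lam) = ρ := fun ρ hρ =>
    Measure.restrict_eq_self_of_ae_mem (mem_ae_iff.2 hρ)
  refine ext_of_forall_integral_eq_of_IsFiniteMeasure fun f => ?_
  rw [← hres μ hμ2, ← hres ν hν2]
  have hf : ContinuousOn f (upperBoundary lam) := f.continuous.continuousOn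
  refine eq_of_forall_dist_le fun ε hε => ?_
  have := (narrowData_of_continuousOn h hf (ε := ε / 2) (by linarith)).abs_integral_sub_le h hf hμν
  refine this.trans ?_
  have h1 : μ.real (upperBoundary lam) ≤ 1 := measureReal_le_one
  nlinarith

theorem existsUnique_isBoundaryMeasure {lam : ℝ} (h : lam ∈ Ico (0 : ℝ) 1) {c : Fin 2 → ℝ}
    (hc : 0 ≤ c) (hc1 : c 0 + c 1 = 1) :
    ∃! μ, IsBoundaryMeasure lam (fluxVector lam c) μ := by
  obtain ⟨μ, h1, h2, h3⟩ := exists_measure_weightedMean h hc hc1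
  have := isBoundaryMeasure_of_integral h h1 h2 h3
  exact ⟨μ, this, fun ν hν => hν.unique h this⟩

theorem setIntegral_of_isBoundaryMeasure {lam : ℝ} (h : lam ∈ Ico (0 : ℝ) 1) {c : Fin 2 → ℝ}
    (hc : 0 ≤ c) (hc1 : c 0 + c 1 = 1) {μ : Measure Plane}
    (hμ : IsBoundaryMeasure lam (fluxVector lam c) μ) {f : Plane → ℝ}
    (hf : ContinuousOn f (upperBoundary lam)) :
    ∫ x in upperBoundary lam, f x ∂μ = weightedMean lam c f := by
  obtain ⟨ν, h1, h2, h3⟩ := exists_measure_weightedMean h hc hc1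
  rw [hμ.unique h (isBoundaryMeasure_of_integral h h1 h2 h3), h3 f hf]

theorem coeff₁_eq (lam : ℝ) : coeff₁ lam = fluxVector lam ![1, 0] := by
  simp [coeff₁, fluxVector]

theorem coeff₂_eq (lam : ℝ) : coeff₂ lam = fluxVector lam ![0, 1] := by
  simp [coeff₂, fluxVector]

theorem weight_nonneg₁ : (0 : Fin 2 → ℝ) ≤ ![1, 0] := by
  intro i; fin_cases i <;> simp

theorem weight_nonneg₂ : (0 : Fin 2 → ℝ) ≤ ![0, 1] := by
  intro i; fin_cases i <;> simp

theorem existsUnique_μ₁ {lam : ℝ} (h : lam ∈ Ico (0 : ℝ) 1) :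
    ∃! μ, IsBoundaryMeasure lam (coeff₁ lam) μ := by
  rw [coeff₁_eq]
  exact existsUnique_isBoundaryMeasure h weight_nonneg₁ (by simp)

theorem existsUnique_μ₂ {lam : ℝ} (h : lam ∈ Ico (0 : ℝ) 1) :
    ∃! μ, IsBoundaryMeasure lam (coeff₂ lam) μ := by
  rw [coeff₂_eq]
  exact existsUnique_isBoundaryMeasure h weight_nonneg₂ (by simp)

theorem setIntegral_μ₁ {lam : ℝ} (h : lam ∈ Ico (0 : ℝ) 1) {f : Plane → ℝ}
    (hf : ContinuousOn f (upperBoundary lam)) :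
    ∫ x in upperBoundary lam, f x ∂(μ₁ lam) = mean₁ lam f := by
  have hμ : IsBoundaryMeasure lam (coeff₁ lam) (μ₁ lam) :=
    Classical.epsilon_spec (existsUnique_μ₁ h).exists
  rw [coeff₁_eq] at hμ
  rw [setIntegral_of_isBoundaryMeasure h weight_nonneg₁ (by simp) hμ hf]
  simp [weightedMean]

theorem setIntegral_μ₂ {lam : ℝ} (h : lam ∈ Ico (0 : ℝ) 1) {f : Plane → ℝ}
    (hf : ContinuousOn f (upperBoundary lam)) :
    ∫ x in upperBoundary lam, f x ∂(μ₂ lam) = mean₂ lam f := by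
  have hμ : IsBoundaryMeasure lam (coeff₂ lam) (μ₂ lam) :=
    Classical.epsilon_spec (existsUnique_μ₂ h).exists
  rw [coeff₂_eq] at hμ
  rw [setIntegral_of_isBoundaryMeasure h weight_nonneg₂ (by simp) hμ hf]
  simp [weightedMean]

/-! ### The values at the vertices of level one -/

theorem F_q_mem_V_one (i j : Fin 3) : F i (q j) ∈ V 1 :=
  mem_iUnion.2 ⟨i, q j, ⟨j, rfl⟩, rfl⟩

theorem F_q_mem_lowerDomain_iff {lam : ℝ} (i j : Fin 3) :
    F i (q j) ∈ lowerDomain lam ↔ i ≠ j ∧ F i (q j) 1 < 1 - lam := by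
  constructor
  · rintro ⟨⟨-, h1⟩, h2⟩
    refine ⟨?_, h2⟩
    rintro rfl
    exact h1 ⟨i, (F_fixed i).symm⟩
  · rintro ⟨hij, h2⟩
    refine ⟨⟨F_mem_SG i (q_mem_SG j), ?_⟩, h2⟩
    rintro ⟨k, hk⟩
    obtain ⟨h3, h4⟩ := eq_of_F_eq_q (q_mem_SG j) hk.symm
    exact hij (h3.trans (q_injective h4).symm)

theorem F_zero_q_height {j : Fin 3} (hj : j ≠ 0) : F 0 (q j) 1 = 1 / 2 := by
  rw [F_height_zero, q_height_of_ne hj]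
  norm_num

theorem F_one_q_two_height : F 1 (q 2) 1 = 0 := by
  rw [F_height_of_ne (by decide), q_height_of_ne (by decide)]
  norm_num

theorem V_one_inter_lowerDomain_of_digit_zero {lam : ℝ} (h : lam ∈ Ico (0 : ℝ) 1)
    (h0 : digit lam 0 = 0) :
    V 1 ∩ lowerDomain lam = {F 0 (q 1), F 0 (q 2), F 1 (q 2)} := by
  have hl := lt_half_of_digit h h0
  apply Subset.antisymm
  · rintro x ⟨hx, hx'⟩
    obtain ⟨i, _, ⟨j, rfl⟩, rfl⟩ := mem_iUnion.1 hx
    have hij := ((F_q_mem_lowerDomain_iff i j).1 hx').1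
    simp only [mem_insert_iff, mem_singleton_iff]
    fin_cases i <;> fin_cases j
    · exact absurd rfl hij
    · exact Or.inl rfl
    · exact Or.inr (Or.inl rfl)
    · exact Or.inl (F_q_comm 1 0)
    · exact absurd rfl hij
    · exact Or.inr (Or.inr rfl)
    · exact Or.inr (Or.inl (F_q_comm 2 0))
    · exact Or.inr (Or.inr (F_q_comm 2 1))
    · exact absurd rfl hij
  · rintro x (rfl | rfl | rfl)
    · refine ⟨F_q_mem_V_one _ _, (F_q_mem_lowerDomain_iff _ _).2 ⟨by decide, ?_⟩⟩
      rw [F_zero_q_height (by decide)]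
      linarith
    · refine ⟨F_q_mem_V_one _ _, (F_q_mem_lowerDomain_iff _ _).2 ⟨by decide, ?_⟩⟩
      rw [F_zero_q_height (by decide)]
      linarith
    · refine ⟨F_q_mem_V_one _ _, (F_q_mem_lowerDomain_iff _ _).2 ⟨by decide, ?_⟩⟩
      rw [F_one_q_two_height]
      linarith

theorem V_one_inter_lowerDomain_of_digit_one {lam : ℝ} (h : lam ∈ Ico (0 : ℝ) 1)
    (h0 : digit lam 0 = 1) : V 1 ∩ lowerDomain lam = {F 1 (q 2)} := by
  have hl := half_le_of_digit h h0
  apply Subset.antisymm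
  · rintro x ⟨hx, hx'⟩
    obtain ⟨i, _, ⟨j, rfl⟩, rfl⟩ := mem_iUnion.1 hx
    obtain ⟨hij, hlt⟩ := (F_q_mem_lowerDomain_iff i j).1 hx'
    have hi : i ≠ 0 := by
      rintro rfl
      rw [F_zero_q_height hij.symm] at hlt
      linarith
    have hj : j ≠ 0 := by
      rintro rfl
      rw [F_q_comm, F_zero_q_height hi] at hlt
      linarith
    rw [mem_singleton_iff]
    fin_cases i <;> fin_cases j
    · exact absurd rfl hij
    · exact absurd rfl hi
    · exact absurd rfl hi
    · exact absurd rfl hj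
    · exact absurd rfl hij
    · rfl
    · exact absurd rfl hj
    · exact F_q_comm 2 1
    · exact absurd rfl hij
  · rintro x rfl
    refine ⟨F_q_mem_V_one _ _, (F_q_mem_lowerDomain_iff _ _).2 ⟨by decide, ?_⟩⟩
    rw [F_one_q_two_height]
    linarith [h.2]

theorem solution_F_q {lam : ℝ} (h : lam ∈ Ico (0 : ℝ) 1) {f : Plane → ℝ}
    (hf : ContinuousOn f (upperBoundary lam)) (i j : Fin 3) :
    solution lam f (F i (q j)) = ((solutionState lam f).child i).val j := by
  have ht := tame_solutionState h hf
  have htc := ht.child i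
  rw [solution, CellSystem.toFun_F ht i (q_mem_SG j), CellSystem.toFun_q htc]
  rfl

theorem η₁_pos {lam : ℝ} (h : lam ∈ Ico (0 : ℝ) 1) : 0 < η₁ lam := by
  rw [η₁_eq h]
  linarith [one_le_symResponse h, three_le_antiResponse h]

theorem denom_eq {lam : ℝ} (h : lam ∈ Ico (0 : ℝ) 1) :
    denom (η₁ lam) (η₂ lam) = 2 * (2 * symResponse lam + 3) * (antiResponse lam + 2) := by
  rw [η₁_eq h, η₂_eq h, denom]
  ring

theorem denom_pos {lam : ℝ} (h : lam ∈ Ico (0 : ℝ) 1) : 0 < denom (η₁ lam) (η₂ lam) := by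
  have h1 := one_le_symResponse h
  have h2 := three_le_antiResponse h
  rw [denom_eq h]
  positivity

theorem upperValue_eq {lam : ℝ} (h : lam ∈ Ico (0 : ℝ) 1) (x x' m m' : ℝ) :
    upperValue (symResponse lam) (antiResponse lam) x x' m m' =
      (9 + 5 * η₁ lam + η₂ lam) / denom (η₁ lam) (η₂ lam) * x +
      (3 + η₁ lam + 5 * η₂ lam) / denom (η₁ lam) (η₂ lam) * x' +
      (7 + 4 * η₁ lam) * (η₁ lam - η₂ lam) / denom (η₁ lam) (η₂ lam) * m +
      (1 + 4 * η₂ lam) * (η₁ lam - η₂ lam) / denom (η₁ lam) (η₂ lam) * m' := by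
  have h1 := one_le_symResponse h
  have h2 := three_le_antiResponse h
  rw [denom_eq h, η₁_eq h, η₂_eq h, upperValue]
  have h3 : 2 * symResponse lam + 3 ≠ 0 := by linarith
  have h4 : antiResponse lam + 2 ≠ 0 := by linarith
  field_simp
  ring

theorem middleValue_eq {lam : ℝ} (h : lam ∈ Ico (0 : ℝ) 1) (x x' m m' : ℝ) :
    middleValue (symResponse lam) (antiResponse lam) x x' m m' =
      η₂ lam / (2 * η₁ lam) * (x + x') + (η₁ lam - η₂ lam) / (2 * η₁ lam) * (m + m') := by
  have h1 := one_le_symResponse h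
  have h2 := three_le_antiResponse h
  rw [η₁_eq h, η₂_eq h, middleValue]
  have h3 : symResponse lam + antiResponse lam ≠ 0 := by linarith
  field_simp
  ring

end SGLower

open SGLower in
theorem theorem4p6 (lam : ℝ) (hlam0 : 0 ≤ lam) (hlam1 : lam < 1)
    (f : Plane → ℝ) (hf : ContinuousOn f (lowerBoundary lam)) :
    -- existence and uniqueness of the solution on the closed domain
    (∃ u, IsDirichletSolution lam f u ∧
      ∀ v, IsDirichletSolution lam f v → EqOn v u (closedLowerDomain lam)) ∧
    -- the objects in the formulas are well defined
    (IsDirichletSolution (shift lam) data₁ (h₁ (shift lam)) ∧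
      HasNormalDeriv (h₁ (shift lam)) 1 (η₁ (shift lam)) ∧
      HasNormalDeriv (h₁ (shift lam)) 2 (-η₂ (shift lam)) ∧
      (∃! μ, IsBoundaryMeasure (shift lam) (coeff₁ (shift lam)) μ) ∧
      (∃! μ, IsBoundaryMeasure (shift lam) (coeff₂ (shift lam)) μ) ∧
      0 < η₁ (shift lam) ∧
      0 < denom (η₁ (shift lam)) (η₂ (shift lam))) ∧
    -- first binary digit `0`
    (digit lam 0 = 0 →
      V 1 ∩ lowerDomain lam = {F 0 (q 1), F 0 (q 2), F 1 (q 2)} ∧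
      ∀ u, IsDirichletSolution lam f u →
        u (F 0 (q 1)) =
          (9 + 5 * η₁ (shift lam) + η₂ (shift lam)) /
              denom (η₁ (shift lam)) (η₂ (shift lam)) * f (q 1) +
          (3 + η₁ (shift lam) + 5 * η₂ (shift lam)) /
              denom (η₁ (shift lam)) (η₂ (shift lam)) * f (q 2) +
          (7 + 4 * η₁ (shift lam)) * (η₁ (shift lam) - η₂ (shift lam)) /
              denom (η₁ (shift lam)) (η₂ (shift lam)) *
            (∫ x in upperBoundary (shift lam), f (F 0 x) ∂(μ₁ (shift lam))) +
          (1 + 4 * η₂ (shift lam)) * (η₁ (shift lam) - η₂ (shift lam)) /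
              denom (η₁ (shift lam)) (η₂ (shift lam)) *
            (∫ x in upperBoundary (shift lam), f (F 0 x) ∂(μ₂ (shift lam))) ∧
        u (F 0 (q 2)) =
          (9 + 5 * η₁ (shift lam) + η₂ (shift lam)) /
              denom (η₁ (shift lam)) (η₂ (shift lam)) * f (q 2) +
          (3 + η₁ (shift lam) + 5 * η₂ (shift lam)) /
              denom (η₁ (shift lam)) (η₂ (shift lam)) * f (q 1) +
          (7 + 4 * η₁ (shift lam)) * (η₁ (shift lam) - η₂ (shift lam)) /
              denom (η₁ (shift lam)) (η₂ (shift lam)) *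
            (∫ x in upperBoundary (shift lam), f (F 0 x) ∂(μ₂ (shift lam))) +
          (1 + 4 * η₂ (shift lam)) * (η₁ (shift lam) - η₂ (shift lam)) /
              denom (η₁ (shift lam)) (η₂ (shift lam)) *
            (∫ x in upperBoundary (shift lam), f (F 0 x) ∂(μ₁ (shift lam))) ∧
        u (F 1 (q 2)) = 1 / 4 * (u (F 0 (q 1)) + u (F 0 (q 2)) + f (q 1) + f (q 2))) ∧
    -- first binary digit `1`
    (digit lam 0 = 1 →
      V 1 ∩ lowerDomain lam = {F 1 (q 2)} ∧
      ∀ u, IsDirichletSolution lam f u →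
        u (F 1 (q 2)) =
          η₂ (shift lam) / (2 * η₁ (shift lam)) * (f (q 1) + f (q 2)) +
          (η₁ (shift lam) - η₂ (shift lam)) / (2 * η₁ (shift lam)) *
            ((∫ x in upperBoundary (shift lam), f (F 1 x) ∂(μ₂ (shift lam))) +
              ∫ x in upperBoundary (shift lam), f (F 2 x) ∂(μ₁ (shift lam)))) := by
  have h : lam ∈ Ico (0 : ℝ) 1 := ⟨hlam0, hlam1⟩
  have hs := shift_mem h
  have hf' : ContinuousOn f (upperBoundary lam) := hf.mono subset_union_left
  have hsol := isDirichletSolution_solution h hf'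
  have hfix : ∀ u, IsDirichletSolution lam f u → ∀ x ∈ V 1 ∩ lowerDomain lam,
      u x = solution lam f x := fun u hu x hx => hsol.eqOn h hu (Or.inl hx.2)
  refine ⟨⟨solution lam f, hsol, fun v hv => hsol.eqOn h hv⟩,
    ⟨isDirichletSolution_h₁ hs, ?_, ?_, existsUnique_μ₁ hs, existsUnique_μ₂ hs, η₁_pos hs,
      denom_pos hs⟩, fun h0 => ?_, fun h0 => ?_⟩
  · rw [η₁_eq hs]
    exact (hasNormalDeriv_h₁ hs).1
  · rw [η₂_eq hs]
    exact (hasNormalDeriv_h₁ hs).2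
  · have hV := V_one_inter_lowerDomain_of_digit_zero h h0
    refine ⟨hV, fun u hu => ?_⟩
    have hc := continuousOn_comp_F h hf' (i := 0) (by simp [h0])
    have u1 : u (F 0 (q 1)) = (upperValues lam f (f (q 1)) (f (q 2))).1 := by
      rw [hfix u hu _ (hV ▸ by simp), solution_F_q h hf']
      simp [solutionState, State.child, h0, State.val]
    have u2 : u (F 0 (q 2)) = (upperValues lam f (f (q 1)) (f (q 2))).2 := by
      rw [hfix u hu _ (hV ▸ by simp), solution_F_q h hf']
      simp [solutionState, State.child, h0, State.val]
    have u3 : u (F 1 (q 2)) = bottomValue lam f (f (q 1)) (f (q 2)) := by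
      rw [hfix u hu _ (hV ▸ by simp), solution_F_q h hf']
      simp [solutionState, State.child, h0, State.val]
    have i1 : ∫ x in upperBoundary (shift lam), f (F 0 x) ∂(μ₁ (shift lam)) =
        mean₁ (shift lam) (f ∘ F 0) := setIntegral_μ₁ hs hc
    have i2 : ∫ x in upperBoundary (shift lam), f (F 0 x) ∂(μ₂ (shift lam)) =
        mean₂ (shift lam) (f ∘ F 0) := setIntegral_μ₂ hs hc
    rw [i1, i2, u1, u2, u3, bottomValue, if_pos h0]
    exact ⟨upperValue_eq hs _ _ _ _, upperValue_eq hs _ _ _ _, by ring⟩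
  · have hV := V_one_inter_lowerDomain_of_digit_one h h0
    refine ⟨hV, fun u hu => ?_⟩
    have u3 : u (F 1 (q 2)) = bottomValue lam f (f (q 1)) (f (q 2)) := by
      rw [hfix u hu _ (hV ▸ by simp), solution_F_q h hf']
      simp [solutionState, State.child, h0, State.val]
    have i1 : ∫ x in upperBoundary (shift lam), f (F 1 x) ∂(μ₂ (shift lam)) =
        mean₂ (shift lam) (f ∘ F 1) :=
      setIntegral_μ₂ hs (continuousOn_comp_F h hf' (by simp [h0]))
    have i2 : ∫ x in upperBoundary (shift lam), f (F 2 x) ∂(μ₁ (shift lam)) =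
        mean₁ (shift lam) (f ∘ F 2) :=
      setIntegral_μ₁ hs (continuousOn_comp_F h hf' (by simp [h0]))
    rw [i1, i2, u3, bottomValue, if_neg (by simp [h0])]
    exact middleValue_eq hs _ _ _ _
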